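/- Let $S$ be a finite set of points in the plane. A polygonalization of $S$ is a simple polygon whose vertex set is $S$; a vertex of a simple polygon is reflex if its interior angle is greater than $\pi$ (angles equal to $\pi$ are allowed and count as convex). The reflexivity $\rho(S)$ is the minimum number of reflex vertices over all polygonalizations of $S$. The convex layers of $S$ are $S_1, S_2, \ldots$, where $S_i$ is the set of points of $S\setminus(S_1\cup\cdots\cup S_{i-1})$ that lie on the boundary of the convex hull of $S\setminus(S_1\cup\cdots\cup S_{i-1})$; $S$ has two layers if $S_2\neq\emptyset$ and $S_3=\emptyset$. Theorem. Every set $S$ of $n$ points in the plane with exactly two convex layers has a polygonalization, and $\rho(S)\le\lceil n/4\rceil$. This bound is tight in the worst case: for every $n\ge 4$ with $n\not\equiv 1\pmod 4$ there is a set $S$ of $n$ points with exactly two convex layers such that $\rho(S)=\lceil n/4\rceil$. -/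

import Mathlib

noncomputable section

namespace TwoLayer

/-- The Euclidean plane. -/
abbrev Plane : Type := EuclideanSpace ℝ (Fin 2)

/-! ### Convex layers -/

/-- What remains of `S` after its first `i` convex layers have been removed: at each step the
points lying on the boundary of the current convex hull are removed. -/
def remaining (S : Set Plane) : ℕ → Set Plane
  | 0 => S
  | i + 1 => remaining S i \ frontier (convexHull ℝ (remaining S i))

/-- The convex layers of `S`, counted from `0`: `layer S i` consists of the points that lie on the
boundary of the convex hull of what remains of `S` after removing the layers before it. -/
def layer (S : Set Plane) (i : ℕ) : Set Plane :=
  remaining S i ∩ frontier (convexHull ℝ (remaining S i))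

/-- `S` has exactly `k` convex layers (onion depth `k`). -/
def HasLayers (S : Set Plane) (k : ℕ) : Prop :=
  ∀ i : ℕ, (layer S i).Nonempty ↔ i < k

/-! ### Polygons, given by the cyclic sequence `p` of their vertices -/

variable {n : ℕ}

/-- The index cyclically following `i`. -/
def next (i : Fin n) : Fin n := finRotate n i

/-- The index cyclically preceding `i`. -/
def prev (i : Fin n) : Fin n := (finRotate n).symm i

/-- The `i`-th edge, joining the `i`-th vertex to the next one. -/
def edge (p : Fin n → Plane) (i : Fin n) : Set Plane := segment ℝ (p i) (p (next i))

/-- The polygon is simple: it has at least three vertices, they are distinct, and two different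
edges have no point in common except a common endpoint. -/
def IsSimplePolygon (p : Fin n → Plane) : Prop :=
  3 ≤ n ∧ Function.Injective p ∧
    ∀ i j : Fin n, i ≠ j →
      edge p i ∩ edge p j ⊆ {p i, p (next i)} ∩ {p j, p (next j)}

/-- The determinant of two plane vectors. -/
def cross (u v : Plane) : ℝ := u 0 * v 1 - u 1 * v 0

/-- The signed area enclosed by the closed polygonal curve; it is positive if a simple polygon is
traversed counterclockwise and negative if it is traversed clockwise. -/
def signedArea (p : Fin n → Plane) : ℝ := (∑ i : Fin n, cross (p i) (p (next i))) / 2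

/-- The polar angle of a nonzero plane vector. -/
def polarAngle (u : Plane) : ℝ := Complex.arg ⟨u 0, u 1⟩

/-- The angle in `[0, 2π)` by which one turns counterclockwise from the direction of `u` to the
direction of `v`. -/
def ccwAngle (u v : Plane) : ℝ :=
  toIcoMod Real.two_pi_pos 0 (polarAngle v - polarAngle u)

/-- The interior angle of a simple polygon at its `i`-th vertex. The interior lies to the left of
the edges if the polygon is traversed counterclockwise and to the right otherwise, so that the
angle is swept counterclockwise from the outgoing to the incoming edge in the first case and from
the incoming to the outgoing edge in the second. -/
def interiorAngle (p : Fin n → Plane) (i : Fin n) : ℝ :=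
  if 0 < signedArea p then ccwAngle (p (next i) - p i) (p (prev i) - p i)
  else ccwAngle (p (prev i) - p i) (p (next i) - p i)

/-- A vertex is reflex if its interior angle exceeds `π`. -/
def IsReflex (p : Fin n → Plane) (i : Fin n) : Prop := Real.pi < interiorAngle p i

/-- The number of reflex vertices. -/
def reflexCount (p : Fin n → Plane) : ℕ := {i : Fin n | IsReflex p i}.ncard

/-- A polygonalization of `S`: a simple polygon with vertex set `S`. -/
def IsPolygonalization (S : Finset Plane) (p : Fin S.card → Plane) : Prop :=
  IsSimplePolygon p ∧ Set.range p = (S : Set Plane)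

/-- The reflexivity of `S`: the minimum number of reflex vertices in a polygonalization of `S`
(`⊤` if `S` has no polygonalization). -/
def reflexivity (S : Finset Plane) : ℕ∞ :=
  ⨅ p : {p : Fin S.card → Plane // IsPolygonalization S p}, (reflexCount p.1 : ℕ∞)

end TwoLayer

end

/-! Upper bound. Let P and Q be the outer and the inner layer, with h and m points, and suppose that
the hull of Q has an interior point o. Sorting by polar angle about o turns both layers into
periodic counterclockwise sequences p and q in weakly convex position (`ConvexRing`). The outside of
the inner ring is a pinwheel of sectors: z lies in sector e if it sees the side from q e to q (e +
1) from outside but not the next side, and q (e + 1) is then a tangent point from z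
(`exists_inSector`, `ConvexRing.tangent`). The maximal runs of outer points in one sector are the
nodes, N in number (`exists_frame`).

The polygon runs along q and makes excursions to the outer points. If a node is visited between the
two ends of its side, only the entry q (e k) can be reflex, because the exit is the tangent point.
This alone gives N reflex vertices. To save some of them, consecutive nodes are paired. If their
sectors are adjacent, one excursion with one reflex vertex serves both. If exactly one sector lies
in between and the second node is a single point, one excursion still serves both but leaves out an
inner point; at another pair of this kind that point is inserted into a side as a spike, so that two
such pairs need three reflex vertices. In all other cases the two nodes are visited separately. Thus
a pair costs one plus half its `gapCost`, up to rounding of the total (`hasSuffix_zero`). Since 2N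
plus the sum of all gap costs is at most h + m (`sum_gapCost_le`), averaging over the cyclic shifts
of the pairing gives c exceptional vertices with 4c ≤ h + m + 3 (`exists_small_suffix`).

If Q is collinear, its points are inserted, in their order on the line, into a side of the outer
ring that the line crosses; one reflex vertex suffices (`reflexivity_le_one_of_line`).

Lower bound. Take h points of a parabola and m = 2⌈n/4⌉ - 1 ≤ h points slightly inside different
sides of their hull (`almostConvex_layeredPoint`). In every polygon on these points, and for each
inner point, there is a right turn at that point, or at its preceding neighbour on the hull, or
among the inner points visited immediately after that neighbour (`exists_right_turn_near`). A right
turn is charged at most twice in this way, so m is at most twice the number of reflex vertices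
(`card_inner_le_reflexCount`). Planarity enters through a parity count: whether two chords separate
each other is additive modulo 2 along paths (`crossing_eq_zero`). -/

noncomputable section

namespace TwoLayer

/-! ### Orientation of triples -/

/-- Twice the signed area of the triangle `a b c`. -/
def orient (a b c : Plane) : ℝ := cross (b - a) (c - a)

theorem orient_eq (a b c : Plane) :
    orient a b c = (b 0 - a 0) * (c 1 - a 1) - (b 1 - a 1) * (c 0 - a 0) := by
  simp [orient, cross]

theorem cross_sub_sub (a b c d : Plane) :
    cross (a - b) (c - d) = (a 0 - b 0) * (c 1 - d 1) - (a 1 - b 1) * (c 0 - d 0) := by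
  simp [cross]

theorem orient_rotate (a b c : Plane) : orient a b c = orient b c a := by
  simp only [orient_eq]; ring

theorem orient_swap (a b c : Plane) : orient a b c = -orient a c b := by
  simp only [orient_eq]; ring

theorem orient_swap_left (a b c : Plane) : orient a b c = -orient b a c := by
  simp only [orient_eq]; ring

@[simp] theorem orient_self_left (a b : Plane) : orient a a b = 0 := by
  simp only [orient_eq]; ring

@[simp] theorem orient_self_right (a b : Plane) : orient a b b = 0 := by
  simp only [orient_eq]; ring

@[simp] theorem orient_self_outer (a b : Plane) : orient a b a = 0 := by
  simp only [orient_eq]; ring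

theorem orient_add_orient (o u v w : Plane) :
    orient o u v + orient o v w = orient o u w + orient u v w := by
  simp only [orient_eq]; ring

theorem plane_ext {a b : Plane} (h0 : a 0 = b 0) (h1 : a 1 = b 1) : a = b := by
  ext i; fin_cases i <;> assumption

theorem mem_segment_coord {a b x : Plane} (h : x ∈ segment ℝ a b) :
    ∃ t : ℝ, 0 ≤ t ∧ t ≤ 1 ∧ x 0 = (1 - t) * a 0 + t * b 0 ∧ x 1 = (1 - t) * a 1 + t * b 1 := by
  obtain ⟨s, t, hs, ht, hst, rfl⟩ := h
  refine ⟨t, ht, by linarith, ?_, ?_⟩ <;> simp [← hst]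

theorem orient_of_coord {a b x : Plane} {t : ℝ} (h0 : x 0 = (1 - t) * a 0 + t * b 0)
    (h1 : x 1 = (1 - t) * a 1 + t * b 1) (u v : Plane) :
    orient u v x = (1 - t) * orient u v a + t * orient u v b := by
  simp only [orient_eq, h0, h1]; ring

/-- An affine functional on a segment, in the form needed throughout. -/
theorem orient_of_mem_segment {a b x : Plane} (h : x ∈ segment ℝ a b) :
    ∃ t : ℝ, 0 ≤ t ∧ t ≤ 1 ∧ (t = 0 → x = a) ∧ (t = 1 → x = b) ∧
      ∀ u v, orient u v x = (1 - t) * orient u v a + t * orient u v b := by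
  obtain ⟨t, ht0, ht1, h0, h1⟩ := mem_segment_coord h
  refine ⟨t, ht0, ht1, ?_, ?_, fun u v => orient_of_coord h0 h1 u v⟩
  · rintro rfl; exact plane_ext (by linarith) (by linarith)
  · rintro rfl; exact plane_ext (by linarith) (by linarith)

theorem convex_orient_nonneg (u v : Plane) : Convex ℝ {x : Plane | 0 ≤ orient u v x} := by
  rintro x hx y hy s t hs ht hst
  have : orient u v (s • x + t • y) = s * orient u v x + t * orient u v y := by
    have hs' : s = 1 - t := by linarith
    subst hs'
    exact orient_of_coord (by simp) (by simp) u v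
  simp only [Set.mem_ofPred_eq] at *
  rw [this]; positivity

/-! ### Compatible segments -/

/-- The two segments meet only in common endpoints. -/
def SegCompat (a b c d : Plane) : Prop :=
  segment ℝ a b ∩ segment ℝ c d ⊆ ({a, b} : Set Plane) ∩ {c, d}

theorem SegCompat.symm {a b c d : Plane} (h : SegCompat a b c d) : SegCompat c d a b := by
  rintro x ⟨h1, h2⟩; exact ⟨(h ⟨h2, h1⟩).2, (h ⟨h2, h1⟩).1⟩

theorem SegCompat.flip_left {a b c d : Plane} (h : SegCompat a b c d) : SegCompat b a c d := by
  unfold SegCompat; rw [segment_symm, Set.pair_comm]; exact h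

theorem SegCompat.flip_right {a b c d : Plane} (h : SegCompat a b c d) : SegCompat a b d c :=
  h.symm.flip_left.symm

/-- A common point must lie on the separating line. Neither segment is contained in that line, so
the point is an endpoint of each. -/
theorem segCompat_of_separated {u v a b c d : Plane} (ha : orient u v a ≤ 0)
    (hb : orient u v b ≤ 0) (hab : orient u v a ≠ 0 ∨ orient u v b ≠ 0)
    (hc : 0 ≤ orient u v c) (hd : 0 ≤ orient u v d) (hcd : orient u v c ≠ 0 ∨ orient u v d ≠ 0) :
    SegCompat a b c d := by
  rintro x ⟨h1, h2⟩
  obtain ⟨t, t0, t1, ta, tb, ht⟩ := orient_of_mem_segment h1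
  obtain ⟨s, s0, s1, sc, sd, hs⟩ := orient_of_mem_segment h2
  have e1 := ht u v
  have e2 := hs u v
  have m1 : (1 - t) * orient u v a ≤ 0 := mul_nonpos_of_nonneg_of_nonpos (by linarith) ha
  have m2 : t * orient u v b ≤ 0 := mul_nonpos_of_nonneg_of_nonpos t0 hb
  have m3 : 0 ≤ (1 - s) * orient u v c := mul_nonneg (by linarith) hc
  have m4 : 0 ≤ s * orient u v d := mul_nonneg s0 hd
  have z1 : (1 - t) * orient u v a = 0 := by linarith
  have z2 : t * orient u v b = 0 := by linarith
  have z3 : (1 - s) * orient u v c = 0 := by linarith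
  have z4 : s * orient u v d = 0 := by linarith
  constructor
  · rcases hab with h | h
    · right; exact tb (by rcases mul_eq_zero.1 z1 with h' | h' <;> [linarith; exact absurd h' h])
    · left; exact ta (by rcases mul_eq_zero.1 z2 with h' | h' <;> [linarith; exact absurd h' h])
  · rcases hcd with h | h
    · right; exact sd (by rcases mul_eq_zero.1 z3 with h' | h' <;> [linarith; exact absurd h' h])
    · left; exact sc (by rcases mul_eq_zero.1 z4 with h' | h' <;> [linarith; exact absurd h' h])

/-- A segment on a line and a segment leaving that line. -/
theorem segCompat_of_on_line {u v a b c d : Plane} (ha : orient u v a = 0) (hb : orient u v b = 0)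
    (hc : 0 ≤ orient u v c) (hd : 0 < orient u v d)
    (hcab : c ∈ segment ℝ a b → c = a ∨ c = b) : SegCompat a b c d := by
  rintro x ⟨h1, h2⟩
  obtain ⟨t, t0, t1, ta, tb, ht⟩ := orient_of_mem_segment h1
  obtain ⟨s, s0, s1, sc, sd, hs⟩ := orient_of_mem_segment h2
  have e1 := ht u v
  have e2 := hs u v
  rw [ha, hb] at e1
  have m3 : 0 ≤ (1 - s) * orient u v c := mul_nonneg (by linarith) hc
  have m4 : 0 ≤ s * orient u v d := mul_nonneg s0 hd.le
  have z4 : s * orient u v d = 0 := by linarith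
  have hxc : x = c := sc ((mul_eq_zero.1 z4).resolve_right hd.ne')
  subst hxc
  exact ⟨hcab h1, Or.inl rfl⟩

theorem segCompat_of_on_line' {u v a b c d : Plane} (ha : orient u v a = 0) (hb : orient u v b = 0)
    (hc : orient u v c ≤ 0) (hd : orient u v d < 0)
    (hcab : c ∈ segment ℝ a b → c = a ∨ c = b) : SegCompat a b c d := by
  rw [orient_swap_left] at ha hb hc hd
  exact segCompat_of_on_line (u := v) (v := u) (by linarith) (by linarith) (by linarith)
    (by linarith) hcab

/-! ### Angles -/

theorem norm_complex_pos {u : Plane} (hu : u ≠ 0) : 0 < ‖(⟨u 0, u 1⟩ : ℂ)‖ := by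
  rw [norm_pos_iff]
  intro h
  apply hu
  exact plane_ext (by simpa using congrArg Complex.re h) (by simpa using congrArg Complex.im h)

theorem cross_eq_sin (u v : Plane) : cross u v =
    ‖(⟨u 0, u 1⟩ : ℂ)‖ * ‖(⟨v 0, v 1⟩ : ℂ)‖ * Real.sin (polarAngle v - polarAngle u) := by
  have a1 := Complex.norm_mul_cos_arg (⟨u 0, u 1⟩ : ℂ)
  have a2 := Complex.norm_mul_sin_arg (⟨u 0, u 1⟩ : ℂ)
  have b1 := Complex.norm_mul_cos_arg (⟨v 0, v 1⟩ : ℂ)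
  have b2 := Complex.norm_mul_sin_arg (⟨v 0, v 1⟩ : ℂ)
  simp only at a1 a2 b1 b2
  unfold cross polarAngle
  rw [Real.sin_sub]
  linear_combination -(‖(⟨v 0, v 1⟩ : ℂ)‖ * Real.sin (Complex.arg ⟨v 0, v 1⟩)) * a1 - u 0 * b2 +
    ‖(⟨v 0, v 1⟩ : ℂ)‖ * Real.cos (Complex.arg ⟨v 0, v 1⟩) * a2 + u 1 * b1

/-- The cross product has the sign of the sine of the angle, and on [0, 2π) the sine is negative
exactly beyond π. Reflexivity thus becomes the sign of a determinant. -/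
theorem pi_lt_ccwAngle_iff {u v : Plane} (hu : u ≠ 0) (hv : v ≠ 0) :
    Real.pi < ccwAngle u v ↔ cross u v < 0 := by
  have hs : Real.sin (ccwAngle u v) = Real.sin (polarAngle v - polarAngle u) := by
    unfold ccwAngle toIcoMod
    rw [zsmul_eq_mul, Real.sin_sub_int_mul_two_pi]
  have hmem := toIcoMod_mem_Ico Real.two_pi_pos 0 (polarAngle v - polarAngle u)
  have h0 : 0 ≤ ccwAngle u v := hmem.1
  have h1 : ccwAngle u v < 2 * Real.pi := by
    have h2 := hmem.2
    rw [zero_add] at h2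
    exact h2
  have hpos : 0 < ‖(⟨u 0, u 1⟩ : ℂ)‖ * ‖(⟨v 0, v 1⟩ : ℂ)‖ :=
    mul_pos (norm_complex_pos hu) (norm_complex_pos hv)
  rw [cross_eq_sin, ← hs]
  constructor
  · intro h
    apply mul_neg_of_pos_of_neg hpos
    have := Real.sin_pos_of_pos_of_lt_pi (x := ccwAngle u v - Real.pi) (by linarith) (by linarith)
    rw [Real.sin_sub_pi] at this; linarith
  · intro h
    by_contra hle
    push Not at hle
    have := Real.sin_nonneg_of_nonneg_of_le_pi h0 hle
    nlinarith

theorem isReflex_iff_of_area_pos {n : ℕ} {p : Fin n → Plane} {i : Fin n} (ha : 0 < signedArea p)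
    (h1 : p (next i) ≠ p i) (h2 : p (prev i) ≠ p i) :
    IsReflex p i ↔ orient (p (prev i)) (p i) (p (next i)) < 0 := by
  unfold IsReflex interiorAngle
  rw [if_pos ha, pi_lt_ccwAngle_iff (sub_ne_zero.2 h1) (sub_ne_zero.2 h2), cross_sub_sub, orient_eq]
  constructor <;> intro h <;> linarith

theorem isReflex_iff_of_area_nonpos {n : ℕ} {p : Fin n → Plane} {i : Fin n}
    (ha : ¬ 0 < signedArea p) (h1 : p (next i) ≠ p i) (h2 : p (prev i) ≠ p i) :
    IsReflex p i ↔ orient (p (next i)) (p i) (p (prev i)) < 0 := by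
  unfold IsReflex interiorAngle
  rw [if_neg ha, pi_lt_ccwAngle_iff (sub_ne_zero.2 h2) (sub_ne_zero.2 h1), cross_sub_sub, orient_eq]
  constructor <;> intro h <;> linarith

/-! ### Polygons as periodic sequences -/

theorem next_val {n : ℕ} (i : Fin n) : (next i : ℕ) = (i + 1) % n := by
  cases n with
  | zero => exact i.elim0
  | succ n =>
    unfold next
    rw [finRotate_apply, Fin.val_add, Fin.val_one']
    simp

theorem next_prev {n : ℕ} (i : Fin n) : next (prev i) = i := by
  exact (finRotate n).apply_symm_apply i

theorem prev_val {n : ℕ} (i : Fin n) : (prev i : ℕ) = (i + (n - 1)) % n := by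
  have h := congrArg Fin.val (next_prev i)
  rw [next_val] at h
  have h1 := (prev i).2
  have h2 := i.2
  rcases Nat.lt_or_ge ((prev i : ℕ) + 1) n with h3 | h3
  · rw [Nat.mod_eq_of_lt h3] at h
    rw [← h]
    rw [show (prev i : ℕ) + 1 + (n - 1) = (prev i : ℕ) + n by omega, Nat.add_mod_right,
      Nat.mod_eq_of_lt h1]
  · have : (prev i : ℕ) + 1 = n := by omega
    rw [this, Nat.mod_self] at h
    rw [← h, zero_add, Nat.mod_eq_of_lt (by omega)]; omega

theorem periodic_mod {α : Type*} {g : ℕ → α} {n : ℕ} (per : ∀ i, g (i + n) = g i) (i : ℕ) :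
    g (i % n) = g i :=
  Function.Periodic.map_mod_nat per i

/-- The base point contributes a telescoping term, which vanishes for a closed curve; the sign of
the area may therefore be checked from any convenient o. -/
theorem sum_orient_eq {g : ℕ → Plane} (o : Plane) (n : ℕ) :
    ∑ i ∈ Finset.range n, orient o (g i) (g (i + 1)) =
      (∑ i ∈ Finset.range n, cross (g i) (g (i + 1))) - (cross o (g n) - cross o (g 0)) := by
  rw [← Finset.sum_range_sub (fun i => cross o (g i)), ← Finset.sum_sub_distrib]
  refine Finset.sum_congr rfl fun i _ => ?_
  simp only [orient_eq, cross]; ring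

/-- All upper bounds pass through this criterion. Positive area makes the polygon counterclockwise,
so its reflex vertices are its right turns, and these lie in Z. -/
theorem reflexivity_le_of_periodic {S : Finset Plane} {g : ℕ → Plane} {n : ℕ} (h3 : 3 ≤ n)
    (per : ∀ i, g (i + n) = g i) (inj : ∀ i j, i < n → j < n → g i = g j → i = j)
    (hS : ∀ y, y ∈ S ↔ ∃ i < n, g i = y)
    (comp : ∀ i j, i < j → j < n → SegCompat (g i) (g (i + 1)) (g j) (g (j + 1)))
    {o : Plane} (area : 0 < ∑ i ∈ Finset.range n, orient o (g i) (g (i + 1)))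
    {Z : Finset Plane}
    (turn : ∀ i, g (i + 1) ∈ Z ∨ 0 ≤ orient (g i) (g (i + 1)) (g (i + 2))) :
    reflexivity S ≤ (Z.card : ℕ∞) := by
  have hcard : S.card = n := by
    have : S = (Finset.range n).image g := by
      ext y; rw [hS]; simp
    rw [this, Finset.card_image_of_injOn, Finset.card_range]
    intro i hi j hj hij
    exact inj i j (by simpa using hi) (by simpa using hj) hij
  subst hcard
  set p : Fin S.card → Plane := fun i => g i with hp
  have hnext : ∀ i : Fin S.card, p (next i) = g (i + 1) := fun i => by
    simp only [hp]; rw [next_val, periodic_mod per]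
  have hprev : ∀ i : Fin S.card, p (prev i) = g (i + (S.card - 1)) := fun i => by
    simp only [hp]; rw [prev_val, periodic_mod per]
  have hinj : Function.Injective p := fun i j hij => Fin.ext (inj i j i.2 j.2 hij)
  have hsimple : IsSimplePolygon p := by
    refine ⟨h3, hinj, fun i j hij => ?_⟩
    unfold edge
    rw [hnext, hnext]
    rcases lt_or_gt_of_ne (fun h => hij (Fin.ext h) : (i : ℕ) ≠ j) with h | h
    · exact comp i j h j.2
    · exact (comp j i h i.2).symm
  have hrange : Set.range p = (S : Set Plane) := by
    ext y
    rw [Finset.mem_coe, hS]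
    constructor
    · rintro ⟨i, rfl⟩; exact ⟨i, i.2, rfl⟩
    · rintro ⟨i, hi, rfl⟩; exact ⟨⟨i, hi⟩, rfl⟩
  have harea : 0 < signedArea p := by
    unfold signedArea
    have h0 : g S.card = g 0 := by simpa using per 0
    rw [sum_orient_eq, h0, sub_self, sub_zero] at area
    have : ∑ i : Fin S.card, cross (p i) (p (next i)) =
        ∑ i ∈ Finset.range S.card, cross (g i) (g (i + 1)) := by
      rw [← Fin.sum_univ_eq_sum_range (fun i => cross (g i) (g (i + 1)))]
      exact Finset.sum_congr rfl fun i _ => by rw [hnext]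
    rw [this]; linarith
  refine (iInf_le _ ⟨p, hsimple, hrange⟩).trans ?_
  rw [Nat.cast_le]
  unfold reflexCount
  rw [← Set.ncard_coe_finset Z]
  refine Set.ncard_le_ncard_of_injOn p (fun i hi => ?_) hinj.injOn (Finset.finite_toSet Z)
  have hi' : IsReflex p i := hi
  have hne1 : p (next i) ≠ p i := fun h => by
    have h1 := congrArg Fin.val (hinj h)
    rw [next_val] at h1
    have := i.2
    rcases Nat.lt_or_ge ((i : ℕ) + 1) S.card with h4 | h4
    · rw [Nat.mod_eq_of_lt h4] at h1; omega
    · rw [show (i : ℕ) + 1 = S.card by omega, Nat.mod_self] at h1; omega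
  have hne2 : p (prev i) ≠ p i := fun h => by
    have h1 := hinj h
    have h2 := next_prev i
    rw [h1] at h2
    exact hne1 (congrArg p h2)
  rw [isReflex_iff_of_area_pos harea hne1 hne2, hnext, hprev] at hi'
  -- The turn at vertex i is indexed by its predecessor i - 1, written as i + (n - 1) to avoid
  -- truncated subtraction.
  have h5 := turn (i + (S.card - 1))
  rw [show (i : ℕ) + (S.card - 1) + 1 = i + S.card by omega,
    show (i : ℕ) + (S.card - 1) + 2 = i + 1 + S.card by omega, per, per] at h5
  exact h5.resolve_right (not_le.2 hi')

/-! ### Polygons as lists -/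

/-- Every inner vertex of the path turns left, unless it belongs to `Z`. -/
def TurnsLeft (Z : Set Plane) : List Plane → Prop
  | u :: v :: w :: l => (v ∈ Z ∨ 0 ≤ orient u v w) ∧ TurnsLeft Z (v :: w :: l)
  | _ => True

/-- Twice the signed area swept from `o` along the path. -/
def sweep (o : Plane) : List Plane → ℝ
  | u :: v :: l => orient o u v + sweep o (v :: l)
  | _ => 0

theorem TurnsLeft.getElem {Z : Set Plane} : ∀ {l : List Plane}, TurnsLeft Z l →
    ∀ (i : ℕ) (h : i + 2 < l.length),
      l[i + 1] ∈ Z ∨ 0 ≤ orient (l[i]) (l[i + 1]) (l[i + 2])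
  | u :: v :: w :: l, h, 0, _ => h.1
  | u :: v :: w :: l, h, i + 1, hi => TurnsLeft.getElem h.2 i (by simpa using hi)
  | [], _, i, hi => by simp at hi
  | [_], _, i, hi => by simp at hi
  | [_, _], _, i, hi => by simp at hi

theorem sweep_eq_sum (o : Plane) : ∀ (l : List Plane),
    sweep o l = ∑ i ∈ Finset.range (l.length - 1), orient o (l.getD i 0) (l.getD (i + 1) 0)
  | [] => by simp [sweep]
  | [_] => by simp [sweep]
  | u :: v :: l => by
    rw [sweep, sweep_eq_sum o (v :: l)]
    simp only [List.length_cons, Nat.add_sub_cancel]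
    rw [Finset.sum_range_succ', add_comm]
    simp

/-- The last vertex x is repeated in front and the first vertex y at the end, so that edges and
turns of the closed polygon are those of an open path. Edges with a common start, edges with a
common end and mutually reversed edges need no check, since distinct edges of the polygon never
coincide in these ways. -/
theorem reflexivity_le_of_list {S : Finset Plane} {x y : Plane} {l : List Plane}
    (hnd : (y :: l).Nodup) (hS : ∀ v, v ∈ S ↔ v ∈ y :: l) (hlen : 3 ≤ (y :: l).length)
    (hx : (y :: l).getLast? = some x)
    (hcomp : ∀ e ∈ (x :: y :: l).zip (y :: l), ∀ e' ∈ (x :: y :: l).zip (y :: l),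
      e.1 ≠ e'.1 → e.2 ≠ e'.2 → (e.1 = e'.2 → e.2 ≠ e'.1) → SegCompat e.1 e.2 e'.1 e'.2)
    {o : Plane} (harea : 0 < sweep o (x :: y :: l)) {Z : Finset Plane}
    (hturn : TurnsLeft Z (x :: y :: l ++ [y])) : reflexivity S ≤ (Z.card : ℕ∞) := by
  set L := y :: l with hL
  set n := L.length with hn
  have hnpos : 0 < n := by omega
  set g : ℕ → Plane := fun i => L[i % n]'(Nat.mod_lt _ hnpos) with hg
  have per : ∀ i, g (i + n) = g i := fun i => by simp [hg]
  have glt : ∀ i (h : i < n), g i = L[i] := fun i h => by simp [hg, Nat.mod_eq_of_lt h]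
  have gx : g (n - 1) = x := by
    rw [glt _ (by omega)]
    rw [List.getLast?_eq_getElem?, List.getElem?_eq_getElem (by omega)] at hx
    exact Option.some.inj hx
  have inj : ∀ i j, i < n → j < n → g i = g j → i = j := by
    intro i j hi hj h
    rw [glt i hi, glt j hj] at h
    exact (List.Nodup.getElem_inj_iff hnd).1 h
  -- the closed list in terms of `g`
  have gL : ∀ i (h : i < (x :: L).length), (x :: L)[i] = g (i + (n - 1)) := by
    intro i h
    rcases i with _ | i
    · simp [gx]
    · rw [show i + 1 + (n - 1) = i + n by omega, per]
      have : i < n := by simpa using h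
      rw [glt i this]; rfl
  have hedge : ∀ i, i < n → (g (i + (n - 1)), g i) ∈ (x :: L).zip L := by
    intro i hi
    rw [List.mem_iff_getElem]
    refine ⟨i, by simp [← hn, hi], ?_⟩
    rw [List.getElem_zip, gL i (by simp [← hn]; omega), glt i hi]
  have hedge' : ∀ i, (g i, g (i + 1)) ∈ (x :: L).zip L := by
    intro i
    have h := hedge ((i + 1) % n) (Nat.mod_lt _ hnpos)
    have e1 : g ((i + 1) % n + (n - 1)) = g i := by
      rw [← periodic_mod per, Nat.mod_add_mod, show i + 1 + (n - 1) = i + n by omega,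
        Nat.add_mod_right, periodic_mod per]
    rwa [e1, periodic_mod per] at h
  have gne : ∀ i j, i % n ≠ j % n → g i ≠ g j := by
    intro i j hij h
    rw [← periodic_mod per i, ← periodic_mod per j] at h
    exact hij (inj _ _ (Nat.mod_lt _ hnpos) (Nat.mod_lt _ hnpos) h)
  have succ_mod : ∀ k, k < n → (k + 1) % n = if k + 1 = n then 0 else k + 1 := by
    intro k hk
    split_ifs with h
    · rw [h, Nat.mod_self]
    · exact Nat.mod_eq_of_lt (by omega)
  refine reflexivity_le_of_periodic (n := n) (g := g) (o := o) hlen per inj ?_ ?_ ?_ ?_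
  · intro v
    rw [hS, List.mem_iff_getElem]
    constructor
    · rintro ⟨i, hi, rfl⟩; exact ⟨i, hi, glt i hi⟩
    · rintro ⟨i, hi, rfl⟩; exact ⟨i, hi, (glt i hi).symm⟩
  · intro i j hij hj
    have si := succ_mod i (by omega)
    have sj := succ_mod j hj
    have mi : i % n = i := Nat.mod_eq_of_lt (by omega)
    have mj : j % n = j := Nat.mod_eq_of_lt hj
    refine hcomp (g i, g (i + 1)) (hedge' i) (g j, g (j + 1)) (hedge' j) (gne i j ?_) (gne (i + 1) (j + 1) ?_)
      (fun h => gne (i + 1) j ?_)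
    · omega
    · rw [si, sj]; split_ifs <;> omega
    -- Mutually reversed edges would need i ≡ j + 1 and i + 1 ≡ j modulo n, impossible for n ≥ 3.
    · have h' : i % n = (j + 1) % n := by
        by_contra hc; exact gne i (j + 1) hc h
      rw [si, mj]
      rw [sj, mi] at h'
      split_ifs at * <;> omega
  · rw [sweep_eq_sum] at harea
    have hlen' : (x :: L).length - 1 = n := by simp [hn]
    rw [hlen'] at harea
    have hgd : ∀ i, i ≤ n → (x :: L).getD i 0 = g (i + (n - 1)) := by
      intro i hi
      rw [List.getD_eq_getElem _ _ (by simp [← hn]; omega)]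
      exact gL i _
    have e : ∑ i ∈ Finset.range n, orient o ((x :: L).getD i 0) ((x :: L).getD (i + 1) 0) =
        ∑ i ∈ Finset.range n, orient o (g (i + (n - 1))) (g (i + (n - 1) + 1)) := by
      refine Finset.sum_congr rfl fun i hi => ?_
      have := Finset.mem_range.1 hi
      rw [hgd i (by omega), hgd (i + 1) (by omega), show i + 1 + (n - 1) = i + (n - 1) + 1 by omega]
    rw [e] at harea
    obtain ⟨k, hk⟩ : ∃ k, n = k + 1 := ⟨n - 1, by omega⟩
    -- The list sum begins with the edge into y, the periodic sum with the edge out of y; one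
    -- summand moves from the front to the back.
    rw [hk, Finset.sum_range_succ'] at harea
    rw [hk, Finset.sum_range_succ]
    have e2 : ∑ i ∈ Finset.range k, orient o (g (i + 1 + (k + 1 - 1))) (g (i + 1 + (k + 1 - 1) + 1)) =
        ∑ i ∈ Finset.range k, orient o (g i) (g (i + 1)) := by
      refine Finset.sum_congr rfl fun i _ => ?_
      rw [show i + 1 + (k + 1 - 1) = i + n by omega, show i + n + 1 = i + 1 + n by omega, per, per]
    rw [e2] at harea
    simpa using harea
  · intro i
    have hin := Nat.mod_lt (i + 1) hnpos
    have h := hturn.getElem ((i + 1) % n) (by simp [← hn]; exact hin)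
    have e : ∀ j (hj : j < (x :: L ++ [y]).length), (x :: L ++ [y])[j] = g (j + (n - 1)) := by
      intro j hj
      rw [List.getElem_append]
      split_ifs with hc
      · exact gL j hc
      · have hjn : j = n + 1 := by
          simp at hc hj; omega
        subst hjn
        simp only [List.getElem_singleton]
        rw [show n + 1 + (n - 1) = 0 + n + n by omega, per, per, glt 0 hnpos]
        simp [hL]
    have r : ∀ j, g ((i + 1) % n + j) = g (i + 1 + j) := by
      intro j
      rw [← periodic_mod per ((i + 1) % n + j), Nat.mod_add_mod, periodic_mod per]
    have e0 : g ((i + 1) % n + (n - 1)) = g i := by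
      rw [r, show i + 1 + (n - 1) = i + n by omega, per]
    have e1 : g ((i + 1) % n + 1 + (n - 1)) = g (i + 1) := by
      rw [show (i + 1) % n + 1 + (n - 1) = (i + 1) % n + n by omega, r, per]
    have e2 : g ((i + 1) % n + 2 + (n - 1)) = g (i + 2) := by
      rw [show (i + 1) % n + 2 + (n - 1) = (i + 1) % n + (n + 1) by omega, r,
        show i + 1 + (n + 1) = i + 2 + n by omega, per]
    rwa [e, e, e, e0, e1, e2] at h

/-! ### Supporting lines -/

/-- A neighbourhood of o lies in the closed half-plane that contains X. This turns weak signs into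
strict ones throughout. -/
theorem orient_pos_of_mem_interior {X : Set Plane} {o u v : Plane}
    (ho : o ∈ interior (convexHull ℝ X)) (huv : u ≠ v) (h : ∀ x ∈ X, 0 ≤ orient u v x) :
    0 < orient u v o := by
  have hsub : convexHull ℝ X ⊆ {x | 0 ≤ orient u v x} :=
    convexHull_min h (convex_orient_nonneg u v)
  by_contra hneg
  push Not at hneg
  -- move from `o` to the right of the line
  let w : Plane := !₂[v 1 - u 1, -(v 0 - u 0)]
  have hcont : Continuous fun t : ℝ => o + t • w := by fun_prop
  have hmem : ∀ᶠ t in nhds (0 : ℝ), o + t • w ∈ convexHull ℝ X := by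
    have : (fun t : ℝ => o + t • w) 0 ∈ interior (convexHull ℝ X) := by simpa using ho
    exact (hcont.continuousAt.eventually_mem (isOpen_interior.mem_nhds this)).mono
      fun t ht => interior_subset ht
  obtain ⟨ε, hε, hball⟩ := Metric.eventually_nhds_iff.1 hmem
  have h1 := hsub (hball (y := ε / 2) (by rw [Real.dist_eq, sub_zero, abs_of_pos] <;> linarith))
  have h2 : orient u v (o + (ε / 2) • w) =
      orient u v o - ε / 2 * ((v 0 - u 0) ^ 2 + (v 1 - u 1) ^ 2) := by
    simp [orient_eq, w]; ring
  have h3 : 0 < (v 0 - u 0) ^ 2 + (v 1 - u 1) ^ 2 := by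
    rcases eq_or_ne (v 0) (u 0) with h0 | h0
    · have h4 : v 1 - u 1 ≠ 0 := fun h5 => huv (plane_ext h0.symm (by linarith))
      positivity
    · have : v 0 - u 0 ≠ 0 := sub_ne_zero.2 h0
      positivity
  have h1' : 0 ≤ orient u v (o + (ε / 2) • w) := h1
  rw [h2] at h1'
  have : 0 < ε / 2 * ((v 0 - u 0) ^ 2 + (v 1 - u 1) ^ 2) := by positivity
  linarith

theorem exists_support {X : Set Plane} {x : Plane} (hint : (interior (convexHull ℝ X)).Nonempty)
    (hx : x ∉ interior (convexHull ℝ X)) : ∃ v ≠ x, ∀ y ∈ X, 0 ≤ orient x v y := by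
  have hconv := convex_convexHull ℝ X
  obtain ⟨f, hf⟩ := geometric_hahn_banach_open_point hconv.interior isOpen_interior hx
  have hle : ∀ y ∈ X, f y ≤ f x := by
    intro y hy
    have hy' : y ∈ closure (interior (convexHull ℝ X)) := by
      rw [hconv.closure_interior_eq_closure_of_nonempty_interior hint]
      exact subset_closure (subset_convexHull ℝ X hy)
    have hcl : IsClosed {z | f z ≤ f x} := isClosed_le f.continuous continuous_const
    exact closure_minimal (fun z hz => (hf z hz).le) hcl hy'
  set α := f !₂[1, 0] with hα
  set β := f !₂[0, 1] with hβ
  have hfy : ∀ y : Plane, f y = α * y 0 + β * y 1 := by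
    intro y
    have : y = y 0 • !₂[(1 : ℝ), 0] + y 1 • !₂[(0 : ℝ), 1] := by
      apply plane_ext <;> simp
    conv_lhs => rw [this]
    rw [map_add, map_smul, map_smul, smul_eq_mul, smul_eq_mul, hα, hβ]; ring
  -- The functional has gradient (α, β) and is maximal at x; turning the gradient by a quarter gives
  -- a direction with X on its left.
  refine ⟨!₂[x 0 - β, x 1 + α], ?_, ?_⟩
  · intro h
    have h0 := congrArg (fun z : Plane => z 0) h
    have h1 := congrArg (fun z : Plane => z 1) h
    simp at h0 h1
    obtain ⟨z, hz⟩ := hint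
    have := hf z hz
    rw [hfy, hfy, h0, h1] at this
    simp at this
  · intro y hy
    have := hle y hy
    rw [hfy, hfy] at this
    rw [orient_eq]; simp; nlinarith

/-- The two triangles at a supported point `v` seen from an inner point `o`. -/
theorem orient_nonneg_of_support {X : Set Plane} {o u v w : Plane}
    (ho : o ∈ interior (convexHull ℝ X)) (hv : v ∉ interior (convexHull ℝ X)) (hu : u ∈ X)
    (hw : w ∈ X) (hA : 0 ≤ orient o u v) (hB : 0 ≤ orient o v w) : 0 ≤ orient u v w := by
  obtain ⟨v', hne, hs⟩ := exists_support ⟨o, ho⟩ hv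
  have ho' := orient_pos_of_mem_interior ho hne.symm hs
  -- With v' on a supporting line at v, this writes the wanted determinant, times the positive
  -- distance factor of o, as a sum of nonnegative products.
  have hid : orient o u v * orient v v' w + orient o v w * orient v v' u =
      orient u v w * orient v v' o := by
    simp only [orient_eq]; ring
  have h1 := mul_nonneg hA (hs w hw)
  have h2 := mul_nonneg hB (hs u hu)
  by_contra hneg
  push Not at hneg
  have := mul_neg_of_neg_of_pos hneg ho'
  linarith

/-! ### Points in convex position around an inner point -/

/-- A periodic sequence of `h` points running counterclockwise around `o` through points in
(weakly) convex position; `Θ` are the polar angles. -/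
structure ConvexRing (o : Plane) (h : ℕ) (c : ℕ → Plane) (Θ : ℕ → ℝ) : Prop where
  pos : 0 < h
  mono : StrictMono Θ
  angle_add : ∀ i, Θ (i + h) = Θ i + 2 * Real.pi
  per : ∀ i, c (i + h) = c i
  polar : ∀ i, ∃ r : ℝ, 0 < r ∧ c i 0 = o 0 + r * Real.cos (Θ i) ∧ c i 1 = o 1 + r * Real.sin (Θ i)
  gap : ∀ i, Θ (i + 1) < Θ i + Real.pi
  tri : ∀ i j k, i ≤ j → j ≤ k → k ≤ i + h → 0 ≤ orient (c i) (c j) (c k)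
  inner : o ∈ interior (convexHull ℝ (Set.range c))
  outer : ∀ i, c i ∉ interior (convexHull ℝ (Set.range c))

theorem orient_polar {o a b : Plane} {r s α β : ℝ} (ha0 : a 0 = o 0 + r * Real.cos α)
    (ha1 : a 1 = o 1 + r * Real.sin α) (hb0 : b 0 = o 0 + s * Real.cos β)
    (hb1 : b 1 = o 1 + s * Real.sin β) : orient o a b = r * s * Real.sin (β - α) := by
  rw [orient_eq, ha0, ha1, hb0, hb1, Real.sin_sub]; ring

theorem exists_polar (o x : Plane) : x 0 = o 0 + ‖(⟨x 0 - o 0, x 1 - o 1⟩ : ℂ)‖ *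
      Real.cos (Complex.arg ⟨x 0 - o 0, x 1 - o 1⟩) ∧
    x 1 = o 1 + ‖(⟨x 0 - o 0, x 1 - o 1⟩ : ℂ)‖ * Real.sin (Complex.arg ⟨x 0 - o 0, x 1 - o 1⟩) := by
  have a1 := Complex.norm_mul_cos_arg (⟨x 0 - o 0, x 1 - o 1⟩ : ℂ)
  have a2 := Complex.norm_mul_sin_arg (⟨x 0 - o 0, x 1 - o 1⟩ : ℂ)
  simp only at a1 a2
  constructor <;> linarith

theorem norm_polar_pos {o x : Plane} (h : x ≠ o) : 0 < ‖(⟨x 0 - o 0, x 1 - o 1⟩ : ℂ)‖ := by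
  rw [norm_pos_iff]
  intro h0
  have h1 := congrArg Complex.re h0
  have h2 := congrArg Complex.im h0
  simp at h1 h2
  exact h (plane_ext (by linarith) (by linarith))

/-- Otherwise the supporting line at the point nearer to o would separate o from the farther one.
Hence polar angles order the points of a layer without ties. -/
theorem eq_of_same_ray {X : Set Plane} {o x y : Plane} (ho : o ∈ interior (convexHull ℝ X))
    (hx : x ∈ X) (hy : y ∈ X) (hx' : x ∉ interior (convexHull ℝ X))
    (hy' : y ∉ interior (convexHull ℝ X)) {r s α : ℝ} (hr : 0 < r) (hs : 0 < s)
    (hx0 : x 0 = o 0 + r * Real.cos α) (hx1 : x 1 = o 1 + r * Real.sin α)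
    (hy0 : y 0 = o 0 + s * Real.cos α) (hy1 : y 1 = o 1 + s * Real.sin α) : x = y := by
  have key : ∀ {a b : Plane} {r s : ℝ}, a ∈ X → b ∈ X → a ∉ interior (convexHull ℝ X) →
      0 < r → 0 < s → a 0 = o 0 + r * Real.cos α → a 1 = o 1 + r * Real.sin α →
      b 0 = o 0 + s * Real.cos α → b 1 = o 1 + s * Real.sin α → s ≤ r := by
    intro a b r s ha hb ha' hr hs a0 a1 b0 b1
    obtain ⟨v, hne, hv⟩ := exists_support ⟨o, ho⟩ ha'
    have h1 := orient_pos_of_mem_interior ho hne.symm hv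
    have h2 := hv b hb
    have : r * orient a v b = (r - s) * orient a v o := by
      simp only [orient_eq, a0, a1, b0, b1]; ring
    by_contra hlt
    push Not at hlt
    have := mul_neg_of_neg_of_pos (show r - s < 0 by linarith) h1
    have := mul_nonneg hr.le h2
    linarith
  have h1 := key hx hy hx' hr hs hx0 hx1 hy0 hy1
  have h2 := key hy hx hy' hs hr hy0 hy1 hx0 hx1
  have : r = s := le_antisymm h2 h1
  subst this
  exact plane_ext (by rw [hx0, hy0]) (by rw [hx1, hy1])

theorem exists_mod_eq {n : ℕ} (hn : 0 < n) (i i₀ : ℕ) :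
    ∃ j, i₀ ≤ j ∧ j < i₀ + n ∧ j % n = i % n := by
  have h0 := Nat.mod_lt i₀ hn
  have hdm := Nat.div_add_mod i₀ n
  refine ⟨i₀ + (i % n + (n - i₀ % n)) % n, by omega, ?_, ?_⟩
  · have := Nat.mod_lt (i % n + (n - i₀ % n)) hn; omega
  · rw [Nat.add_mod_mod, show i₀ + (i % n + (n - i₀ % n)) = i % n + n * (i₀ / n + 1) by
      rw [Nat.mul_add]; omega, Nat.add_mul_mod_self_left, Nat.mod_mod]

/-- The points are sorted by argument and repeated with 2π added for each turn. The parameter s adds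
further full turns, so that the starting angles of two rings can be compared. -/
theorem exists_convexRing {X : Finset Plane} {o : Plane}
    (hX : (X : Set Plane) ⊆ frontier (convexHull ℝ (X : Set Plane)))
    (ho : o ∈ interior (convexHull ℝ (X : Set Plane))) (s : ℕ) :
    ∃ c Θ, ConvexRing o X.card c Θ ∧ (∀ y, y ∈ X ↔ ∃ i < X.card, c i = y) ∧
      2 * Real.pi * s - Real.pi < Θ 0 ∧ Θ 0 ≤ 2 * Real.pi * s + Real.pi := by
  have hXi : ∀ x ∈ X, x ∉ interior (convexHull ℝ (X : Set Plane)) := fun x hx => (hX hx).2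
  have hXo : ∀ x ∈ X, x ≠ o := fun x hx h => hXi x hx (h ▸ ho)
  have hne : X.Nonempty := by
    rw [Finset.nonempty_iff_ne_empty]; rintro rfl; simp at ho
  set n := X.card with hn
  have hnpos : 0 < n := hne.card_pos
  set A : Plane → ℝ := fun x => Complex.arg ⟨x 0 - o 0, x 1 - o 1⟩ with hA
  have hAinj : Set.InjOn A X := by
    intro x hx y hy hxy
    have hx1 := exists_polar o x
    have hy1 := exists_polar o y
    have hxy' : Complex.arg ⟨x 0 - o 0, x 1 - o 1⟩ = Complex.arg ⟨y 0 - o 0, y 1 - o 1⟩ := hxy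
    rw [hxy'] at hx1
    exact eq_of_same_ray ho hx hy (hXi x hx) (hXi y hy) (norm_polar_pos (hXo x hx))
      (norm_polar_pos (hXo y hy)) hx1.1 hx1.2 hy1.1 hy1.2
  have hcardT : (X.image A).card = n := Finset.card_image_of_injOn hAinj
  set θ : ℕ → ℝ := fun i => if h : i < n then (X.image A).orderEmbOfFin hcardT ⟨i, h⟩ else 0 with hθ
  have hθmem : ∀ i, i < n → ∃ x ∈ X, A x = θ i := by
    intro i hi
    have := (X.image A).orderEmbOfFin_mem hcardT ⟨i, hi⟩
    rw [Finset.mem_image] at this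
    obtain ⟨x, hx, e⟩ := this
    exact ⟨x, hx, by simp [hθ, hi, e]⟩
  have hθmono : ∀ i j, i < j → j < n → θ i < θ j := by
    intro i j hij hj
    have hi : i < n := hij.trans hj
    simp only [hθ, hi, hj, dif_pos]
    exact ((X.image A).orderEmbOfFin hcardT).strictMono (by simpa using hij)
  choose! pt hptX hptA using hθmem
  have hptsurj : ∀ y ∈ X, ∃ i < n, pt i = y := by
    intro y hy
    have : A y ∈ Set.range ((X.image A).orderEmbOfFin hcardT) := by
      rw [Finset.range_orderEmbOfFin]; exact Finset.mem_coe.2 (Finset.mem_image_of_mem A hy)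
    obtain ⟨i, hi⟩ := this
    refine ⟨i, i.2, hAinj (hptX i i.2) hy ?_⟩
    rw [hptA i i.2]; simp [hθ, hi]
  have hAlo : ∀ x, -Real.pi < A x := fun x => Complex.neg_pi_lt_arg _
  have hAhi : ∀ x, A x ≤ Real.pi := fun x => Complex.arg_le_pi _
  have hmod : ∀ i, i % n < n := fun i => Nat.mod_lt i hnpos
  set c : ℕ → Plane := fun i => pt (i % n) with hc
  set Θ : ℕ → ℝ := fun i => θ (i % n) + 2 * Real.pi * (i / n : ℕ) + 2 * Real.pi * s with hΘ
  have hpi := Real.pi_pos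
  have hcX : ∀ i, c i ∈ X := fun i => hptX _ (hmod i)
  have hmono : StrictMono Θ := by
    refine strictMono_nat_of_lt_succ fun i => ?_
    have hi := hmod i
    have hdm := Nat.div_add_mod i n
    simp only [hΘ]
    rcases Nat.lt_or_ge (i % n + 1) n with h | h
    · have h1 : (i + 1) % n = i % n + 1 := by
        rw [← Nat.mod_add_mod, Nat.mod_eq_of_lt h]
      have h2 : (i + 1) / n = i / n := by
        rw [Nat.div_eq_iff hnpos]
        constructor
        · rw [Nat.mul_comm]; omega
        · rw [Nat.mul_comm]; omega
      rw [h1, h2]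
      have := hθmono (i % n) (i % n + 1) (by omega) h
      linarith
    · have h0 : i % n + 1 = n := by omega
      have h1 : (i + 1) % n = 0 := by
        rw [← Nat.mod_add_mod, h0, Nat.mod_self]
      have h2 : (i + 1) / n = i / n + 1 := by
        rw [show i + 1 = n * (i / n) + n by omega, ← Nat.mul_succ, Nat.mul_div_cancel_left _ hnpos]
      rw [h1, h2]
      have e1 := hptA 0 hnpos
      have e2 := hptA (i % n) hi
      have := hAlo (pt 0)
      have := hAhi (pt (i % n))
      push_cast
      linarith
  have hadd : ∀ i, Θ (i + n) = Θ i + 2 * Real.pi := by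
    intro i
    simp only [hΘ, Nat.add_mod_right, Nat.add_div_right i hnpos]
    push_cast; ring
  have hper : ∀ i, c (i + n) = c i := fun i => by simp [hc]
  have hpolar : ∀ i, ∃ r : ℝ, 0 < r ∧ c i 0 = o 0 + r * Real.cos (Θ i) ∧
      c i 1 = o 1 + r * Real.sin (Θ i) := by
    intro i
    have h1 := exists_polar o (c i)
    have h2 : A (c i) = θ (i % n) := hptA _ (hmod i)
    have h3 : Complex.arg ⟨c i 0 - o 0, c i 1 - o 1⟩ = θ (i % n) := h2
    rw [h3] at h1
    refine ⟨_, norm_polar_pos (hXo _ (hcX i)), ?_⟩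
    have h4 : Θ i = θ (i % n) + ((i / n : ℕ) + s : ℕ) * (2 * Real.pi) := by
      simp only [hΘ]; push_cast; ring
    rw [h4, Real.cos_add_nat_mul_two_pi, Real.sin_add_nat_mul_two_pi]
    exact h1
  have hor : ∀ i j, 0 ≤ Θ j - Θ i → Θ j - Θ i ≤ Real.pi → 0 ≤ orient o (c i) (c j) := by
    intro i j h1 h2
    obtain ⟨r, hr, a0, a1⟩ := hpolar i
    obtain ⟨t, ht, b0, b1⟩ := hpolar j
    rw [orient_polar a0 a1 b0 b1]
    have := Real.sin_nonneg_of_nonneg_of_le_pi h1 h2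
    positivity
  have hcsurj : ∀ (y) (_ : y ∈ X) (i₀ : ℕ), ∃ j, i₀ ≤ j ∧ j < i₀ + n ∧ c j = y := by
    intro y hy i₀
    obtain ⟨i, hi, rfl⟩ := hptsurj y hy
    obtain ⟨j, h1, h2, h3⟩ := exists_mod_eq hnpos i i₀
    exact ⟨j, h1, h2, by simp only [hc]; rw [h3, Nat.mod_eq_of_lt hi]⟩
  have hgap : ∀ i, Θ (i + 1) < Θ i + Real.pi := by
    intro i
    by_contra hle
    push Not at hle
    -- A gap of at least π would leave all points on one side of a line through o.
    have hall : ∀ x ∈ (X : Set Plane), 0 ≤ orient o (c (i + 1)) x := by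
      intro x hx
      obtain ⟨j, h1, h2, rfl⟩ := hcsurj x hx (i + 1)
      apply hor
      · linarith [hmono.monotone h1]
      · have := hmono.monotone (show j ≤ i + n by omega)
        rw [hadd] at this
        linarith
    have := orient_pos_of_mem_interior ho (hXo _ (hcX (i + 1))).symm hall
    simp at this
  have hrange : Set.range c = X := by
    ext y
    constructor
    · rintro ⟨i, rfl⟩; exact hcX i
    · intro hy
      obtain ⟨j, _, _, e⟩ := hcsurj y hy 0
      exact ⟨j, e⟩
  refine ⟨c, Θ, ⟨hnpos, hmono, hadd, hper, hpolar, hgap, ?_, hrange ▸ ho,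
    fun i => hrange ▸ hXi _ (hcX i)⟩, ?_, ?_, ?_⟩
  · intro i j k hij hjk hki
    have m1 := hmono.monotone hij
    have m2 := hmono.monotone hjk
    have m3 := hmono.monotone hki
    rw [hadd] at m3
    have hor' : Θ k - Θ i ≥ Real.pi → 0 ≤ orient o (c k) (c i) := by
      intro h
      rw [← hper i]
      apply hor <;> rw [hadd] <;> linarith
    -- The three angular gaps add up to 2π, so at most one exceeds π; the vertex opposite to that
    -- gap sees both others within π, and `orient_nonneg_of_support` applies there.
    rcases le_or_gt (Θ j - Θ i) Real.pi with hα | hα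
    · rcases le_or_gt (Θ k - Θ j) Real.pi with hβ | hβ
      · exact orient_nonneg_of_support ho (hXi _ (hcX j)) (hcX i) (hcX k)
          (hor _ _ (by linarith) hα) (hor _ _ (by linarith) hβ)
      · rw [← orient_rotate]
        exact orient_nonneg_of_support ho (hXi _ (hcX i)) (hcX k) (hcX j)
          (hor' (by linarith)) (hor _ _ (by linarith) hα)
    · rw [orient_rotate]
      exact orient_nonneg_of_support ho (hXi _ (hcX k)) (hcX j) (hcX i)
        (hor _ _ (by linarith) (by linarith)) (hor' (by linarith))
  · intro y
    constructor
    · intro hy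
      obtain ⟨i, hi, e⟩ := hptsurj y hy
      exact ⟨i, hi, by simp [hc, Nat.mod_eq_of_lt hi, e]⟩
    · rintro ⟨i, _, rfl⟩; exact hcX i
  · have e1 := hptA 0 hnpos
    have := hAlo (pt 0)
    simp only [hΘ, Nat.zero_mod, Nat.zero_div]
    push_cast
    linarith
  · have e1 := hptA 0 hnpos
    have := hAhi (pt 0)
    simp only [hΘ, Nat.zero_mod, Nat.zero_div]
    push_cast
    linarith

/-- The difference of the two angles has sine zero and positive cosine, and it is less than a full
turn. -/
theorem polar_unique {o z : Plane} {s s' φ φ' : ℝ} (hs : 0 < s) (hs' : 0 < s')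
    (h0 : z 0 = o 0 + s * Real.cos φ) (h1 : z 1 = o 1 + s * Real.sin φ)
    (h0' : z 0 = o 0 + s' * Real.cos φ') (h1' : z 1 = o 1 + s' * Real.sin φ')
    (hle : φ ≤ φ') (hlt : φ' < φ + 2 * Real.pi) : φ = φ' := by
  have hsin : Real.sin (φ' - φ) = 0 := by
    have h := orient_polar h0 h1 h0' h1'
    rw [orient_self_right] at h
    have : s * s' ≠ 0 := by positivity
    exact (mul_eq_zero.1 h.symm).resolve_left this
  have hcos : 0 < Real.cos (φ' - φ) := by
    have e0 : s * Real.cos φ = s' * Real.cos φ' := by linarith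
    have e1 : s * Real.sin φ = s' * Real.sin φ' := by linarith
    have : s * s' * Real.cos (φ' - φ) = s ^ 2 := by
      rw [Real.cos_sub]
      have := Real.sin_sq_add_cos_sq φ
      linear_combination -s * Real.cos φ * e0 - s * Real.sin φ * e1 + s ^ 2 * this
    have h2 : 0 < s ^ 2 := by positivity
    rw [← this] at h2
    exact (pos_iff_pos_of_mul_pos h2).1 (by positivity)
  rcases hle.lt_or_eq with h | h
  · exfalso
    rcases lt_trichotomy (φ' - φ) Real.pi with h2 | h2 | h2
    · have := Real.sin_pos_of_pos_of_lt_pi (by linarith) h2; linarith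
    · rw [h2, Real.cos_pi] at hcos; linarith
    · have := Real.sin_pos_of_pos_of_lt_pi (x := φ' - φ - Real.pi) (by linarith) (by linarith)
      rw [Real.sin_sub_pi] at this; linarith
  · exact h

theorem orient_eq_zero_of_collinear {u w a b c : Plane} (huw : u ≠ w) (ha : orient u w a = 0)
    (hb : orient u w b = 0) (hc : orient u w c = 0) : orient a b c = 0 := by
  have h0 : (w 0 - u 0) * orient a b c = 0 := by
    simp only [orient_eq] at *
    linear_combination (b 0 - a 0) * (hc - ha) - (c 0 - a 0) * (hb - ha)
  have h1 : (w 1 - u 1) * orient a b c = 0 := by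
    simp only [orient_eq] at *
    linear_combination (b 1 - a 1) * (hc - ha) - (c 1 - a 1) * (hb - ha)
  by_contra hne
  exact huw (plane_ext (by have := (mul_eq_zero.1 h0).resolve_right hne; linarith)
    (by have := (mul_eq_zero.1 h1).resolve_right hne; linarith))

theorem orient_mul_comm_of_collinear {a b u w : Plane} (ha : orient u w a = 0)
    (hb : orient u w b = 0) (p q : Plane) :
    orient a b p * orient u w q = orient a b q * orient u w p := by
  have hid : orient a b p * orient u w q - orient a b q * orient u w p =
      (orient a b p - orient a b q) * orient u w a -
        orient a p q * (orient u w b - orient u w a) := by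
    simp only [orient_eq]; ring
  rw [ha, hb] at hid
  linarith

/-! ### Sides and chords of a convex ring. -/

namespace ConvexRing

variable {o : Plane} {h : ℕ} {c : ℕ → Plane} {Θ : ℕ → ℝ} (R : ConvexRing o h c Θ)
include R

theorem orient_center_pos {i j : ℕ} (h1 : Θ i < Θ j) (h2 : Θ j < Θ i + Real.pi) :
    0 < orient o (c i) (c j) := by
  obtain ⟨r, hr, a0, a1⟩ := R.polar i
  obtain ⟨t, ht, b0, b1⟩ := R.polar j
  rw [orient_polar a0 a1 b0 b1]
  have := Real.sin_pos_of_pos_of_lt_pi (x := Θ j - Θ i) (by linarith) (by linarith)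
  positivity

theorem side_pos (i : ℕ) : 0 < orient o (c i) (c (i + 1)) :=
  R.orient_center_pos (R.mono (Nat.lt_succ_self i)) (R.gap i)

theorem ne_of_lt {i j : ℕ} (h1 : i < j) (h2 : j < i + h) : c i ≠ c j := by
  intro e
  obtain ⟨r, hr, a0, a1⟩ := R.polar i
  obtain ⟨t, ht, b0, b1⟩ := R.polar j
  rw [← e] at b0 b1
  have h3 := R.mono h1
  have h4 := R.mono h2
  rw [R.angle_add] at h4
  exact h3.ne (polar_unique hr ht a0 a1 b0 b1 h3.le h4)

theorem exists_rep (i i₀ : ℕ) : ∃ j, i₀ ≤ j ∧ j < i₀ + h ∧ c j = c i := by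
  obtain ⟨j, h1, h2, h3⟩ := exists_mod_eq R.pos i i₀
  exact ⟨j, h1, h2, by rw [← periodic_mod R.per j, h3, periodic_mod R.per]⟩

/-- Gaps smaller than π need at least three summands to make 2π. -/
theorem three_le : 3 ≤ h := by
  by_contra hlt
  have h1 := R.gap 0
  have h2 := R.gap 1
  have h3 := R.angle_add 0
  have h4 := R.mono.monotone (show 0 + h ≤ 2 by omega)
  have : Θ (1 + 1) = Θ 2 := rfl
  linarith

/-- The polar angles of the points of a side. -/
theorem angle_of_mem_side {x : ℕ} {z : Plane} (hz : z ∈ segment ℝ (c x) (c (x + 1))) :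
    ∃ s φ : ℝ, 0 < s ∧ z 0 = o 0 + s * Real.cos φ ∧ z 1 = o 1 + s * Real.sin φ ∧
      Θ x ≤ φ ∧ φ ≤ Θ (x + 1) ∧ (φ = Θ x → z = c x) ∧ (φ = Θ (x + 1) → z = c (x + 1)) := by
  obtain ⟨t, t0, t1, e0, e1, ht⟩ := orient_of_mem_segment hz
  have hD := R.side_pos x
  have k1 : orient o (c x) z = t * orient o (c x) (c (x + 1)) := by
    rw [ht]; simp
  have k2 : orient o z (c (x + 1)) = (1 - t) * orient o (c x) (c (x + 1)) := by
    rw [orient_swap, ht]; simp [orient_swap o (c (x + 1)) (c x)]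
  have hzo : z ≠ o := by
    rintro rfl
    simp only [orient_self_outer, orient_self_left] at k1 k2
    have a := (mul_eq_zero.1 k1.symm).resolve_right hD.ne'
    have b := (mul_eq_zero.1 k2.symm).resolve_right hD.ne'
    linarith
  obtain ⟨p0, p1⟩ := exists_polar o z
  set s := ‖(⟨z 0 - o 0, z 1 - o 1⟩ : ℂ)‖
  have hs : 0 < s := norm_polar_pos hzo
  set ψ := Complex.arg ⟨z 0 - o 0, z 1 - o 1⟩
  -- The angle of z is normalised to the turn that begins at Θ x; the signs of the two sines below
  -- then confine it to the interval of the side.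
  obtain ⟨φ, hφ1, hφ2, hc, hsn⟩ : ∃ φ, Θ x ≤ φ ∧ φ < Θ x + 2 * Real.pi ∧
      Real.cos φ = Real.cos ψ ∧ Real.sin φ = Real.sin ψ := by
    refine ⟨toIcoMod Real.two_pi_pos (Θ x) ψ, left_le_toIcoMod _ _ _, toIcoMod_lt_right _ _ _, ?_, ?_⟩
    · unfold toIcoMod; rw [zsmul_eq_mul, Real.cos_sub_int_mul_two_pi]
    · unfold toIcoMod; rw [zsmul_eq_mul, Real.sin_sub_int_mul_two_pi]
  rw [← hc] at p0
  rw [← hsn] at p1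
  obtain ⟨r, hr, a0, a1⟩ := R.polar x
  obtain ⟨r', hr', b0, b1⟩ := R.polar (x + 1)
  rw [orient_polar a0 a1 p0 p1] at k1
  rw [orient_polar p0 p1 b0 b1] at k2
  have hgap := R.gap x
  have hlt := R.mono (Nat.lt_succ_self x)
  have hsin1 : 0 ≤ Real.sin (φ - Θ x) := by
    have h1 : 0 ≤ r * s * Real.sin (φ - Θ x) := by rw [k1]; positivity
    exact nonneg_of_mul_nonneg_right h1 (by positivity)
  have hsin2 : 0 ≤ Real.sin (Θ (x + 1) - φ) := by
    have h1 : 0 ≤ s * r' * Real.sin (Θ (x + 1) - φ) := by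
      rw [k2]; exact mul_nonneg (by linarith) hD.le
    exact nonneg_of_mul_nonneg_right h1 (by positivity)
  have hle : φ ≤ Θ x + Real.pi := by
    by_contra hgt
    push Not at hgt
    have := Real.sin_pos_of_pos_of_lt_pi (x := φ - Θ x - Real.pi) (by linarith) (by linarith)
    rw [Real.sin_sub_pi] at this; linarith
  have hle' : φ ≤ Θ (x + 1) := by
    by_contra hgt
    push Not at hgt
    have := Real.sin_pos_of_pos_of_lt_pi (x := φ - Θ (x + 1)) (by linarith)
      (by simp only [Nat.succ_eq_add_one] at hlt; linarith)
    rw [← neg_sub, Real.sin_neg] at this; linarith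
  refine ⟨s, φ, hs, p0, p1, hφ1, hle', fun he => e0 ?_, fun he => e1 ?_⟩
  · rw [he, sub_self, Real.sin_zero, mul_zero] at k1
    exact (mul_eq_zero.1 k1.symm).resolve_right hD.ne'
  · rw [he, sub_self, Real.sin_zero, mul_zero] at k2
    have := (mul_eq_zero.1 k2.symm).resolve_right hD.ne'
    linarith

/-- Different sides occupy angular intervals that share at most end angles, and at an end angle the
only point of a side is its endpoint. -/
theorem side_compat {x y : ℕ} (hxy : x < y) (hyx : y < x + h) :
    SegCompat (c x) (c (x + 1)) (c y) (c (y + 1)) := by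
  rintro z ⟨h1, h2⟩
  obtain ⟨s, φ, hs, p0, p1, lo, hi, e0, e1⟩ := R.angle_of_mem_side h1
  obtain ⟨s', φ', hs', p0', p1', lo', hi', e0', e1'⟩ := R.angle_of_mem_side h2
  have m1 := R.mono.monotone (show x + 1 ≤ y by omega)
  have m2 := R.mono.monotone (show y + 1 ≤ x + h by omega)
  rw [R.angle_add] at m2
  have m3 := R.mono (Nat.lt_succ_self x)
  simp only [Nat.succ_eq_add_one] at m3
  rcases lt_or_ge φ' (φ + 2 * Real.pi) with hlt | hge
  · have he := polar_unique hs hs' p0 p1 p0' p1' (by linarith) hlt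
    have a1 := e1 (by linarith)
    have a2 := e0' (by linarith)
    exact ⟨Or.inr a1, Or.inl a2⟩
  · have a1 := e0 (by linarith)
    have a2 := e1' (by linarith)
    exact ⟨Or.inl a1, Or.inr a2⟩

theorem mem_side {x j : ℕ} (hj : c j ∈ segment ℝ (c x) (c (x + 1))) :
    c j = c x ∨ c j = c (x + 1) := by
  obtain ⟨k, k1, k2, e⟩ := R.exists_rep j x
  rw [← e] at hj ⊢
  obtain ⟨s, φ, hs, p0, p1, lo, hi, e0, e1⟩ := R.angle_of_mem_side hj
  obtain ⟨r, hr, a0, a1⟩ := R.polar k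
  have m1 := R.mono.monotone k1
  have m2 := R.mono k2
  rw [R.angle_add] at m2
  have hgap := R.gap x
  have hpi := Real.pi_pos
  have he : φ = Θ k := by
    rcases le_total φ (Θ k) with hle | hle
    · exact polar_unique hs hr p0 p1 a0 a1 hle (by linarith)
    · exact (polar_unique hr hs a0 a1 p0 p1 hle (by linarith)).symm
  have : k ≤ x + 1 := R.mono.le_iff_le.1 (by linarith)
  rcases (show k = x ∨ k = x + 1 by omega) with rfl | rfl
  · exact Or.inl rfl
  · exact Or.inr rfl

theorem orient_side_nonneg (x j : ℕ) : 0 ≤ orient (c x) (c (x + 1)) (c j) := by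
  obtain ⟨k, k1, k2, e⟩ := R.exists_rep j x
  rw [← e]
  rcases k1.eq_or_lt with rfl | hlt
  · simp
  · exact R.tri x (x + 1) k (by omega) hlt (by omega)

/-- If `c x` lies on the line of `c i` and `c j` and between them as seen from the centre, then the
whole arc from `c i` to `c j` is straight. -/
theorem arc_straight {i x j : ℕ} (hji : j ≤ i + h)
    (hA : 0 < orient o (c i) (c x)) (hB : 0 < orient o (c x) (c j))
    (h0 : orient (c i) (c x) (c j) = 0) :
    c i ≠ c j ∧ ∀ y, i ≤ y → y ≤ j → orient (c i) (c j) (c y) = 0 := by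
  -- A supporting line at c x must contain c i and c j. It is then their common line, and both
  -- convexity and support confine the arc to it.
  obtain ⟨v, hne, hs⟩ := exists_support ⟨o, R.inner⟩ (R.outer x)
  have ho := orient_pos_of_mem_interior R.inner hne.symm hs
  have hsi := hs (c i) ⟨i, rfl⟩
  have hsj := hs (c j) ⟨j, rfl⟩
  have hid : orient o (c i) (c x) * orient (c x) v (c j) +
      orient o (c x) (c j) * orient (c x) v (c i) =
      orient (c i) (c x) (c j) * orient (c x) v o := by
    simp only [orient_eq]; ring
  rw [h0, zero_mul] at hid
  have h1 := mul_nonneg hA.le hsj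
  have h2 := mul_nonneg hB.le hsi
  have zj : orient (c x) v (c j) = 0 :=
    (mul_eq_zero.1 (by linarith : orient o (c i) (c x) * orient (c x) v (c j) = 0)).resolve_left hA.ne'
  have zi : orient (c x) v (c i) = 0 :=
    (mul_eq_zero.1 (by linarith : orient o (c x) (c j) * orient (c x) v (c i) = 0)).resolve_left hB.ne'
  have hsum := orient_add_orient o (c i) (c x) (c j)
  rw [h0, add_zero] at hsum
  have hpos : 0 < orient o (c i) (c j) := by linarith
  refine ⟨fun e => ?_, fun y h3 h4 => ?_⟩
  · rw [e, orient_self_right] at hpos; exact lt_irrefl _ hpos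
  · have hsy := hs (c y) ⟨y, rfl⟩
    have hid2 : orient (c i) (c j) (c y) * orient (c x) v o =
        orient (c i) (c j) o * orient (c x) v (c y) := by
      exact orient_mul_comm_of_collinear zi zj _ _
    rw [← orient_rotate o (c i)] at hid2
    have h5 := mul_nonneg hpos.le hsy
    have h6 := R.tri i y j h3 h4 hji
    rw [orient_swap] at h6
    have h7 : 0 ≤ orient (c i) (c j) (c y) := by
      rw [← hid2] at h5
      exact nonneg_of_mul_nonneg_left h5 ho
    linarith

/-- A chord with corners on both sides has all other points strictly on one of its sides. -/
theorem orient_chord_pos {i j k l : ℕ} (hik : i ≤ k) (hkj : k + 2 ≤ j) (hjl : j ≤ l)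
    (hli : l + 2 ≤ i + h) (hk : 0 < orient (c k) (c (k + 1)) (c (k + 2)))
    (hl : 0 < orient (c l) (c (l + 1)) (c (l + 2))) {x : ℕ} (hix : i < x) (hxj : x < j) :
    0 < orient (c i) (c x) (c j) := by
  by_contra hcon
  have h0 : orient (c i) (c x) (c j) = 0 :=
    le_antisymm (not_lt.1 hcon) (R.tri i x j hix.le hxj.le (by omega))
  have corner : ∀ {a b m : ℕ}, c a ≠ c b →
      (∀ y, a ≤ y → y ≤ b → orient (c a) (c b) (c y) = 0) → a ≤ m → m + 2 ≤ b →
      orient (c m) (c (m + 1)) (c (m + 2)) = 0 := fun hne hall h1 h2 =>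
    orient_eq_zero_of_collinear hne (hall _ h1 (by omega)) (hall _ (by omega) (by omega))
      (hall _ (by omega) h2)
  have m1 := R.mono hix
  have m2 := R.mono hxj
  have m3 := R.mono (show j < i + h by omega)
  have ai := R.angle_add i
  have ax := R.angle_add x
  -- At most one of the three angular gaps between i, x and j reaches π. Across the other two
  -- `arc_straight` flattens an arc, which contains the corner k in the first case and the corner l
  -- in the other two.
  rcases lt_or_ge (Θ x) (Θ i + Real.pi) with hA | hA
  · rcases lt_or_ge (Θ j) (Θ x + Real.pi) with hB | hB
    · obtain ⟨hne, hall⟩ := R.arc_straight (by omega)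
        (R.orient_center_pos m1 hA) (R.orient_center_pos m2 hB) h0
      exact hk.ne' (corner hne hall hik hkj)
    · obtain ⟨hne, hall⟩ := R.arc_straight (i := j) (x := i + h) (j := x + h) (by omega)
        (R.orient_center_pos m3 (by linarith)) (R.orient_center_pos (by linarith) (by linarith))
        (by rw [R.per, R.per, orient_rotate]; exact h0)
      exact hl.ne' (corner hne hall hjl (by omega))
  · obtain ⟨hne, hall⟩ := R.arc_straight (i := x) (x := j) (j := i + h) (by omega)
      (R.orient_center_pos m2 (by linarith)) (R.orient_center_pos m3 (by linarith))
      (by rw [R.per, ← orient_rotate]; exact h0)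
    exact hl.ne' (corner hne hall (by omega) hli)

theorem orient_chord_pos' {i j k l : ℕ} (hik : i ≤ k) (hkj : k + 2 ≤ j) (hjl : j ≤ l)
    (hli : l + 2 ≤ i + h) (hk : 0 < orient (c k) (c (k + 1)) (c (k + 2)))
    (hl : 0 < orient (c l) (c (l + 1)) (c (l + 2))) {x : ℕ} (hjx : j < x) (hxi : x < i + h) :
    0 < orient (c i) (c j) (c x) := by
  have := R.orient_chord_pos (i := j) (j := i + h) (k := l) (l := k + h) hjl hli (by omega)
    (by omega) hl (by
      rw [show k + h + 1 = k + 1 + h by omega, show k + h + 2 = k + 2 + h by omega,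
        R.per, R.per, R.per]; exact hk) hjx hxi
  rw [R.per] at this
  rw [orient_rotate]; exact this

end ConvexRing

/-! ### Sectors of the outside of a convex ring -/

/-- The points that see the side from `q e` to `q (e + 1)` from outside, but not the next one. -/
def InSector (q : ℕ → Plane) (e : ℕ) (z : Plane) : Prop :=
  orient (q e) (q (e + 1)) z < 0 ∧ 0 ≤ orient (q (e + 1)) (q (e + 2)) z

/-- Transitivity of the angular order of points on one side of a line through `c`. -/
theorem orient_pos_trans {c d u v w : Plane} (hu : orient c d u < 0) (hv : orient c d v < 0)
    (hw : orient c d w < 0) (h1 : 0 < orient c u v) (h2 : 0 < orient c v w) :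
    0 < orient c u w := by
  have hid : orient c u w * orient c d v = orient c u v * orient c d w + orient c v w * orient c d u := by
    simp only [orient_eq]; ring
  have h3 := mul_neg_of_pos_of_neg h1 hw
  have h4 := mul_neg_of_pos_of_neg h2 hu
  by_contra hneg
  push Not at hneg
  have := mul_nonneg_of_nonpos_of_nonpos hneg hv.le
  linarith

/-! ### Tangents from outer points; existence and uniqueness of their sectors. -/

namespace ConvexRing

variable {o : Plane} {m : ℕ} {q : ℕ → Plane} {Φ : ℕ → ℝ} (R : ConvexRing o m q Φ)
include R

theorem inSector_congr {e e' : ℕ} (h : e % m = e' % m) {z : Plane} (hz : InSector q e z) :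
    InSector q e' z := by
  have hk : ∀ k, q (e + k) = q (e' + k) := fun k => by
    rw [← periodic_mod R.per (e + k), ← periodic_mod R.per (e' + k), Nat.add_mod, h, ← Nat.add_mod]
  have h0 := hk 0
  rw [add_zero, add_zero] at h0
  unfold InSector at *
  rwa [← h0, ← hk, ← hk]

/-- If the ring were straight at q (e + 1), the two sides there would lie on one line and could not
see z from opposite sides. -/
theorem corner_of_inSector {e : ℕ} {z : Plane} (hz : InSector q e z) :
    0 < orient (q e) (q (e + 1)) (q (e + 2)) := by
  refine lt_of_le_of_ne (R.tri _ _ _ (by omega) (by omega) (by have := R.three_le; omega)) fun h0 => ?_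
  have hD := R.side_pos e
  have hD' := R.side_pos (e + 1)
  have hid : orient o (q e) (q (e + 1)) * orient (q (e + 1)) (q (e + 2)) z -
      orient o (q (e + 1)) (q (e + 2)) * orient (q e) (q (e + 1)) z =
      -(orient (q e) (q (e + 1)) (q (e + 2)) * orient o (q (e + 1)) z) := by
    simp only [orient_eq]; ring
  rw [← h0, zero_mul] at hid
  have := mul_neg_of_pos_of_neg hD' hz.1
  have := mul_nonneg hD.le hz.2
  have : q (e + 1 + 1) = q (e + 2) := rfl
  rw [this] at *
  linarith

/-- Multiplied by the corner determinant, the tangent determinant is a nonnegative combination of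
the two side determinants. Equality forces q x onto the ray beyond q (e + 1), which gives the
uniqueness of the tangent point. -/
theorem tangent_aux {e : ℕ} {z : Plane} (hz : InSector q e z) (x : ℕ) :
    0 ≤ orient z (q (e + 1)) (q x) ∧ (orient z (q (e + 1)) (q x) = 0 →
      ∃ t : ℝ, 0 ≤ t ∧ q x 0 - q (e + 1) 0 = t * (q (e + 1) 0 - z 0) ∧
        q x 1 - q (e + 1) 1 = t * (q (e + 1) 1 - z 1)) := by
  have hc := R.corner_of_inSector hz
  have h1 := R.orient_side_nonneg e x
  have h2 := R.orient_side_nonneg (e + 1) x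
  have h3 : q (e + 1 + 1) = q (e + 2) := rfl
  rw [h3] at h2
  obtain ⟨z1, z2⟩ := hz
  have hid : orient (q e) (q (e + 1)) (q (e + 2)) * orient z (q (e + 1)) (q x) =
      orient (q (e + 1)) (q (e + 2)) (q x) * (-orient (q e) (q (e + 1)) z) +
      orient (q e) (q (e + 1)) (q x) * orient (q (e + 1)) (q (e + 2)) z := by
    simp only [orient_eq]; ring
  have n1 := mul_nonneg h2 (show 0 ≤ -orient (q e) (q (e + 1)) z by linarith)
  have n2 := mul_nonneg h1 z2
  refine ⟨?_, fun h0 => ?_⟩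
  · by_contra hneg
    push Not at hneg
    have := mul_neg_of_pos_of_neg hc hneg
    linarith
  · -- `q x` lies further along the ray
    have hz1 : 0 < -orient (q e) (q (e + 1)) z := by linarith
    refine ⟨orient (q e) (q (e + 1)) (q x) / (-orient (q e) (q (e + 1)) z), by positivity, ?_, ?_⟩
    · rw [div_mul_eq_mul_div, eq_div_iff hz1.ne']
      simp only [orient_eq] at *
      linear_combination -(q (e + 1) 0 - q e 0) * h0
    · rw [div_mul_eq_mul_div, eq_div_iff hz1.ne']
      simp only [orient_eq] at *
      linear_combination -(q (e + 1) 1 - q e 1) * h0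

/-- The ring lies to the left of the tangent from a point of the sector. -/
theorem tangent {e : ℕ} {z : Plane} (hz : InSector q e z) (x : ℕ) :
    0 ≤ orient z (q (e + 1)) (q x) := (R.tangent_aux hz x).1

/-- Each of the two tangent points lies weakly beyond the other on the same ray from z. -/
theorem inSector_unique {e e' : ℕ} {z : Plane} (hz : InSector q e z) (hz' : InSector q e' z) :
    q (e + 1) = q (e' + 1) := by
  have h1 := R.tangent_aux hz (e' + 1)
  have h2 := R.tangent_aux hz' (e + 1)
  have h3 := orient_swap z (q (e + 1)) (q (e' + 1))
  obtain ⟨t, ht, a0, a1⟩ := h1.2 (by linarith [h1.1, h2.1])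
  obtain ⟨s, hs, b0, b1⟩ := h2.2 (by linarith [h1.1, h2.1])
  have c0 : (t + s + t * s) * (q (e + 1) 0 - z 0) = 0 := by linear_combination -b0 - (1 + s) * a0
  have c1 : (t + s + t * s) * (q (e + 1) 1 - z 1) = 0 := by linear_combination -b1 - (1 + s) * a1
  have ht0 : t + s + t * s = 0 := by
    by_contra hne
    have d0 := (mul_eq_zero.1 c0).resolve_left hne
    have d1 := (mul_eq_zero.1 c1).resolve_left hne
    have : q (e + 1) = z := plane_ext (by linarith) (by linarith)
    have h4 := hz.1
    rw [this, orient_self_right] at h4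
    exact lt_irrefl _ h4
  have : t = 0 := by have := mul_nonneg ht hs; linarith
  subst this
  exact (plane_ext (by linarith) (by linarith))

theorem not_inSector_self (e x : ℕ) : ¬ InSector q e (q x) := fun h =>
  absurd h.1 (not_lt.2 (R.orient_side_nonneg e x))

theorem exists_index_of_le {ψ : ℝ} (h : Φ 0 ≤ ψ) : ∃ x, Φ x ≤ ψ ∧ ψ < Φ (x + 1) := by
  have hex : ∃ x, ψ < Φ x := by
    have hk : ∀ k : ℕ, Φ (k * m) = Φ 0 + k * (2 * Real.pi) := by
      intro k
      induction k with
      | zero => simp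
      | succ k ih => rw [Nat.succ_mul, R.angle_add, ih]; push_cast; ring
    obtain ⟨k, hk'⟩ := Archimedean.arch (ψ - Φ 0 + 1) Real.two_pi_pos
    refine ⟨k * m, ?_⟩
    rw [hk]
    rw [nsmul_eq_mul] at hk'
    linarith
  classical
  have h1 := Nat.find_spec hex
  have h2 : Nat.find hex ≠ 0 := fun h0 => by rw [h0] at h1; linarith
  obtain ⟨x, hx⟩ := Nat.exists_eq_succ_of_ne_zero h2
  refine ⟨x, not_lt.1 (Nat.find_min hex (by omega)), ?_⟩
  rw [← Nat.succ_eq_add_one, ← hx]; exact h1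

theorem exists_cone (z : Plane) : ∃ x, 0 ≤ orient o (q x) z ∧ 0 ≤ orient o z (q (x + 1)) := by
  obtain ⟨p0, p1⟩ := exists_polar o z
  set s := ‖(⟨z 0 - o 0, z 1 - o 1⟩ : ℂ)‖
  have hs : 0 ≤ s := norm_nonneg _
  set ψ := Complex.arg ⟨z 0 - o 0, z 1 - o 1⟩
  set φ := toIcoMod Real.two_pi_pos (Φ 0) ψ with hφ
  have hlo : Φ 0 ≤ φ := left_le_toIcoMod _ _ _
  have hc : Real.cos φ = Real.cos ψ := by
    rw [hφ]; unfold toIcoMod; rw [zsmul_eq_mul, Real.cos_sub_int_mul_two_pi]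
  have hsn : Real.sin φ = Real.sin ψ := by
    rw [hφ]; unfold toIcoMod; rw [zsmul_eq_mul, Real.sin_sub_int_mul_two_pi]
  rw [← hc] at p0
  rw [← hsn] at p1
  obtain ⟨x, h1, h2⟩ := R.exists_index_of_le hlo
  obtain ⟨r, hr, a0, a1⟩ := R.polar x
  obtain ⟨r', hr', b0, b1⟩ := R.polar (x + 1)
  have hgap := R.gap x
  refine ⟨x, ?_, ?_⟩
  · rw [orient_polar a0 a1 p0 p1]
    have := Real.sin_nonneg_of_nonneg_of_le_pi (x := φ - Φ x) (by linarith) (by linarith)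
    positivity
  · rw [orient_polar p0 p1 b0 b1]
    have := Real.sin_nonneg_of_nonneg_of_le_pi (x := Φ (x + 1) - φ) (by linarith) (by linarith)
    positivity

/-- Some side is seen from outside, for otherwise z would be a convex combination of o and the ends
of a side; some side is not. Going around the ring, a seen side must be followed by an unseen one.
-/
theorem exists_inSector {z : Plane} (hz : z ∉ convexHull ℝ (Set.range q)) : ∃ e, InSector q e z := by
  -- some side is seen from outside
  have hvis : ∃ x, orient (q x) (q (x + 1)) z < 0 := by
    obtain ⟨x, hA, hB⟩ := R.exists_cone z
    refine ⟨x, ?_⟩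
    by_contra hC
    push Not at hC
    apply hz
    have hD := R.side_pos x
    set D := orient o (q x) (q (x + 1)) with hDd
    have hsum : orient (q x) (q (x + 1)) z = D - orient o (q x) z - orient o z (q (x + 1)) := by
      rw [hDd]; simp only [orient_eq]; ring
    have hconv := convex_convexHull ℝ (Set.range q)
    have ho : o ∈ convexHull ℝ (Set.range q) := interior_subset R.inner
    have hx : ∀ y, q y ∈ convexHull ℝ (Set.range q) := fun y => subset_convexHull ℝ _ ⟨y, rfl⟩
    have hmem := hconv.sum_mem (t := Finset.univ)
      (w := ![orient (q x) (q (x + 1)) z / D, orient o z (q (x + 1)) / D, orient o (q x) z / D])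
      (z := ![o, q x, q (x + 1)])
      (by intro i _; fin_cases i <;> simp <;> positivity)
      (by simp [Fin.sum_univ_three]; field_simp; linarith)
      (by intro i _; fin_cases i <;> simp [ho, hx])
    convert hmem using 1
    rw [Fin.sum_univ_three]
    apply plane_ext
    · simp
      field_simp
      rw [hDd]; simp only [orient_eq]; ring
    · simp
      field_simp
      rw [hDd]; simp only [orient_eq]; ring
  have hinv : ∃ x, 0 ≤ orient (q x) (q (x + 1)) z := by
    -- The side in the direction opposite to z, found by reflecting z in o, is not seen.
    obtain ⟨x, hA, hB⟩ := R.exists_cone ((2 : ℝ) • o - z)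
    refine ⟨x, ?_⟩
    have hD := R.side_pos x
    have e1 : orient o (q x) ((2 : ℝ) • o - z) = -orient o (q x) z := by
      simp [orient_eq]; ring
    have e2 : orient o ((2 : ℝ) • o - z) (q (x + 1)) = -orient o z (q (x + 1)) := by
      simp [orient_eq]; ring
    have hsum : orient (q x) (q (x + 1)) z =
        orient o (q x) (q (x + 1)) - orient o (q x) z - orient o z (q (x + 1)) := by
      simp only [orient_eq]; ring
    linarith
  obtain ⟨x, hx⟩ := hvis
  obtain ⟨y, hy⟩ := hinv
  obtain ⟨y', h1, h2, h3⟩ := exists_mod_eq R.pos y x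
  have hy' : 0 ≤ orient (q y') (q (y' + 1)) z := by
    have e0 : q y' = q y := by rw [← periodic_mod R.per y', h3, periodic_mod R.per]
    have e1 : q (y' + 1) = q (y + 1) := by
      rw [← periodic_mod R.per (y' + 1), Nat.add_mod, h3, ← Nat.add_mod, periodic_mod R.per]
    rw [e0, e1]; exact hy
  classical
  have hex : ∃ k, 0 ≤ orient (q (x + k)) (q (x + k + 1)) z := ⟨y' - x, by
    rw [Nat.add_sub_cancel' h1]; exact hy'⟩
  have hs := Nat.find_spec hex
  have hne : Nat.find hex ≠ 0 := fun h0 => by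
    rw [h0, add_zero] at hs; linarith
  obtain ⟨k, hk⟩ := Nat.exists_eq_succ_of_ne_zero hne
  have hmin := Nat.find_min hex (m := k) (by omega)
  rw [hk] at hs
  exact ⟨x + k, not_le.1 hmin, hs⟩

/-- Crossing from a sector along a line that leaves the ring on its left, one sees the side that
follows the sector. -/
theorem orient_neg_of_leave_sector {e : ℕ} {z w : Plane} (hz : InSector q e z)
    (hw : ¬ InSector q e w) (h : 0 < orient z w (q (e + 1))) :
    orient (q (e + 1)) (q (e + 2)) w < 0 := by
  by_contra hG
  push Not at hG
  have hg : 0 ≤ orient (q e) (q (e + 1)) w := by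
    by_contra hlt
    exact hw ⟨not_le.1 hlt, hG⟩
  have hc := R.corner_of_inSector hz
  have hid : orient (q e) (q (e + 1)) (q (e + 2)) * orient z w (q (e + 1)) =
      orient (q e) (q (e + 1)) z * orient (q (e + 1)) (q (e + 2)) w -
      orient (q e) (q (e + 1)) w * orient (q (e + 1)) (q (e + 2)) z := by
    simp only [orient_eq]; ring
  have h1 := mul_pos hc h
  have h2 := mul_nonneg hg hz.2
  have h3 := mul_nonneg (neg_nonneg.2 hz.1.le) hG
  linarith

end ConvexRing

/-! ### The frame: an outer ring grouped by the sectors of an inner ring -/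

/-- An outer ring `p` and an inner ring `q`. The outer points are grouped into nodes: node `k`
consists of the `p i` with `b k ≤ i < b (k + 1)`, all of which lie in sector `e k` of `q`. -/
structure Frame (o : Plane) (h m N : ℕ) (p q : ℕ → Plane) (Θ Φ : ℕ → ℝ) (b e : ℕ → ℕ) : Prop where
  ringP : ConvexRing o h p Θ
  ringQ : ConvexRing o m q Φ
  hull : ∀ i x, 0 < orient (p i) (p (i + 1)) (q x)
  bmono : StrictMono b
  emono : StrictMono e
  bper : ∀ k, b (k + N) = b k + h
  eper : ∀ k, e (k + N) = e k + m
  sector : ∀ k i, b k ≤ i → i < b (k + 1) → InSector q (e k) (p i)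
  leave : ∀ k, ¬ InSector q (e k) (p (b (k + 1)))

/-- The indices are cut at the jumps of E. Since E gains m > 0 in each period, there are infinitely
many jumps, enumerated by `Nat.nth`, and N is their number in one period. -/
theorem exists_nodes {E : ℕ → ℕ} {h m : ℕ} (hE : Monotone E) (hper : ∀ i, E (i + h) = E i + m)
    (hm : 0 < m) : ∃ (N : ℕ) (b : ℕ → ℕ), StrictMono b ∧ (∀ k, b (k + N) = b k + h) ∧
      (∀ k i, b k ≤ i → i < b (k + 1) → E i = E (b k)) ∧
      (∀ k, ∃ j, b (k + 1) = j + 1 ∧ b k ≤ j ∧ E j < E (j + 1)) := by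
  classical
  set D : ℕ → Prop := fun i => E i < E (i + 1) with hD
  have hDper : ∀ i, D (h + i) ↔ D i := by
    intro i
    simp only [hD]
    rw [show h + i = i + h by omega, show i + h + 1 = i + 1 + h by omega, hper, hper]
    omega
  have hconst : ∀ a c, a ≤ c → (∀ j, a ≤ j → j < c → ¬ D j) → E c = E a := by
    intro a c hac hno
    induction c, hac using Nat.le_induction with
    | base => rfl
    | succ c hac ih =>
      have h1 := hno c hac (by omega)
      have h2 := hE (Nat.le_succ c)
      have h3 := ih fun j h4 h5 => hno j h4 (by omega)
      simp only [hD, not_lt, Nat.succ_eq_add_one] at h1 h2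
      omega
  have hinf : {i | D i}.Infinite := by
    rw [Set.infinite_iff_exists_gt]
    intro a
    by_contra hcon
    push Not at hcon
    have := hconst (a + 1) (a + 1 + h) (by omega) fun j h1 _ h3 => by
      have := hcon j h3; omega
    rw [hper] at this; omega
  have hnth : ∀ k, D (Nat.nth D k) := fun k => Nat.nth_mem_of_infinite hinf k
  have hmono : StrictMono (Nat.nth D) := Nat.nth_strictMono hinf
  have hcount : ∀ x, Nat.count D (x + h) = Nat.count D x + Nat.count D h := by
    intro x
    rw [Nat.add_comm x h, Nat.count_add, Nat.add_comm]
    congr 1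
    simp only [hDper]
  refine ⟨Nat.count D h, fun k => Nat.nth D k + 1, fun k l hkl => ?_, fun k => ?_,
    fun k i h1 h2 => ?_, fun k => ?_⟩
  · have := hmono hkl; simp only; omega
  · have h1 : D (Nat.nth D k + h) := by
      rw [Nat.add_comm, hDper]; exact hnth k
    have h2 := Nat.nth_count h1
    rw [hcount, Nat.count_nth_of_infinite hinf] at h2
    simp only; omega
  · simp only at h1 h2
    refine hconst (Nat.nth D k + 1) i h1 fun j h3 h4 h5 => ?_
    have h6 := Nat.nth_count h5
    have h7 : Nat.nth D k < Nat.nth D (Nat.count D j) := by omega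
    have h8 : Nat.nth D (Nat.count D j) < Nat.nth D (k + 1) := by omega
    have := hmono.lt_iff_lt.1 h7
    have := hmono.lt_iff_lt.1 h8
    omega
  · have := hmono (Nat.lt_succ_self k)
    exact ⟨Nat.nth D (k + 1), rfl, this, hnth (k + 1)⟩

theorem exists_frame {o : Plane} {h m : ℕ} {p q : ℕ → Plane} {Θ Φ : ℕ → ℝ}
    (RP : ConvexRing o h p Θ) (RQ : ConvexRing o m q Φ)
    (hull : ∀ i x, 0 < orient (p i) (p (i + 1)) (q x))
    (hout : ∀ i, p i ∉ convexHull ℝ (Set.range q)) (h0 : Φ 0 ≤ Θ 0) :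
    ∃ N b e, Frame o h m N p q Θ Φ b e := by
  have hpi := Real.pi_pos
  -- The sector is defined modulo m only. The condition that the angle of the tangent point exceeds
  -- Θ i by less than π selects one integer index, and `h0` keeps it in ℕ.
  have hlift : ∀ i, ∃ e, InSector q e (p i) ∧ Θ i < Φ (e + 1) ∧ Φ (e + 1) < Θ i + Real.pi := by
    intro i
    obtain ⟨e, he⟩ := RQ.exists_inSector (hout i)
    obtain ⟨x, hx1, hx2⟩ := RQ.exists_index_of_le (h0.trans (RP.mono.monotone (Nat.zero_le i)))
    obtain ⟨j, j1, j2, j3⟩ := exists_mod_eq RQ.pos e x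
    have hj := RQ.inSector_congr j3.symm he
    have m1 := RQ.mono.monotone (show x + 1 ≤ j + 1 by omega)
    have m2 := RQ.mono.monotone (show j + 1 ≤ x + m by omega)
    rw [RQ.angle_add] at m2
    refine ⟨j, hj, by linarith, ?_⟩
    have hne : p i ≠ q (j + 1) := fun hc => hout i (hc ▸ subset_convexHull ℝ _ ⟨j + 1, rfl⟩)
    have hpos : 0 < orient (p i) (q (j + 1)) o := by
      refine orient_pos_of_mem_interior RQ.inner hne ?_
      rintro _ ⟨y, rfl⟩
      exact RQ.tangent hj y
    rw [← orient_rotate] at hpos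
    obtain ⟨r, hr, a0, a1⟩ := RP.polar i
    obtain ⟨s, hs, b0, b1⟩ := RQ.polar (j + 1)
    rw [orient_polar a0 a1 b0 b1] at hpos
    by_contra hle
    push Not at hle
    have := Real.sin_nonneg_of_nonneg_of_le_pi (x := Φ (j + 1) - Θ i - Real.pi) (by linarith)
      (by linarith)
    rw [Real.sin_sub_pi] at this
    have hrs : 0 < r * s := by positivity
    have := mul_nonneg hrs.le this
    linarith
  choose E hE1 hE2 hE3 using hlift
  have huniq : ∀ i e, InSector q e (p i) → Θ i < Φ (e + 1) → Φ (e + 1) < Θ i + Real.pi →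
      e = E i := by
    intro i e h1 h2 h3
    have hq := RQ.inSector_unique h1 (hE1 i)
    have h4 := hE2 i
    have h5 := hE3 i
    rcases lt_trichotomy e (E i) with hlt | heq | hgt
    · refine absurd hq (RQ.ne_of_lt (by omega) (RQ.mono.lt_iff_lt.1 ?_))
      rw [RQ.angle_add]; linarith
    · exact heq
    · refine absurd hq.symm (RQ.ne_of_lt (by omega) (RQ.mono.lt_iff_lt.1 ?_))
      rw [RQ.angle_add]; linarith
  have hper : ∀ i, E (i + h) = E i + m := by
    intro i
    refine (huniq (i + h) (E i + m) ?_ ?_ ?_).symm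
    · rw [RP.per]; exact RQ.inSector_congr (by simp) (hE1 i)
    · rw [show E i + m + 1 = E i + 1 + m by omega, RQ.angle_add, RP.angle_add]
      linarith [hE2 i]
    · rw [show E i + m + 1 = E i + 1 + m by omega, RQ.angle_add, RP.angle_add]
      linarith [hE3 i]
  have hmono : Monotone E := by
    refine monotone_nat_of_le_succ fun i => ?_
    by_contra hlt
    push Not at hlt
    have hmQ := RQ.mono (show E (i + 1) + 1 < E i + 1 by omega)
    have hmP := RP.mono (Nat.lt_succ_self i)
    simp only [Nat.succ_eq_add_one] at hmP
    have a1 := hE2 (i + 1)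
    have a2 := hE3 i
    -- Suppose that the tangent point moved backwards, from A to B, while the hull side from p i to
    -- p (i + 1) is traversed. The identity below then has a positive left and a nonpositive right
    -- side.
    have T1 := RQ.tangent (hE1 i) (E (i + 1) + 1)
    have T2 := RQ.tangent (hE1 (i + 1)) (E i + 1)
    have hH := hull i (E i + 1)
    have hba := RQ.orient_center_pos hmQ (by linarith)
    obtain ⟨r, hr, p0, p1⟩ := RP.polar i
    obtain ⟨r', hr', p0', p1'⟩ := RP.polar (i + 1)
    obtain ⟨s, hs, q0, q1⟩ := RQ.polar (E (i + 1) + 1)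
    have hpb : 0 < orient o (p i) (q (E (i + 1) + 1)) := by
      rw [orient_polar p0 p1 q0 q1]
      have := Real.sin_pos_of_pos_of_lt_pi (x := Φ (E (i + 1) + 1) - Θ i) (by linarith) (by linarith)
      positivity
    have hpb' : 0 < orient o (p (i + 1)) (q (E (i + 1) + 1)) := by
      rw [orient_polar p0' p1' q0 q1]
      have := Real.sin_pos_of_pos_of_lt_pi (x := Φ (E (i + 1) + 1) - Θ (i + 1)) (by linarith)
        (by linarith)
      positivity
    generalize q (E (i + 1) + 1) = B at *
    generalize q (E i + 1) = A at *
    have hid : (orient (p i) A B + orient (p i) (p (i + 1)) A) * orient o B A =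
        -(orient (p (i + 1)) B A * (orient o (p i) B + orient o B A) +
          orient (p i) A B * orient o (p (i + 1)) B) := by
      simp only [orient_eq]; ring
    have k1 := mul_pos (show 0 < orient (p i) A B + orient (p i) (p (i + 1)) A by linarith) hba
    have k2 := mul_nonneg T2 (show 0 ≤ orient o (p i) B + orient o B A by linarith)
    have k3 := mul_nonneg T1 hpb'.le
    linarith
  obtain ⟨N, b, hb, hbper, hsec, hstep⟩ := exists_nodes hmono hper RQ.pos
  have hstep' : ∀ k, ∃ j, b (k + 1) = j + 1 ∧ E j = E (b k) ∧ E j < E (j + 1) := by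
    intro k
    obtain ⟨j, j1, j2, j3⟩ := hstep k
    exact ⟨j, j1, hsec k j j2 (by omega), j3⟩
  refine ⟨N, b, fun k => E (b k), RP, RQ, hull, hb, ?_, hbper, ?_, ?_, ?_⟩
  · refine strictMono_nat_of_lt_succ fun k => ?_
    obtain ⟨j, j1, j2, j3⟩ := hstep' k
    rw [j1, ← j2]; exact j3
  · intro k
    rw [hbper, hper]
  · intro k i h1 h2
    rw [← hsec k i h1 h2]; exact hE1 i
  · intro k hc
    obtain ⟨j, j1, j2, j3⟩ := hstep' k
    rw [j1, ← j2] at hc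
    -- A return to the same sector would mean an advance by a full turn, but successive outer points
    -- differ by less than π, and so does each from its tangent point.
    have hq := RQ.inSector_unique hc (hE1 (j + 1))
    refine RQ.ne_of_lt (by omega) (RQ.mono.lt_iff_lt.1 ?_) hq
    rw [RQ.angle_add]
    have := RP.gap j
    linarith [hE3 (j + 1), hE2 j]

theorem segCompat_of_pos {u v a b c d : Plane} (ha : orient u v a = 0) (hb : orient u v b = 0)
    (hc : 0 < orient u v c) (hd : 0 < orient u v d) : SegCompat a b c d := by
  refine segCompat_of_on_line ha hb hc.le hd fun h => ?_
  obtain ⟨t, _, _, _, _, ht⟩ := orient_of_mem_segment h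
  have := ht u v
  rw [ha, hb] at this
  simp only [mul_zero, add_zero] at this
  exact absurd this hc.ne'

/-! ### Nodes, chords and admissible edges of a frame. -/

namespace Frame

variable {o : Plane} {h m N : ℕ} {p q : ℕ → Plane} {Θ Φ : ℕ → ℝ} {b e : ℕ → ℕ}

section basic

variable (F : Frame o h m N p q Θ Φ b e)
include F

/-- With a single node, the point that leaves its sector would be a point of that node again. -/
theorem two_le : 2 ≤ N := by
  by_contra hlt
  have h1 := F.leave 0
  have h2 := F.sector 0 (b 0) le_rfl (F.bmono (Nat.lt_succ_self 0))
  rcases (show N = 0 ∨ N = 1 by omega) with rfl | rfl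
  · have := F.bper 0
    have := F.ringP.pos
    simp at *; omega
  · rw [F.bper, F.ringP.per] at h1
    exact h1 h2

theorem corner (k : ℕ) : 0 < orient (q (e k)) (q (e k + 1)) (q (e k + 2)) :=
  F.ringQ.corner_of_inSector (F.sector k (b k) le_rfl (F.bmono (Nat.lt_succ_self k)))

theorem p_ne_q (i x : ℕ) : p i ≠ q x := fun hc => by
  have := F.hull i x
  rw [← hc, orient_self_outer] at this
  exact lt_irrefl _ this

theorem sector_disjoint {k k' : ℕ} (h1 : k < k') (h2 : k' < k + N) {z : Plane}
    (hz : InSector q (e k) z) (hz' : InSector q (e k') z) : False := by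
  refine F.ringQ.ne_of_lt (i := e k + 1) (j := e k' + 1) ?_ ?_ (F.ringQ.inSector_unique hz hz')
  · have := F.emono h1; omega
  · have := F.emono h2; rw [F.eper] at this; omega

/-- The line of the side is written from either of its ends; at the end e k + 1 its second point is
obtained by translation along the side. This is the half-plane that `orient_pos_trans` needs. -/
theorem node_orient_neg {k i x : ℕ} (h1 : b k ≤ i) (h2 : i < b (k + 1))
    (hx : x = e k ∨ x = e k + 1) : orient (q x) (q (e k + 1) + (q x - q (e k))) (p i) < 0 := by
  have := (F.sector k i h1 h2).1
  rcases hx with rfl | rfl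
  · simpa using this
  · rw [orient_eq] at *; simp; linarith

/-- The points of a node in angular order around the two ends of its side. -/
theorem node_orient_pos {k i j x : ℕ} (h1 : b k ≤ i) (hij : i < j) (h2 : j < b (k + 1))
    (hx : x = e k ∨ x = e k + 1) : 0 < orient (q x) (p i) (p j) := by
  induction j, hij using Nat.le_induction with
  | base => rw [orient_rotate]; exact F.hull i x
  | succ j hij ih =>
    refine orient_pos_trans (F.node_orient_neg h1 (by omega) hx)
      (F.node_orient_neg (i := j) (by omega) (by omega) hx) (F.node_orient_neg (by omega) h2 hx)
      (ih (by omega)) ?_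
    rw [orient_rotate]; exact F.hull j x

end basic

/-! ### Chords of the inner ring -/

/-- All other points of the inner ring lie strictly on one of the two sides of the chord. -/
def ProperChord (m : ℕ) (q : ℕ → Plane) (i j : ℕ) : Prop :=
  (∀ x, i < x → x < j → orient (q i) (q j) (q x) < 0) ∧
    ∀ x, j < x → x < i + m → 0 < orient (q i) (q j) (q x)

/-- The chord joining `q z` to the ends of the side at `q s` can be used to insert `q z` into
this side. -/
structure IsSpike (m N : ℕ) (q : ℕ → Plane) (e : ℕ → ℕ) (s z : ℕ) : Prop where
  left : e 0 < s
  sep : s + 3 ≤ z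
  right : z < e N
  chord : ProperChord m q s z
  chord' : ProperChord m q (s + 1) z

section chords

variable (F : Frame o h m N p q Θ Φ b e)
include F

/-- The ring is only weakly convex; a genuine corner on each of the two arcs is what makes both
signs strict. -/
theorem properChord_of_corners {i j k l : ℕ} (hik : i ≤ e k) (hkj : e k + 2 ≤ j) (hjl : j ≤ e l)
    (hli : e l + 2 ≤ i + m) : ProperChord m q i j := by
  refine ⟨fun x h1 h2 => ?_, fun x h1 h2 => ?_⟩
  · have := F.ringQ.orient_chord_pos hik hkj hjl hli (F.corner k) (F.corner l) h1 h2
    rw [orient_swap] at this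
    linarith
  · exact F.ringQ.orient_chord_pos' hik hkj hjl hli (F.corner k) (F.corner l) h1 h2

theorem eN : e N = e 0 + m := by simpa using F.eper 0

theorem bN : b N = b 0 + h := by simpa using F.bper 0

theorem chord_mem {i j : ℕ} (hC : ProperChord m q i j) (x : ℕ)
    (hx : q x ∈ segment ℝ (q i) (q j)) : q x = q i ∨ q x = q j := by
  obtain ⟨y, y1, y2, e1⟩ := F.ringQ.exists_rep x i
  rw [← e1] at hx ⊢
  obtain ⟨t, _, _, _, _, ht⟩ := orient_of_mem_segment hx
  have h0 := ht (q i) (q j)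
  simp only [orient_self_outer, orient_self_right, mul_zero, add_zero] at h0
  rcases lt_trichotomy y j with hlt | rfl | hgt
  · rcases y1.eq_or_lt with rfl | hiy
    · exact Or.inl rfl
    · exact absurd h0 (hC.1 y hiy hlt).ne
  · exact Or.inr rfl
  · exact absurd h0 (hC.2 y hgt y2).ne'

theorem chord_sign {i j : ℕ} (hC : ProperChord m q i j) (hi : e 0 < i) (hj : j < e N) {y : ℕ}
    (hy : e 0 ≤ y) (hy' : y ≤ e N) :
    (i < y ∧ y < j → orient (q i) (q j) (q y) < 0) ∧
      (y < i ∨ j < y → i < j → 0 < orient (q i) (q j) (q y)) := by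
  have hN := F.eN
  refine ⟨fun hh => hC.1 y hh.1 hh.2, fun hh hij => ?_⟩
  rcases hh with hh | hh
  · rw [← F.ringQ.per y]; exact hC.2 _ (by omega) (by omega)
  · exact hC.2 _ hh (by omega)

/-- A chord is compatible with any pair of points on one side of it. -/
theorem chord_compat {i j : ℕ} (hC : ProperChord m q i j) (hi : e 0 < i) (hij : i < j)
    (hj : j < e N) {y y' : ℕ} (hy : e 0 ≤ y) (hyy : y < y') (hy' : y' ≤ e N)
    (hside : y' ≤ i ∨ (i ≤ y ∧ y' ≤ j) ∨ j ≤ y) (hne : ¬(y = i ∧ y' = j)) :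
    SegCompat (q i) (q j) (q y) (q y') := by
  have h0 : orient (q i) (q j) (q i) = 0 := by simp
  have h1 : orient (q i) (q j) (q j) = 0 := by simp
  have hmem := fun x => F.chord_mem hC x
  rcases hside with hs | hs | hs
  · have a := (F.chord_sign hC hi hj hy (by omega)).2 (Or.inl (by omega)) hij
    refine (segCompat_of_on_line (u := q i) (v := q j) h0 h1 ?_ a (hmem y')).flip_right
    rcases hs.eq_or_lt with rfl | hlt
    · exact h0.ge
    · exact ((F.chord_sign hC hi hj (by omega) hy').2 (Or.inl hlt) hij).le
  · have key : ∀ w, i ≤ w → w ≤ j → orient (q i) (q j) (q w) ≤ 0 := by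
      intro w w1 w2
      rcases w1.eq_or_lt with rfl | w1
      · exact h0.le
      rcases w2.eq_or_lt with rfl | w2
      · exact h1.le
      exact (hC.1 w w1 w2).le
    rcases hs.1.eq_or_lt with rfl | hlt
    · exact segCompat_of_on_line' (u := q i) (v := q j) h0 h1 h0.le
        (hC.1 y' hyy (by omega)) (hmem i)
    · exact (segCompat_of_on_line' (u := q i) (v := q j) h0 h1 (key y' (by omega) hs.2)
        (hC.1 y hlt (by omega)) (hmem y')).flip_right
  · have a := (F.chord_sign hC hi hj (by omega) hy').2 (Or.inr (by omega)) hij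
    refine segCompat_of_on_line (u := q i) (v := q j) h0 h1 ?_ a (hmem y)
    rcases hs.eq_or_lt with rfl | hlt
    · exact h1.ge
    · exact ((F.chord_sign hC hi hj hy (by omega)).2 (Or.inr hlt) hij).le

end chords

/-! ### Edges -/

/-- The edges used by the polygonalizations. -/
inductive Edge (N : ℕ) (p q : ℕ → Plane) (b e : ℕ → ℕ) (Sp : Set (ℕ × ℕ)) : Plane → Plane → Prop
  | side (x : ℕ) : e 0 ≤ x → x < e N → Edge N p q b e Sp (q x) (q (x + 1))
  | spikeIn (s z : ℕ) : (s, z) ∈ Sp → Edge N p q b e Sp (q s) (q z)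
  | spikeOut (s z : ℕ) : (s, z) ∈ Sp → Edge N p q b e Sp (q z) (q (s + 1))
  | hull (i : ℕ) : b 0 ≤ i → i < b N → Edge N p q b e Sp (p i) (p (i + 1))
  -- Entry from the far end of the side is reserved for even nodes and exit to its near end for odd
  -- nodes: used at the same node, such an entry and exit could cross.
  | enter (k x i : ℕ) : k < N → (x = e k ∨ (x = e k + 1 ∧ Even k)) → i = b k →
      Edge N p q b e Sp (q x) (p i)
  | exit (k x i : ℕ) : k < N → (x = e k + 1 ∨ (x = e k ∧ ¬ Even k)) → i + 1 = b (k + 1) →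
      Edge N p q b e Sp (p i) (q x)

theorem Edge.mono {Sp Sp' : Set (ℕ × ℕ)} (hsub : Sp ⊆ Sp') {u v : Plane}
    (hE : Edge N p q b e Sp u v) : Edge N p q b e Sp' u v := by
  cases hE with
  | side x h1 h2 => exact .side x h1 h2
  | spikeIn s z h1 => exact .spikeIn s z (hsub h1)
  | spikeOut s z h1 => exact .spikeOut s z (hsub h1)
  | hull i h1 h2 => exact .hull i h1 h2
  | enter k x i h1 h2 h3 => exact .enter k x i h1 h2 h3
  | exit k x i h1 h2 h3 => exact .exit k x i h1 h2 h3

/-- The spikes of a family occupy disjoint intervals. -/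
structure SpikeFamily (m N : ℕ) (q : ℕ → Plane) (e : ℕ → ℕ) (Sp : Set (ℕ × ℕ)) : Prop where
  spike : ∀ w ∈ Sp, IsSpike m N q e w.1 w.2
  disj : ∀ w ∈ Sp, ∀ w' ∈ Sp, w ≠ w' → w.2 < w'.1 ∨ w'.2 < w.1

section compat

variable (F : Frame o h m N p q Θ Φ b e) {Sp : Set (ℕ × ℕ)} (hSp : SpikeFamily m N q e Sp)
include F

theorem hull_inner_compat (i x y : ℕ) : SegCompat (p i) (p (i + 1)) (q x) (q y) :=
  segCompat_of_pos (u := p i) (v := p (i + 1)) (by simp) (by simp) (F.hull i x) (F.hull i y)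

theorem hull_wedge_compat (i j x : ℕ) : SegCompat (p i) (p (i + 1)) (p j) (q x) :=
  segCompat_of_on_line (u := p i) (v := p (i + 1)) (by simp) (by simp)
    (F.ringP.orient_side_nonneg i j) (F.hull i x) fun hm => F.ringP.mem_side hm

/-- The line of the side of node k has p i strictly on one side and the whole ring on the other. The
hypothesis on q x matters only when the inner segment lies in that line. -/
theorem wedge_inner_compat {k i x y y' : ℕ} (h1 : b k ≤ i) (h2 : i < b (k + 1))
    (hx : x = e k ∨ x = e k + 1)
    (hmem : q x ∈ segment ℝ (q y) (q y') → q x = q y ∨ q x = q y') :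
    SegCompat (p i) (q x) (q y) (q y') := by
  have hs := (F.sector k i h1 h2).1
  have hx0 : orient (q (e k)) (q (e k + 1)) (q x) = 0 := by
    rcases hx with rfl | rfl <;> simp
  have n1 := F.ringQ.orient_side_nonneg (e k) y
  have n2 := F.ringQ.orient_side_nonneg (e k) y'
  by_cases hz : orient (q (e k)) (q (e k + 1)) (q y) = 0 ∧ orient (q (e k)) (q (e k + 1)) (q y') = 0
  · exact (segCompat_of_on_line' hz.1 hz.2 hx0.le hs hmem).flip_right.symm
  · refine segCompat_of_separated hs.le hx0.le (Or.inl hs.ne) n1 n2 ?_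
    by_contra hcon
    push Not at hcon
    exact hz hcon

theorem wedge_mem_sector {k i x : ℕ} (h1 : b k ≤ i) (h2 : i < b (k + 1))
    (hx : x = e k ∨ x = e k + 1) {z : Plane} (hz : z ∈ segment ℝ (p i) (q x)) :
    z = q x ∨ InSector q (e k) z := by
  obtain ⟨t, t0, t1, _, e1, ht⟩ := orient_of_mem_segment hz
  obtain ⟨s1, s2⟩ := F.sector k i h1 h2
  have hx0 : orient (q (e k)) (q (e k + 1)) (q x) = 0 := by
    rcases hx with rfl | rfl <;> simp
  have hx1 := F.ringQ.orient_side_nonneg (e k + 1) x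
  rw [show e k + 1 + 1 = e k + 2 from rfl] at hx1
  rcases t1.eq_or_lt with rfl | hlt
  · exact Or.inl (e1 rfl)
  · right
    refine ⟨?_, ?_⟩
    · rw [ht, hx0]
      have := mul_neg_of_pos_of_neg (show 0 < 1 - t by linarith) s1
      linarith
    · rw [ht]
      have := mul_nonneg (show 0 ≤ 1 - t by linarith) s2
      have := mul_nonneg t0 hx1
      linarith

/-- Except for its inner end, a segment from a node to its side stays in the sector of the node
(`wedge_mem_sector`), and different sectors are disjoint. -/
theorem wedge_wedge_compat {k k' i i' x x' : ℕ} (hk : k < N) (hk' : k' < N) (hkk : k ≠ k')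
    (h1 : b k ≤ i) (h2 : i < b (k + 1)) (hx : x = e k ∨ x = e k + 1)
    (h1' : b k' ≤ i') (h2' : i' < b (k' + 1)) (hx' : x' = e k' ∨ x' = e k' + 1) :
    SegCompat (p i) (q x) (p i') (q x') := by
  rintro z ⟨z1, z2⟩
  have a1 := F.wedge_mem_sector h1 h2 hx z1
  have a2 := F.wedge_mem_sector h1' h2' hx' z2
  rcases a1 with rfl | a1
  · rcases a2 with a2 | a2
    · exact ⟨Or.inr rfl, Or.inr a2⟩
    · exact absurd a2 (F.ringQ.not_inSector_self _ _)
  · rcases a2 with rfl | a2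
    · exact absurd a1 (F.ringQ.not_inSector_self _ _)
    · rcases lt_or_gt_of_ne hkk with hlt | hlt
      · exact (F.sector_disjoint hlt (by omega) a1 a2).elim
      · exact (F.sector_disjoint hlt (by omega) a2 a1).elim

/-- Seen from an end of the side, the points of a node come in angular order (`node_orient_pos`), so
the exit from the later point stays on the left of the entering edge. -/
theorem enter_exit_compat {k i j x y : ℕ} (h1 : b k ≤ i) (hij : i ≤ j) (h2 : j < b (k + 1))
    (hxy : (x = e k ∧ y = e k + 1) ∨ (i < j ∧ x = y ∧ (x = e k ∨ x = e k + 1))) :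
    SegCompat (q x) (p i) (p j) (q y) := by
  rcases hxy with ⟨rfl, rfl⟩ | ⟨hlt, rfl, hx⟩
  · have hq : 0 < orient (q (e k)) (p i) (q (e k + 1)) := by
      have := (F.sector k i h1 (by omega)).1
      rw [orient_swap]; linarith
    refine segCompat_of_on_line (u := q (e k)) (v := p i) (by simp) (by simp) ?_ hq ?_
    · rcases hij.eq_or_lt with rfl | hlt
      · simp
      · exact (F.node_orient_pos h1 hlt h2 (Or.inl rfl)).le
    · rcases hij.eq_or_lt with rfl | hlt
      · exact fun _ => Or.inr rfl
      · intro hm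
        obtain ⟨t, _, _, _, _, ht⟩ := orient_of_mem_segment hm
        have h3 := ht (q (e k)) (p i)
        simp only [orient_self_outer, orient_self_right, mul_zero, add_zero] at h3
        exact absurd h3 (F.node_orient_pos h1 hlt h2 (Or.inl rfl)).ne'
  · exact (segCompat_of_on_line (u := q x) (v := p i) (by simp) (by simp) (by simp)
      (F.node_orient_pos h1 hlt h2 hx) fun _ => Or.inl rfl).flip_right

theorem inner_mem_side (x y : ℕ) (hm : q y ∈ segment ℝ (q x) (q (x + 1))) :
    q y = q x ∨ q y = q (x + 1) := F.ringQ.mem_side hm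

include hSp

theorem spike_side_compat {s z i x : ℕ} (hs : (s, z) ∈ Sp) (hi : i = s ∨ i = s + 1)
    (h1 : e 0 ≤ x) (h2 : x < e N) : SegCompat (q i) (q z) (q x) (q (x + 1)) := by
  have S := hSp.spike _ hs
  have h3 := S.left
  have h4 := S.sep
  have h5 := S.right
  simp only at h3 h4 h5
  have hC : ProperChord m q i z := by
    rcases hi with rfl | rfl
    exacts [S.chord, S.chord']
  exact F.chord_compat hC (by omega) (by omega) h5 h1 (by omega) h2 (by omega) (by omega)

theorem spike_mem {s z i y : ℕ} (hs : (s, z) ∈ Sp) (hi : i = s ∨ i = s + 1)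
    (hm : q y ∈ segment ℝ (q i) (q z)) : q y = q i ∨ q y = q z := by
  have S := hSp.spike _ hs
  have hC : ProperChord m q i z := by
    rcases hi with rfl | rfl
    exacts [S.chord, S.chord']
  exact F.chord_mem hC y hm

theorem spike_spike_compat {s z i s' z' i' : ℕ} (hs : (s, z) ∈ Sp) (hi : i = s ∨ i = s + 1)
    (hs' : (s', z') ∈ Sp) (hi' : i' = s' ∨ i' = s' + 1) (hne : ¬(i = i' ∧ z = z')) :
    SegCompat (q i) (q z) (q i') (q z') := by
  have S := hSp.spike _ hs
  have S' := hSp.spike _ hs'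
  have h3 := S.left
  have h4 := S.sep
  have h5 := S.right
  have h3' := S'.left
  have h4' := S'.sep
  have h5' := S'.right
  simp only at h3 h4 h5 h3' h4' h5'
  have hC : ProperChord m q i z := by
    rcases hi with rfl | rfl
    exacts [S.chord, S.chord']
  have hC' : ProperChord m q i' z' := by
    rcases hi' with rfl | rfl
    exacts [S'.chord, S'.chord']
  by_cases hw : (s, z) = (s', z')
  · obtain ⟨rfl, rfl⟩ := Prod.mk.inj hw
    rcases lt_or_gt_of_ne (show i ≠ i' by intro h0; exact hne ⟨h0, rfl⟩) with hlt | hlt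
    · exact F.chord_compat hC (by omega) (by omega) h5 (by omega) (by omega) (by omega) (by omega)
        (by omega)
    · exact (F.chord_compat hC' (by omega) (by omega) h5 (by omega) (by omega) (by omega) (by omega)
        (by omega)).symm
  · have := hSp.disj _ hs _ hs' hw
    simp only at this
    exact F.chord_compat hC (by omega) (by omega) h5 (by omega) (by omega) (by omega) (by omega)
      (by omega)

/-- Simplicity is checked once for all admissible edges, independently of the path. The construction
of paths only has to stay within `Edge` and a family of disjoint spikes. -/
theorem edge_compat {u v u' v' : Plane} (E : Edge N p q b e Sp u v) (E' : Edge N p q b e Sp u' v')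
    (h1 : u ≠ u') (h2 : v ≠ v') (h3 : u = v' → v ≠ u') : SegCompat u v u' v' := by
  have hb : ∀ k, b k < b (k + 1) := fun k => F.bmono (Nat.lt_succ_self k)
  have hbN := F.bN
  have heN := F.eN
  cases E with
  | side x x1 x2 =>
    cases E' with
    | side y y1 y2 =>
      rcases lt_trichotomy x y with hlt | rfl | hlt
      · exact F.ringQ.side_compat hlt (by omega)
      · exact absurd rfl h1
      · exact (F.ringQ.side_compat hlt (by omega)).symm
    | spikeIn s z hs => exact (F.spike_side_compat hSp hs (Or.inl rfl) x1 x2).symm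
    | spikeOut s z hs => exact (F.spike_side_compat hSp hs (Or.inr rfl) x1 x2).flip_left.symm
    | hull i i1 i2 => exact (F.hull_inner_compat i _ _).symm
    | enter k y i k1 k2 k3 =>
      subst k3
      exact (F.wedge_inner_compat le_rfl (hb k) (by tauto) (F.inner_mem_side x y)).flip_left.symm
    | exit k y i k1 k2 k3 =>
      have := hb k
      exact (F.wedge_inner_compat (k := k) (by omega) (by omega) (by tauto)
        (F.inner_mem_side x y)).symm
  | spikeIn s z hs =>
    cases E' with
    | side y y1 y2 => exact F.spike_side_compat hSp hs (Or.inl rfl) y1 y2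
    | spikeIn s' z' hs' =>
      exact F.spike_spike_compat hSp hs (Or.inl rfl) hs' (Or.inl rfl) (by
        rintro ⟨rfl, rfl⟩; exact h1 rfl)
    | spikeOut s' z' hs' =>
      exact (F.spike_spike_compat hSp hs (Or.inl rfl) hs' (Or.inr rfl) (by
        rintro ⟨rfl, rfl⟩; exact h3 rfl rfl)).flip_right
    | hull i i1 i2 => exact (F.hull_inner_compat i _ _).symm
    | enter k y i k1 k2 k3 =>
      subst k3
      exact (F.wedge_inner_compat le_rfl (hb k) (by tauto)
        (F.spike_mem hSp hs (Or.inl rfl))).flip_left.symm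
    | exit k y i k1 k2 k3 =>
      have := hb k
      exact (F.wedge_inner_compat (k := k) (by omega) (by omega) (by tauto)
        (F.spike_mem hSp hs (Or.inl rfl))).symm
  | spikeOut s z hs =>
    cases E' with
    | side y y1 y2 => exact (F.spike_side_compat hSp hs (Or.inr rfl) y1 y2).flip_left
    | spikeIn s' z' hs' =>
      exact (F.spike_spike_compat hSp hs (Or.inr rfl) hs' (Or.inl rfl) (by
        rintro ⟨h4, rfl⟩; exact h3 rfl (by rw [h4]))).flip_left
    | spikeOut s' z' hs' =>
      exact (F.spike_spike_compat hSp hs (Or.inr rfl) hs' (Or.inr rfl) (by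
        rintro ⟨h4, rfl⟩; exact h1 rfl)).flip_left.flip_right
    | hull i i1 i2 => exact (F.hull_inner_compat i _ _).symm
    | enter k y i k1 k2 k3 =>
      subst k3
      exact (F.wedge_inner_compat le_rfl (hb k) (by tauto)
        (F.spike_mem hSp hs (Or.inr rfl))).flip_left.symm.flip_left
    | exit k y i k1 k2 k3 =>
      have := hb k
      exact (F.wedge_inner_compat (k := k) (by omega) (by omega) (by tauto)
        (F.spike_mem hSp hs (Or.inr rfl))).symm.flip_left
  | hull i i1 i2 =>
    cases E' with
    | side y y1 y2 => exact F.hull_inner_compat i _ _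
    | spikeIn s z hs => exact F.hull_inner_compat i _ _
    | spikeOut s z hs => exact F.hull_inner_compat i _ _
    | hull j j1 j2 =>
      rcases lt_trichotomy i j with hlt | rfl | hlt
      · exact F.ringP.side_compat hlt (by omega)
      · exact absurd rfl h1
      · exact (F.ringP.side_compat hlt (by omega)).symm
    | enter k y j k1 k2 k3 => exact (F.hull_wedge_compat i j y).flip_right
    | exit k y j k1 k2 k3 => exact F.hull_wedge_compat i j y
  | enter k x i k1 k2 k3 =>
    subst k3
    have hbk := hb k
    cases E' with
    | side y y1 y2 =>
      exact (F.wedge_inner_compat le_rfl (hb k) (by tauto) (F.inner_mem_side y x)).flip_left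
    | spikeIn s z hs =>
      exact (F.wedge_inner_compat le_rfl (hb k) (by tauto)
        (F.spike_mem hSp hs (Or.inl rfl))).flip_left
    | spikeOut s z hs =>
      exact (F.wedge_inner_compat le_rfl (hb k) (by tauto)
        (F.spike_mem hSp hs (Or.inr rfl))).flip_left.flip_right
    | hull j j1 j2 => exact (F.hull_wedge_compat j _ x).symm.flip_left
    | enter k' y j k1' k2' k3' =>
      subst k3'
      by_cases hkk : k = k'
      · subst hkk; exact absurd rfl h2
      · exact (F.wedge_wedge_compat k1 k1' hkk le_rfl (hb k) (by tauto) le_rfl (hb k')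
          (by tauto)).flip_left.flip_right
    | exit k' y j k1' k2' k3' =>
      have hbk' := hb k'
      by_cases hkk : k = k'
      · subst hkk
        refine F.enter_exit_compat le_rfl (by omega) (by omega) ?_
        have hxy : x = y → b k < j := by
          intro hxy
          have : b k ≠ j := fun h0 => h3 (by rw [hxy]) (by rw [h0])
          omega
        -- Far entry together with near exit would need k to be both even and odd.
        rcases k2 with rfl | ⟨rfl, ev⟩ <;> rcases k2' with rfl | ⟨rfl, ev'⟩
        · exact Or.inl ⟨rfl, rfl⟩
        · exact Or.inr ⟨hxy rfl, rfl, Or.inl rfl⟩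
        · exact Or.inr ⟨hxy rfl, rfl, Or.inr rfl⟩
        · exact absurd ev ev'
      · exact (F.wedge_wedge_compat k1 k1' hkk le_rfl (hb k) (by tauto) (by omega) (by omega)
          (by tauto)).flip_left
  | exit k x i k1 k2 k3 =>
    have hbk := hb k
    cases E' with
    | side y y1 y2 =>
      exact (F.wedge_inner_compat (k := k) (by omega) (by omega) (by tauto) (F.inner_mem_side y x))
    | spikeIn s z hs =>
      exact (F.wedge_inner_compat (k := k) (by omega) (by omega) (by tauto)
        (F.spike_mem hSp hs (Or.inl rfl)))
    | spikeOut s z hs =>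
      exact (F.wedge_inner_compat (k := k) (by omega) (by omega) (by tauto)
        (F.spike_mem hSp hs (Or.inr rfl))).flip_right
    | hull j j1 j2 => exact (F.hull_wedge_compat j i x).symm
    | enter k' y j k1' k2' k3' =>
      subst k3'
      have hbk' := hb k'
      by_cases hkk : k = k'
      · subst hkk
        refine (F.enter_exit_compat (k := k) (x := y) (y := x) le_rfl (by omega) (by omega) ?_).symm
        have hxy : x = y → b k < i := by
          intro hxy
          have : b k ≠ i := fun h0 => h3 (by rw [h0]) (by rw [hxy])
          omega
        rcases k2 with rfl | ⟨rfl, ev⟩ <;> rcases k2' with rfl | ⟨rfl, ev'⟩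
        · exact Or.inl ⟨rfl, rfl⟩
        · exact Or.inr ⟨hxy rfl, rfl, Or.inr rfl⟩
        · exact Or.inr ⟨hxy rfl, rfl, Or.inl rfl⟩
        · exact absurd ev' ev
      · exact (F.wedge_wedge_compat k1 k1' hkk (by omega) (by omega) (by tauto) le_rfl (hb k')
          (by tauto)).flip_right
    | exit k' y j k1' k2' k3' =>
      have hbk' := hb k'
      by_cases hkk : k = k'
      · subst hkk
        exact absurd (by rw [show i = j by omega]) h1
      · exact F.wedge_wedge_compat k1 k1' hkk (by omega) (by omega) (by tauto) (by omega) (by omega)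
          (by tauto)

end compat

end Frame

/-! ### Paths -/

theorem TurnsLeft.mono {Z Z' : Set Plane} (h : Z ⊆ Z') : ∀ {l : List Plane}, TurnsLeft Z l →
    TurnsLeft Z' l
  | _ :: _ :: _ :: _, ht => ⟨ht.1.imp (fun h1 => h h1) id, TurnsLeft.mono h ht.2⟩
  | [], _ => trivial
  | [_], _ => trivial
  | [_, _], _ => trivial

/-- The path `f i, …, f (i + n)`. -/
def run (f : ℕ → Plane) : ℕ → ℕ → List Plane
  | i, 0 => [f i]
  | i, n + 1 => f i :: run f (i + 1) n

/-- The points `f i`, …, `f (j - 1)`. -/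
def pts (f : ℕ → Plane) (i j : ℕ) : Multiset Plane := (Multiset.Ico i j).map f

theorem pts_add (f : ℕ → Plane) {i j k : ℕ} (h1 : i ≤ j) (h2 : j ≤ k) :
    pts f i j + pts f j k = pts f i k := by
  unfold pts
  rw [← Multiset.map_add, Multiset.Ico_add_Ico_eq_Ico h1 h2]

theorem pts_succ (f : ℕ → Plane) (i : ℕ) : pts f i (i + 1) = {f i} := by
  unfold pts
  have : Multiset.Ico i (i + 1) = {i} := by
    have := Nat.Ico_succ_singleton i
    exact congrArg Finset.val this
  rw [this]; rfl

theorem pts_cons (f : ℕ → Plane) {i j : ℕ} (h : i < j) : pts f i j = {f i} + pts f (i + 1) j := by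
  rw [← pts_add f (Nat.le_succ i) h, pts_succ]

theorem coe_run (f : ℕ → Plane) (i n : ℕ) : (run f i n : Multiset Plane) = pts f i (i + n + 1) := by
  induction n generalizing i with
  | zero => rw [add_zero, pts_succ]; rfl
  | succ n ih =>
    rw [pts_cons f (by omega), show i + (n + 1) + 1 = i + 1 + n + 1 by omega, ← ih]
    rfl

theorem TurnsLeft.cons {Z : Set Plane} {u v : Plane} {r : List Plane} (ht : TurnsLeft Z (v :: r))
    (h : ∀ w r', r = w :: r' → v ∈ Z ∨ 0 ≤ orient u v w) : TurnsLeft Z (u :: v :: r) := by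
  cases r with
  | nil => trivial
  | cons w r' => exact ⟨h w r' rfl, ht⟩

/-! ### Partial paths along the inner ring, built from the end backwards. -/

namespace Frame

variable {o : Plane} {h m N : ℕ} {p q : ℕ → Plane} {Θ Φ : ℕ → ℝ} {b e : ℕ → ℕ}

/-- The points omitted from a path. -/
def omitted (q : ℕ → Plane) : Option ℕ → Multiset Plane
  | none => 0
  | some z => {q z}

/-- The area that has to be left for the omitted point. -/
def reserve (q : ℕ → Plane) (e : ℕ → ℕ) (x : ℕ) : Option ℕ → ℝ
  | none => 0
  | some z => orient (q (e 0)) (q x) (q z)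

/-- The path `q x :: l` runs through the outer points from `b k` on and the inner points from `x`
on, with the exception of the omitted point, and turns left outside `Z`. -/
structure Suffix (m N : ℕ) (p q : ℕ → Plane) (b e : ℕ → ℕ) (k x : ℕ) (w : Option ℕ)
    (l : List Plane) (Z : Set Plane) (Sp : Set (ℕ × ℕ)) : Prop where
  low : e 0 ≤ x
  high : x ≤ e N
  chain : List.IsChain (Edge N p q b e Sp) (q x :: l)
  -- The polygon closes at q (e N) = q (e 0); the appended point stands for the vertex that follows
  -- there.
  turns : TurnsLeft Z (q x :: l ++ [q (e N + 1)])
  -- Either the turn at q x is excused, or the path leaves q x along the ring, so that any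
  -- predecessor can be tested against the side alone.
  head : q x ∈ Z ∨ ∃ l', l ++ [q (e N + 1)] = q (x + 1) :: l'
  last : [q (e N)] <:+ q x :: l
  points : (l : Multiset Plane) + omitted q w = pts p (b k) (b N) + pts q (x + 1) (e N + 1)
  family : SpikeFamily m N q e Sp
  spike_gt : ∀ s ∈ Sp, x < s.1
  -- The omitted point is the second end of a double gap between nodes, and it precedes all spikes
  -- placed so far; a spike to it is therefore a proper chord, disjoint from theirs.
  omit_spec : ∀ z, w = some z → (∃ j, k ≤ j ∧ j + 1 < N ∧ z = e (j + 1) ∧ z = e j + 2) ∧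
    x < z ∧ ∀ s ∈ Sp, z < s.1
  area : reserve q e x w ≤ sweep (q (e 0)) (q x :: l)
  area_pos : k < N → w = none → 0 < sweep (q (e 0)) (q x :: l)

section

variable (F : Frame o h m N p q Θ Φ b e)
include F

theorem center_nonneg {x y : ℕ} (h0 : e 0 ≤ x) (hxy : x ≤ y) (hy : y ≤ e N) :
    0 ≤ orient (q (e 0)) (q x) (q y) :=
  F.ringQ.tri _ _ _ h0 hxy (by have := F.eN; omega)

/-- By convexity of the ring the triangle on q x, q y and q z is counterclockwise, so moving back
from y to x sweeps enough area for the larger reserve. -/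
theorem reserve_le {x y : ℕ} {w : Option ℕ} (h0 : e 0 ≤ x) (hxy : x ≤ y) (hy : y ≤ e N)
    (hw : ∀ z, w = some z → y ≤ z ∧ z ≤ e N) :
    reserve q e x w ≤ orient (q (e 0)) (q x) (q y) + reserve q e y w := by
  have heN := F.eN
  cases w with
  | none => simpa [reserve] using F.center_nonneg h0 hxy hy
  | some z =>
    have := hw z rfl
    have h1 := orient_add_orient (q (e 0)) (q x) (q y) (q z)
    have h2 := F.ringQ.tri x y z hxy this.1 (by omega)
    simp only [reserve]; linarith

/-- An excursion from the inner ring over consecutive outer points. -/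
theorem excursion {Sp : Set (ℕ × ℕ)} {Z : Set Plane} {x y : ℕ} {l : List Plane} {i n : ℕ}
    (hi : b 0 ≤ i) (hn : i + n < b N)
    (hchain : List.IsChain (Edge N p q b e Sp) (q y :: l))
    (henter : Edge N p q b e Sp (q x) (p i)) (hexit : Edge N p q b e Sp (p (i + n)) (q y))
    {r : List Plane} (hturns : TurnsLeft Z (p (i + n) :: q y :: r))
    (hor : 0 ≤ orient (q x) (p (i + n)) (q y)) (o' : Plane) :
    List.IsChain (Edge N p q b e Sp) (q x :: (run p i n ++ q y :: l)) ∧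
      TurnsLeft Z (q x :: (run p i n ++ q y :: r)) ∧
      orient o' (q x) (q y) + orient (q x) (p (i + n)) (q y) + sweep o' (q y :: l) ≤
        sweep o' (q x :: (run p i n ++ q y :: l)) ∧
      (0 < n → orient o' (q x) (q y) + orient (q x) (p (i + n)) (q y) + sweep o' (q y :: l) <
        sweep o' (q x :: (run p i n ++ q y :: l))) := by
  have key : ∀ (n i : ℕ), b 0 ≤ i → i + n < b N → Edge N p q b e Sp (p (i + n)) (q y) →
      TurnsLeft Z (p (i + n) :: q y :: r) → 0 ≤ orient (q x) (p (i + n)) (q y) →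
      List.IsChain (Edge N p q b e Sp) (run p i n ++ q y :: l) ∧
      (∀ u, (0 < n → 0 ≤ orient u (p i) (p (i + 1))) → (n = 0 → 0 ≤ orient u (p i) (q y)) →
        TurnsLeft Z (u :: (run p i n ++ q y :: r))) ∧
      orient o' (q x) (q y) + orient (q x) (p (i + n)) (q y) + sweep o' (q y :: l) ≤
        sweep o' (q x :: (run p i n ++ q y :: l)) ∧
      (0 < n → orient o' (q x) (q y) + orient (q x) (p (i + n)) (q y) + sweep o' (q y :: l) <
        sweep o' (q x :: (run p i n ++ q y :: l))) := by
    intro n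
    induction n with
    | zero =>
      intro i hi hn hexit hturns hor
      refine ⟨?_, fun u _ h2 => ⟨Or.inr (h2 rfl), hturns⟩, ?_, fun h => absurd h (lt_irrefl 0)⟩
      · exact List.IsChain.cons_cons hexit hchain
      · simp only [run, List.cons_append, List.nil_append, sweep, add_zero]
        have := orient_add_orient o' (q x) (p i) (q y)
        linarith
    | succ n ih =>
      intro i hi hn hexit hturns hor
      have e1 : i + (n + 1) = i + 1 + n := by omega
      rw [e1] at hexit hturns hor hn ⊢
      obtain ⟨c1, c2, c3, _⟩ := ih (i + 1) (by omega) hn hexit hturns hor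
      -- Each further outer point adds the triangle on q x, p i and p (i + 1), which is positively
      -- oriented by `hull`.
      have hadd : sweep o' (q x :: (run p i (n + 1) ++ q y :: l)) =
          orient (q x) (p i) (p (i + 1)) + sweep o' (q x :: (run p (i + 1) n ++ q y :: l)) := by
        have := orient_add_orient o' (q x) (p i) (p (i + 1))
        cases n <;> simp only [run, List.cons_append, sweep, List.nil_append] <;> linarith
      have hpos : 0 < orient (q x) (p i) (p (i + 1)) := by rw [orient_rotate]; exact F.hull i x
      refine ⟨?_, fun u h1 h2 => ?_, by rw [hadd]; linarith, fun _ => by rw [hadd]; linarith⟩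
      · have he : Edge N p q b e Sp (p i) (p (i + 1)) := .hull i hi (by omega)
        cases n <;> exact List.IsChain.cons_cons he c1
      · have c2' := c2 (p i) (fun _ => F.ringP.tri i (i + 1) (i + 1 + 1) (by omega) (by omega)
          (by have := F.ringP.three_le; omega)) (fun _ => (F.hull i y).le)
        cases n <;> exact ⟨Or.inr (h1 (by omega)), c2'⟩
  obtain ⟨c1, c2, c3, c4⟩ := key n i hi hn hexit hturns hor
  refine ⟨?_, c2 (q x) (fun _ => ?_) (fun h0 => ?_), c3, c4⟩
  · cases n <;> exact List.IsChain.cons_cons henter c1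
  · rw [orient_rotate]; exact (F.hull i x).le
  · subst h0; exact hor

omit F in
theorem Suffix.first_turn {k x : ℕ} {w : Option ℕ} {l : List Plane} {Z : Set Plane}
    {Sp : Set (ℕ × ℕ)} (S : Suffix m N p q b e k x w l Z Sp) {u : Plane}
    (hu : 0 ≤ orient u (q x) (q (x + 1))) : TurnsLeft Z (u :: q x :: (l ++ [q (e N + 1)])) := by
  refine TurnsLeft.cons S.turns fun v r' hv => ?_
  rcases S.head with h1 | ⟨l', h1⟩
  · exact Or.inl h1
  · right
    rw [h1] at hv
    rw [← (List.cons.inj hv).1]; exact hu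

theorem Suffix.omit_le {k x : ℕ} {w : Option ℕ} {l : List Plane} {Z : Set Plane}
    {Sp : Set (ℕ × ℕ)} (S : Suffix m N p q b e k x w l Z Sp) :
    ∀ z, w = some z → x ≤ z ∧ z ≤ e N := by
  intro z hz
  obtain ⟨⟨j, h1, h2, h3, h4⟩, h5, h6⟩ := S.omit_spec z hz
  have := F.emono.monotone h2.le
  omega

theorem Suffix.side {k x : ℕ} {w : Option ℕ} {l : List Plane} {Z : Set Plane}
    {Sp : Set (ℕ × ℕ)} (S : Suffix m N p q b e k (x + 1) w l Z Sp) (hx : e 0 ≤ x) :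
    Suffix m N p q b e k x w (q (x + 1) :: l) Z Sp where
  low := hx
  high := by have := S.high; omega
  chain := List.IsChain.cons_cons (.side x hx S.high) S.chain
  turns := S.first_turn (F.ringQ.tri _ _ _ (by omega) (by omega)
    (by have := F.ringQ.three_le; omega))
  head := Or.inr ⟨_, rfl⟩
  last := S.last.trans (List.suffix_cons _ _)
  points := by
    have h1 := S.points
    have h2 := S.high
    rw [← Multiset.cons_coe, ← Multiset.singleton_add, add_assoc, h1, pts_cons q (i := x + 1) (by omega)]
    abel
  family := S.family
  spike_gt := fun s hs => by have := S.spike_gt s hs; omega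
  omit_spec := fun z hz => by
    obtain ⟨h1, h2, h3⟩ := S.omit_spec z hz
    exact ⟨h1, by omega, h3⟩
  area := by
    have h1 := S.area
    have h2 := F.reserve_le hx (Nat.le_succ x) S.high (S.omit_le F)
    rw [sweep]
    simp only [Nat.succ_eq_add_one] at h2
    linarith
  area_pos := fun h1 h2 => by
    have h3 := S.area_pos h1 h2
    have h4 := F.center_nonneg hx (Nat.le_succ x) S.high
    rw [sweep]
    simp only [Nat.succ_eq_add_one] at h4
    linarith

theorem Suffix.sides {k y : ℕ} {w : Option ℕ} {Z : Set Plane} {Sp : Set (ℕ × ℕ)}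
    {l : List Plane} (S : Suffix m N p q b e k y w l Z Sp) {x : ℕ} (hx : e 0 ≤ x) (hxy : x ≤ y) :
    ∃ l', Suffix m N p q b e k x w l' Z Sp := by
  obtain ⟨d, rfl⟩ := Nat.exists_eq_add_of_le hxy
  clear hxy
  induction d generalizing x with
  | zero => exact ⟨l, S⟩
  | succ d ih =>
    rw [show x + (d + 1) = x + 1 + d by omega] at S
    obtain ⟨l', S'⟩ := ih (by omega) S
    exact ⟨_, S'.side F hx⟩

omit F in
theorem Suffix.mono {k x : ℕ} {w : Option ℕ} {l : List Plane} {Z Z' : Set Plane}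
    {Sp : Set (ℕ × ℕ)} (S : Suffix m N p q b e k x w l Z Sp) (hZ : Z ⊆ Z') :
    Suffix m N p q b e k x w l Z' Sp :=
  { S with
    turns := S.turns.mono hZ
    head := S.head.imp_left fun h1 => hZ h1 }

theorem enter_turn_pos (k : ℕ) {i : ℕ} (h1 : b k ≤ i) (h2 : i < b (k + 1)) :
    0 < orient (q (e k)) (p i) (q (e k + 1)) := by
  have := (F.sector k i h1 h2).1
  rw [orient_swap]; linarith

theorem tangent (k x : ℕ) {i : ℕ} (h1 : b k ≤ i) (h2 : i < b (k + 1)) :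
    0 ≤ orient (p i) (q (e k + 1)) (q x) := F.ringQ.tangent (F.sector k i h1 h2) x

/-- A node is visited between the two ends of its side. -/
theorem Suffix.node {k : ℕ} {w : Option ℕ} {l : List Plane} {Z : Set Plane} {Sp : Set (ℕ × ℕ)}
    (S : Suffix m N p q b e (k + 1) (e k + 1) w l Z Sp) (hk : k < N) :
    ∃ l', Suffix m N p q b e k (e k) w l' (insert (q (e k)) Z) Sp := by
  have hb := F.bmono (Nat.lt_succ_self k)
  have hb0 := F.bmono.monotone (Nat.zero_le k)
  have hbN := F.bmono.monotone (show k + 1 ≤ N by omega)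
  have he0 := F.emono.monotone (Nat.zero_le k)
  have heN := F.emono.monotone hk.le
  simp only [Nat.succ_eq_add_one] at hb
  obtain ⟨n, hn⟩ : ∃ n, b k + n + 1 = b (k + 1) := ⟨b (k + 1) - b k - 1, by omega⟩
  have S' := S.mono (Set.subset_insert (q (e k)) Z)
  -- The exit q (e k + 1) is the tangent point of the last outer point, hence a left turn; only the
  -- entry q (e k) is excused.
  obtain ⟨c1, c2, c3, c4⟩ := F.excursion (i := b k) (n := n) (x := e k) hb0 (by omega) S'.chain
    (.enter k _ _ hk (Or.inl rfl) rfl) (.exit k _ _ hk (Or.inl rfl) hn)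
    (S'.first_turn (F.tangent k _ (by omega) (by omega)))
    (F.enter_turn_pos k (by omega) (by omega)).le (q (e 0))
  have hpos := F.enter_turn_pos k (i := b k + n) (by omega) (by omega)
  have hnn := F.center_nonneg he0 (Nat.le_succ (e k)) S.high
  simp only [Nat.succ_eq_add_one] at hnn
  refine ⟨_, ⟨he0, heN, c1, by simpa using c2, Or.inl (Set.mem_insert _ _),
    S.last.trans ((List.suffix_append _ _).trans (List.suffix_cons _ _)), ?_, S.family,
    fun s hs => ?_, fun z hz => ?_, ?_, fun _ hw => ?_⟩⟩
  · have h1 := S.points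
    have h2 := S.high
    rw [← Multiset.coe_add, ← Multiset.cons_coe, coe_run, ← Multiset.singleton_add, hn,
      pts_cons q (i := e k + 1) (by omega), ← pts_add p (j := b (k + 1)) hb.le hbN]
    rw [add_assoc, add_assoc, h1]
    abel
  · have := S.spike_gt s hs; omega
  · obtain ⟨⟨j, j1, j2, j3, j4⟩, h2, h3⟩ := S.omit_spec z hz
    exact ⟨⟨j, by omega, j2, j3, j4⟩, by omega, h3⟩
  · have h1 := S.area
    have h2 := F.reserve_le he0 (Nat.le_succ (e k)) S.high (S.omit_le F)
    simp only [Nat.succ_eq_add_one] at h2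
    linarith
  · have h1 := S.area
    rw [hw] at h1
    simp only [reserve] at h1
    linarith

/-- The two nodes `k` and `k + 1` are visited in one excursion. -/
theorem merge_aux {k : ℕ} {w : Option ℕ} {l : List Plane} {Z : Set Plane} {Sp : Set (ℕ × ℕ)}
    (S : Suffix m N p q b e (k + 2) (e (k + 1) + 1) w l Z Sp) (hk : k + 1 < N) (hev : Even k) :
    ∃ l' : List Plane,
      List.IsChain (Edge N p q b e Sp) (q (e k) :: q (e k + 1) :: l') ∧
      TurnsLeft (insert (q (e k + 1)) Z) (q (e k) :: q (e k + 1) :: l' ++ [q (e N + 1)]) ∧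
      [q (e N)] <:+ l' ∧
      (l' : Multiset Plane) + omitted q w =
        pts p (b k) (b N) + pts q (e (k + 1) + 1) (e N + 1) ∧
      orient (q (e 0)) (q (e k)) (q (e k + 1)) +
        (orient (q (e 0)) (q (e k + 1)) (q (e (k + 1) + 1)) +
        orient (q (e k + 1)) (p (b (k + 2) - 1)) (q (e (k + 1) + 1)) +
        sweep (q (e 0)) (q (e (k + 1) + 1) :: l)) <
        sweep (q (e 0)) (q (e k) :: q (e k + 1) :: l') := by
  have hb := F.bmono (Nat.lt_succ_self k)
  have hb' := F.bmono (Nat.lt_succ_self (k + 1))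
  have hb0 := F.bmono.monotone (Nat.zero_le k)
  have hbN := F.bmono.monotone (show k + 2 ≤ N by omega)
  have he0 := F.emono.monotone (Nat.zero_le k)
  have he := F.emono (Nat.lt_succ_self k)
  have heN := F.emono.monotone hk.le
  simp only [Nat.succ_eq_add_one] at hb hb' he
  rw [show k + 1 + 1 = k + 2 from rfl] at hb'
  obtain ⟨n, hn⟩ : ∃ n, b k + n + 1 = b (k + 2) := ⟨b (k + 2) - b k - 1, by omega⟩
  have S' := S.mono (Set.subset_insert (q (e k + 1)) Z)
  have htan := fun x => F.tangent (k + 1) x (i := b k + n) (by omega) (by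
    rw [show k + 1 + 1 = k + 2 from rfl]; omega)
  -- The excursion starts at the far end of the side of node k and ends at the tangent point of node
  -- k + 1; the ring points strictly between these two are skipped.
  obtain ⟨c1, c2, c3, c4⟩ := F.excursion (i := b k) (n := n) (x := e k + 1) hb0 (by omega) S'.chain
    (.enter k _ _ (by omega) (Or.inr ⟨rfl, hev⟩) rfl) (.exit (k + 1) _ _ hk (Or.inl rfl) hn)
    (S'.first_turn (htan _)) (by rw [orient_rotate]; exact htan _) (q (e 0))
  refine ⟨_, List.IsChain.cons_cons (.side _ he0 (by omega)) c1,
    by simpa using TurnsLeft.cons (u := q (e k)) c2 fun _ _ _ => Or.inl (Set.mem_insert _ _),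
    S.last.trans (List.suffix_append _ _), ?_, ?_⟩
  · have h1 := S.points
    have h2 := S.high
    rw [← Multiset.coe_add, ← Multiset.cons_coe, coe_run, ← Multiset.singleton_add, hn,
      pts_cons q (i := e (k + 1) + 1) (by omega), ← pts_add p (j := b (k + 2)) (by omega) hbN]
    rw [add_assoc, add_assoc, h1]
    abel
  · have h4 := c4 (by omega)
    rw [show b (k + 2) - 1 = b k + n by omega]
    rw [sweep]
    linarith

/-- For adjacent sectors no ring point is skipped, and one excused vertex serves two nodes. -/
theorem Suffix.merge {k : ℕ} {w : Option ℕ} {l : List Plane} {Z : Set Plane} {Sp : Set (ℕ × ℕ)}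
    (S : Suffix m N p q b e (k + 2) (e (k + 1) + 1) w l Z Sp) (hk : k + 1 < N) (hev : Even k)
    (hg : e (k + 1) = e k + 1) :
    ∃ l', Suffix m N p q b e k (e k) w l' (insert (q (e k + 1)) Z) Sp := by
  have he0 := F.emono.monotone (Nat.zero_le k)
  have heN := F.emono hk
  have hb' := F.bmono (Nat.lt_succ_self (k + 1))
  have hb := F.bmono (Nat.lt_succ_self k)
  simp only [Nat.succ_eq_add_one] at hb hb'
  rw [show k + 1 + 1 = k + 2 from rfl] at hb'
  obtain ⟨l', c1, c2, hl, c3, c4⟩ := F.merge_aux S hk hev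
  have htan := F.tangent (k + 1) (e k + 1) (i := b (k + 2) - 1) (by omega) (by
    rw [show k + 1 + 1 = k + 2 from rfl]; omega)
  rw [← orient_rotate] at htan
  have k1 := F.center_nonneg he0 (Nat.le_succ (e k)) (by simp only [Nat.succ_eq_add_one]; omega)
  have k2 := F.center_nonneg (x := e k + 1) (y := e (k + 1) + 1) (by omega) (by omega) S.high
  simp only [Nat.succ_eq_add_one] at k1
  refine ⟨_, ⟨he0, by omega, c1, c2, Or.inr ⟨_, rfl⟩,
    hl.trans ((List.suffix_cons _ _).trans (List.suffix_cons _ _)), ?_, S.family, fun s hs => ?_,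
    fun z hz => ?_, ?_, fun _ hw => ?_⟩⟩
  · rw [← Multiset.cons_coe, ← Multiset.singleton_add, add_assoc, c3,
      pts_cons q (i := e k + 1) (by omega), hg]
    abel
  · have := S.spike_gt s hs; omega
  · obtain ⟨⟨j, j1, j2, j3, j4⟩, h2, h3⟩ := S.omit_spec z hz
    exact ⟨⟨j, by omega, j2, j3, j4⟩, by omega, h3⟩
  · have h1 := S.area
    have hz : ∀ z, w = some z → e (k + 1) + 1 ≤ z ∧ z ≤ e N := S.omit_le F
    have h2 := F.reserve_le (x := e k + 1) (y := e (k + 1) + 1) (by omega) (by omega) S.high hz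
    have h3 := F.reserve_le (x := e k) (y := e k + 1) (w := w) (by omega) (by omega) (by omega)
      (fun z h => by have := hz z h; omega)
    linarith
  · have h1 := S.area
    rw [hw] at h1
    simp only [reserve] at h1
    linarith

/-- Across a double gap the merged excursion skips exactly q (e k + 2), which is recorded as
omitted. That node k + 1 is a single point enters the area estimate: the last outer point visited is
then p (b (k + 1)), the point at which sector k is left. -/
theorem Suffix.merge_omit {k : ℕ} {l : List Plane} {Z : Set Plane} {Sp : Set (ℕ × ℕ)}
    (S : Suffix m N p q b e (k + 2) (e (k + 1) + 1) none l Z Sp) (hk : k + 1 < N) (hev : Even k)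
    (hg : e (k + 1) = e k + 2) (hs : b (k + 2) = b (k + 1) + 1) :
    ∃ l', Suffix m N p q b e k (e k) (some (e k + 2)) l' (insert (q (e k + 1)) Z) Sp := by
  have he0 := F.emono.monotone (Nat.zero_le k)
  have heN := F.emono hk
  have hb := F.bmono (Nat.lt_succ_self k)
  simp only [Nat.succ_eq_add_one] at hb
  have hm := F.ringQ.three_le
  have heN' := F.eN
  obtain ⟨l', c1, c2, hl, c3, c4⟩ := F.merge_aux S hk hev
  simp only [omitted, add_zero] at c3
  rw [show b (k + 2) - 1 = b (k + 1) by omega] at c4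
  refine ⟨_, ⟨he0, by omega, c1, c2, Or.inr ⟨_, rfl⟩,
    hl.trans ((List.suffix_cons _ _).trans (List.suffix_cons _ _)), ?_, S.family, fun s hs' => ?_,
    fun z hz => ?_, ?_, fun _ hw => by cases hw⟩⟩
  · rw [← Multiset.cons_coe, ← Multiset.singleton_add, add_assoc, add_comm (l' : Multiset Plane), c3,
      pts_cons q (i := e k + 1) (by omega), pts_cons q (i := e k + 1 + 1) (by omega), hg]
    simp only [omitted]
    abel
  · have := S.spike_gt s hs'; omega
  · cases hz
    exact ⟨⟨k, le_rfl, hk, hg.symm, rfl⟩, by omega, fun s hs' => by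
      have := S.spike_gt s hs'; omega⟩
  · have h1 := S.area
    simp only [reserve] at h1 ⊢
    have t1 := F.tangent (k + 1) (e k + 2) (i := b (k + 1)) le_rfl (by
      rw [show k + 1 + 1 = k + 2 from rfl]; omega)
    have t2 := F.ringQ.orient_neg_of_leave_sector
      (F.sector k (b (k + 1) - 1) (by omega) (by omega)) (F.leave k) (by
        have := F.hull (b (k + 1) - 1) (e k + 1)
        rwa [show b (k + 1) - 1 + 1 = b (k + 1) by omega] at this)
    have i1 := orient_add_orient (q (e 0)) (q (e k)) (q (e k + 1)) (q (e k + 2))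
    have i2 := F.ringQ.tri (e k) (e k + 1) (e k + 2) (by omega) (by omega) (by omega)
    have i3 := F.center_nonneg (x := e k + 2) (y := e k + 3) (by omega) (by omega) (by omega)
    rw [hg] at c4 h1 t1
    rw [show e k + 2 + 1 = e k + 3 from rfl] at c4 h1 t1
    -- By `t1` and `t2` the detour over p (b (k + 1)) sweeps at least as much as the ring path
    -- through q (e k + 2), which accounts for the reserve.
    have i4 : orient (q (e 0)) (q (e k + 1)) (q (e k + 3)) +
        orient (q (e k + 1)) (p (b (k + 1))) (q (e k + 3)) =
        orient (q (e 0)) (q (e k + 1)) (q (e k + 2)) + orient (q (e 0)) (q (e k + 2)) (q (e k + 3)) -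
        orient (q (e k + 1)) (q (e k + 2)) (p (b (k + 1))) +
        orient (p (b (k + 1))) (q (e k + 3)) (q (e k + 2)) := by
      simp only [orient_eq]; ring
    linarith

end

end Frame

/-! ### Spikes: putting an omitted inner point back into the path. -/

namespace Frame

variable {o : Plane} {h m N : ℕ} {p q : ℕ → Plane} {Θ Φ : ℕ → ℝ} {b e : ℕ → ℕ}
variable (F : Frame o h m N p q Θ Φ b e)
include F

/-- The corners that belong to nodes j and j + 1 lie on opposite sides of both chords. -/
theorem isSpike {j s : ℕ} (hj : j + 1 < N) (hg : e (j + 1) = e j + 2) (hs : e 0 < s)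
    (hsj : s + 1 ≤ e j) : IsSpike m N q e s (e (j + 1)) := by
  have h1 := F.emono hj
  have heN := F.eN
  refine ⟨hs, by omega, h1, ?_, ?_⟩
  · exact F.properChord_of_corners (k := j) (l := j + 1) (by omega) (by omega) le_rfl (by omega)
  · exact F.properChord_of_corners (k := j) (l := j + 1) (by omega) (by omega) le_rfl (by omega)

theorem Suffix.spikeFamily {k y z s : ℕ} {l : List Plane} {Z : Set Plane} {Sp : Set (ℕ × ℕ)}
    (S : Suffix m N p q b e k y (some z) l Z Sp) (hs : e 0 < s) (hk : s + 1 ≤ e k) :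
    SpikeFamily m N q e (insert (s, z) Sp) := by
  obtain ⟨⟨j, j1, j2, j3, j4⟩, h2, h3⟩ := S.omit_spec z rfl
  have hek := F.emono.monotone j1
  constructor
  · rintro w (rfl | hw)
    · subst j3
      exact F.isSpike j2 j4 hs (by omega)
    · exact S.family.spike w hw
  · rintro w (rfl | hw) w' (rfl | hw') hne
    · exact absurd rfl hne
    · exact Or.inl (h3 w' hw')
    · exact Or.inr (h3 w hw)
    · exact S.family.disj w hw w' hw' hne

/-- The omitted point is inserted into the side following node `k`, on the far side of the node. -/
theorem Suffix.insert_before {k z : ℕ} {l : List Plane} {Z : Set Plane} {Sp : Set (ℕ × ℕ)}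
    (S : Suffix m N p q b e (k + 2) (e (k + 1) + 1) (some z) l Z Sp) (hk : k + 1 < N)
    (hg : e (k + 1) = e k + 2) (hs : b (k + 2) = b (k + 1) + 1)
    (hturn : orient (p (b (k + 1))) (q (e k + 2)) (q z) ≤ 0) :
    ∃ l' Sp', Suffix m N p q b e k (e k) none l' (insert (q z) (insert (q (e k)) Z)) Sp' := by
  have hb := F.bmono (Nat.lt_succ_self k)
  have hb0 := F.bmono.monotone (Nat.zero_le k)
  have hbN := F.bmono.monotone (show k + 2 ≤ N by omega)
  have he0 := F.emono.monotone (Nat.zero_le k)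
  have hee := F.emono (Nat.lt_succ_self (k + 1))
  have heN := F.emono hk
  simp only [Nat.succ_eq_add_one] at hb hee
  rw [show k + 1 + 1 = k + 2 from rfl] at hee
  obtain ⟨n, hn⟩ : ∃ n, b k + n + 1 = b (k + 1) := ⟨b (k + 1) - b k - 1, by omega⟩
  obtain ⟨_, z2, z3⟩ := S.omit_spec z rfl
  have z4 := (S.omit_le F z rfl).2
  have hfam := S.spikeFamily F (s := e k + 1) (by omega) (by omega)
  have S' := S.mono (Z' := insert (q z) (insert (q (e k)) Z))
    ((Set.subset_insert _ _).trans (Set.subset_insert _ _))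
  have hb2 : b (k + 1) < b (k + 1 + 1) := by rw [show k + 1 + 1 = k + 2 from rfl]; omega
  have hchain : List.IsChain (Edge N p q b e (insert (e k + 1, z) Sp)) (q (e (k + 1) + 1) :: l) :=
    S.chain.imp fun a b hab => hab.mono (Set.subset_insert _ _)
  have hpos := F.enter_turn_pos (k + 1) le_rfl hb2
  obtain ⟨c1, c2, c3, _⟩ := F.excursion (i := b (k + 1)) (n := 0) (x := e (k + 1)) (by omega)
    (by omega) hchain (.enter (k + 1) _ _ hk (Or.inl rfl) rfl)
    (.exit (k + 1) _ _ hk (Or.inl rfl) (by rw [show k + 1 + 1 = k + 2 from rfl]; omega))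
    (S'.first_turn (F.tangent (k + 1) _ le_rfl hb2)) hpos.le (q (e 0))
  simp only [run, List.cons_append, List.nil_append, add_zero] at c1 c2 c3 hpos
  have hsp : (e k + 1, z) ∈ insert (e k + 1, z) Sp := Set.mem_insert _ _
  -- the spike
  have d1 : List.IsChain (Edge N p q b e (insert (e k + 1, z) Sp)) (q (e k + 1) :: q z ::
      q (e (k + 1)) :: p (b (k + 1)) :: q (e (k + 1) + 1) :: l) := by
    refine List.IsChain.cons_cons (.spikeIn _ _ hsp) (List.IsChain.cons_cons ?_ c1)
    rw [hg]; exact .spikeOut _ _ hsp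
  have d2 : TurnsLeft (insert (q z) (insert (q (e k)) Z)) (p (b k + n) :: q (e k + 1) :: q z ::
      q (e (k + 1)) :: p (b (k + 1)) :: q (e (k + 1) + 1) :: (l ++ [q (e N + 1)])) := by
    -- Of the vertices q (e k + 1), q z and q (e k + 2), the first is a tangent point and the second
    -- is excused. At the third, the usual entry to node k + 1, coming from q z instead makes a left
    -- turn by `hturn`.
    refine ⟨Or.inr (F.tangent k _ (by omega) (by omega)), Or.inl (Set.mem_insert _ _), ?_, c2⟩
    right
    rw [hg, orient_rotate, orient_rotate, orient_swap]
    linarith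
  obtain ⟨f1, f2, f3, f4⟩ := F.excursion (i := b k) (n := n) (x := e k) hb0 (by omega) d1
    (.enter k _ _ (by omega) (Or.inl rfl) rfl) (.exit k _ _ (by omega) (Or.inl rfl) hn) d2
    (F.enter_turn_pos k (by omega) (by omega)).le (q (e 0))
  -- Returning from q z is the only backward sweep at this stage, and the reserve pays for it.
  have harea : 0 < sweep (q (e 0)) (q (e k) :: (run p (b k) n ++ q (e k + 1) :: q z ::
      q (e (k + 1)) :: p (b (k + 1)) :: q (e (k + 1) + 1) :: l)) := by
    have h1 := S.area
    simp only [reserve] at h1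
    have h2 := F.enter_turn_pos k (i := b k + n) (by omega) (by omega)
    have h3 := F.center_nonneg (x := e k) (y := e k + 1) he0 (by omega) (by omega)
    have h4 := F.center_nonneg (x := e k + 1) (y := z) (by omega) (by omega) z4
    have h5 := F.reserve_le (x := e (k + 1)) (y := e (k + 1) + 1) (w := some z) (by omega) (by omega)
      (by omega) (by intro z' hz'; cases hz'; omega)
    simp only [reserve] at h5
    have h6 := orient_swap (q (e 0)) (q z) (q (e (k + 1)))
    rw [sweep, sweep] at f3
    linarith
  refine ⟨_, insert (e k + 1, z) Sp, ⟨he0, by omega, f1, by simpa using f2,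
    Or.inl (Set.mem_insert_of_mem _ (Set.mem_insert _ _)), ?_, ?_, hfam, ?_, fun z hz => (by cases hz), harea.le,
    fun _ _ => harea⟩⟩
  · refine S.last.trans (List.IsSuffix.trans ?_ ((List.suffix_append _ _).trans (List.suffix_cons _ _)))
    exact (List.suffix_cons _ _).trans ((List.suffix_cons _ _).trans
      ((List.suffix_cons _ _).trans (List.suffix_cons _ _)))
  · have h1 := S.points
    have h2 := S.high
    simp only [omitted] at h1 ⊢
    rw [← Multiset.coe_add, coe_run, hn]
    simp only [← Multiset.cons_coe, ← Multiset.singleton_add]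
    have hP : pts p (b k) (b N) =
        pts p (b k) (b (k + 1)) + ({p (b (k + 1))} + pts p (b (k + 1) + 1) (b N)) := by
      rw [← pts_cons p (by omega), pts_add p hb.le (by omega)]
    rw [pts_cons q (i := e k + 1) (by omega), pts_cons q (i := e k + 1 + 1) (by omega),
      pts_cons q (i := e k + 1 + 1 + 1) (by omega), hP]
    rw [hg, hs] at h1
    rw [hg]
    have h3 : ({q z} : Multiset Plane) + l = pts p (b (k + 1) + 1) (b N) + pts q (e k + 2 + 1 + 1) (e N + 1) := by
      rw [← h1, add_comm]
    have e1 : pts p (b k) (b (k + 1)) + ({q (e k + 1)} + ({q z} + ({q (e k + 2)} +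
        ({p (b (k + 1))} + ({q (e k + 2 + 1)} + (l : Multiset Plane)))))) + 0 =
        pts p (b k) (b (k + 1)) + ({q (e k + 1)} + ({q (e k + 2)} +
        ({p (b (k + 1))} + ({q (e k + 2 + 1)} + ({q z} + (l : Multiset Plane)))))) := by abel
    rw [e1, h3]
    simp only [show e k + 1 + 1 = e k + 2 from rfl]
    abel
  · rintro s (rfl | hs')
    · simp only; omega
    · have := S.spike_gt s hs'; omega

/-- The omitted point is inserted into the side following the exit of node `k + 1`. -/
theorem Suffix.insert_after {k z : ℕ} {l : List Plane} {Z : Set Plane} {Sp : Set (ℕ × ℕ)}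
    (S : Suffix m N p q b e (k + 2) (e (k + 1) + 1) (some z) l Z Sp) (hk : k + 1 < N) (hev : Even k)
    (hg : e (k + 1) = e k + 2) (hs : b (k + 2) = b (k + 1) + 1)
    (hturn : 0 ≤ orient (p (b (k + 1))) (q (e k + 2)) (q z)) :
    ∃ l' Sp', Suffix m N p q b e k (e k) none l' (insert (q z) (insert (q (e k + 1)) Z)) Sp' := by
  have hb := F.bmono (Nat.lt_succ_self k)
  have hb0 := F.bmono.monotone (Nat.zero_le k)
  have hbN := F.bmono.monotone (show k + 2 ≤ N by omega)
  have he0 := F.emono.monotone (Nat.zero_le k)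
  have hee := F.emono (Nat.lt_succ_self (k + 1))
  have heN := F.emono hk
  simp only [Nat.succ_eq_add_one] at hb hee
  rw [show k + 1 + 1 = k + 2 from rfl] at hee
  obtain ⟨n, hn⟩ : ∃ n, b k + n = b (k + 1) := ⟨b (k + 1) - b k, by omega⟩
  obtain ⟨_, z2, z3⟩ := S.omit_spec z rfl
  have z4 := (S.omit_le F z rfl).2
  have hfam := S.spikeFamily F (s := e k + 2) (by omega) (by omega)
  have S' := S.mono (Z' := insert (q z) (insert (q (e k + 1)) Z))
    ((Set.subset_insert _ _).trans (Set.subset_insert _ _))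
  have hchain : List.IsChain (Edge N p q b e (insert (e k + 2, z) Sp)) (q (e (k + 1) + 1) :: l) :=
    S.chain.imp fun a b hab => hab.mono (Set.subset_insert _ _)
  have hsp : (e k + 2, z) ∈ insert (e k + 2, z) Sp := Set.mem_insert _ _
  have d1 : List.IsChain (Edge N p q b e (insert (e k + 2, z) Sp)) (q (e k + 2) :: q z ::
      q (e (k + 1) + 1) :: l) := by
    refine List.IsChain.cons_cons (.spikeIn _ _ hsp) (List.IsChain.cons_cons ?_ hchain)
    rw [hg]; exact .spikeOut _ _ hsp
  have d2 : TurnsLeft (insert (q z) (insert (q (e k + 1)) Z)) (p (b k + n) :: q (e k + 2) :: q z ::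
      q (e (k + 1) + 1) :: (l ++ [q (e N + 1)])) := by
    -- The opposite sign of the same determinant makes the exit from p (b (k + 1)) to q (e k + 2),
    -- and on to q z, a left turn.
    refine ⟨Or.inr (by rw [hn]; exact hturn), Or.inl (Set.mem_insert _ _), S'.first_turn ?_⟩
    rw [orient_rotate]; exact F.ringQ.orient_side_nonneg _ _
  have hleave := F.ringQ.orient_neg_of_leave_sector
      (F.sector k (b (k + 1) - 1) (by omega) (by omega)) (F.leave k) (by
        have := F.hull (b (k + 1) - 1) (e k + 1)
        rwa [show b (k + 1) - 1 + 1 = b (k + 1) by omega] at this)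
  have hpos : 0 < orient (q (e k + 1)) (p (b k + n)) (q (e k + 2)) := by
    rw [hn, orient_swap]; linarith
  -- The single point of node k + 1 is appended to the run of node k, and the exit goes to the near
  -- end of the side of node k + 1, which is allowed because k + 1 is odd.
  obtain ⟨f1, f2, f3, f4⟩ := F.excursion (i := b k) (n := n) (x := e k + 1) hb0 (by omega) d1
    (.enter k _ _ (by omega) (Or.inr ⟨rfl, hev⟩) rfl)
    (.exit (k + 1) _ _ hk (Or.inr ⟨hg.symm, by
      rw [Nat.not_even_iff_odd]; exact hev.add_one⟩) (by
        rw [show k + 1 + 1 = k + 2 from rfl]; omega)) d2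
    hpos.le (q (e 0))
  have harea : 0 < sweep (q (e 0)) (q (e k) :: q (e k + 1) :: (run p (b k) n ++ q (e k + 2) :: q z ::
      q (e (k + 1) + 1) :: l)) := by
    have h1 := S.area
    simp only [reserve] at h1
    have h3 := F.center_nonneg (x := e k) (y := e k + 1) he0 (by omega) (by omega)
    have h4 := F.center_nonneg (x := e k + 1) (y := e k + 2) (by omega) (by omega) (by omega)
    have h5 := F.center_nonneg (x := e k + 2) (y := z) (by omega) (by omega) z4
    have h6 := orient_swap (q (e 0)) (q z) (q (e (k + 1) + 1))
    rw [sweep, sweep] at f3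
    rw [sweep]
    linarith
  refine ⟨_, insert (e k + 2, z) Sp, ⟨he0, by omega, List.IsChain.cons_cons (.side _ he0 (by omega)) f1,
    by simpa using TurnsLeft.cons (u := q (e k)) f2 fun _ _ _ =>
      Or.inl (Set.mem_insert_of_mem _ (Set.mem_insert _ _)),
    Or.inr ⟨_, rfl⟩, ?_, ?_, hfam, ?_, fun z hz => (by cases hz), harea.le, fun _ _ => harea⟩⟩
  · refine S.last.trans (List.IsSuffix.trans ?_ ((List.suffix_append _ _).trans
      ((List.suffix_cons _ _).trans (List.suffix_cons _ _))))
    exact (List.suffix_cons _ _).trans (List.suffix_cons _ _)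
  · have h1 := S.points
    have h2 := S.high
    simp only [omitted] at h1 ⊢
    rw [← Multiset.cons_coe, ← Multiset.coe_add, coe_run, hn]
    simp only [← Multiset.cons_coe, ← Multiset.singleton_add]
    have hP : pts p (b k) (b N) = pts p (b k) (b (k + 1)) + pts p (b (k + 1)) (b (k + 1) + 1) +
        pts p (b (k + 1) + 1) (b N) := by
      rw [pts_add p hb.le (by omega), pts_add p (by omega) (by omega)]
    rw [pts_cons q (i := e k + 1) (by omega), pts_cons q (i := e k + 1 + 1) (by omega),
      pts_cons q (i := e k + 1 + 1 + 1) (by omega), hP,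
      ← pts_add p (i := b k) (j := b (k + 1)) hb.le (by omega)]
    rw [hg, hs] at h1
    rw [hg]
    have h3 : ({q z} : Multiset Plane) + l = pts p (b (k + 1) + 1) (b N) + pts q (e k + 2 + 1 + 1) (e N + 1) := by
      rw [← h1, add_comm]
    have e1 : {q (e k + 1)} + (pts p (b k) (b (k + 1)) + pts p (b (k + 1)) (b (k + 1) + 1) +
        ({q (e k + 2)} + ({q z} + ({q (e k + 2 + 1)} + (l : Multiset Plane))))) + 0 =
        {q (e k + 1)} + (pts p (b k) (b (k + 1)) + pts p (b (k + 1)) (b (k + 1) + 1) +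
        ({q (e k + 2)} + ({q (e k + 2 + 1)} + ({q z} + (l : Multiset Plane))))) := by abel
    rw [e1, h3]
    simp only [show e k + 1 + 1 = e k + 2 from rfl]
    abel
  · rintro s (rfl | hs')
    · simp only; omega
    · have := S.spike_gt s hs'; omega

end Frame

/-! ### Closing the path, and counting exceptional vertices over pairs of nodes. -/

theorem rel_of_mem_zip {R : Plane → Plane → Prop} : ∀ {x : Plane} {l : List Plane},
    List.IsChain R (x :: l) → ∀ a ∈ (x :: l).zip l, R a.1 a.2
  | _, [], _, a, ha => by simp at ha
  | x, y :: l, hc, a, ha => by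
    rw [List.zip_cons_cons, List.mem_cons] at ha
    rw [List.isChain_cons_cons] at hc
    rcases ha with rfl | ha
    · exact hc.1
    · exact rel_of_mem_zip hc.2 a ha

theorem TurnsLeft.change_end {Z : Set Plane} {v a b : Plane} (hv : v ∈ Z) :
    ∀ {r : List Plane}, TurnsLeft Z (r ++ [v, a]) → TurnsLeft Z (r ++ [v, b])
  | [], _ => trivial
  | [_], _ => ⟨Or.inl hv, trivial⟩
  | [_, _], h => ⟨h.1, Or.inl hv, trivial⟩
  | _ :: y :: z :: r, h => ⟨h.1, TurnsLeft.change_end (r := y :: z :: r) hv h.2⟩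

theorem nodup_pts {f : ℕ → Plane} {i j : ℕ} (h : ∀ x y, i ≤ x → x < y → y < j → f x ≠ f y) :
    (pts f i j).Nodup := by
  refine Multiset.Nodup.map_on (fun x hx y hy hxy => ?_) (Multiset.nodup_Ico (a := i) (b := j))
  rw [Multiset.mem_Ico] at hx hy
  by_contra hne
  rcases lt_or_gt_of_ne hne with hlt | hlt
  · exact h x y hx.1 hlt hy.2 hxy
  · exact h y x hy.1 hlt hx.2 hxy.symm

theorem mem_pts {f : ℕ → Plane} {i j : ℕ} {y : Plane} : y ∈ pts f i j ↔ ∃ x, i ≤ x ∧ x < j ∧ f x = y := by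
  simp [pts, Multiset.mem_map, and_assoc]

theorem card_pts (f : ℕ → Plane) (i j : ℕ) : (pts f i j).card = j - i := by
  unfold pts
  rw [Multiset.card_map]
  exact Nat.card_Ico i j

namespace Frame

variable {o : Plane} {h m N : ℕ} {p q : ℕ → Plane} {Θ Φ : ℕ → ℝ} {b e : ℕ → ℕ}

/-- There is a path from the entry of node `k` on with at most `c` exceptional vertices. -/
def HasSuffix (m N : ℕ) (p q : ℕ → Plane) (b e : ℕ → ℕ) (k : ℕ) (w : Option ℕ) (c : ℕ) : Prop :=
  ∃ (l : List Plane) (Z : Finset Plane) (Sp : Set (ℕ × ℕ)), Z.card ≤ c ∧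
    Suffix m N p q b e k (e k) w l Z Sp

/-- The number of half-spikes needed to merge the nodes `k` and `k + 1`. -/
def gapCost (b e : ℕ → ℕ) (k : ℕ) : ℕ :=
  if e (k + 1) = e k + 1 then 0
  else if e (k + 1) = e k + 2 ∧ b (k + 2) = b (k + 1) + 1 then 1 else 2

variable (F : Frame o h m N p q Θ Φ b e)
include F

theorem reflexivity_le {S : Finset Plane} (hS : ∀ y, y ∈ S ↔ (∃ i, p i = y) ∨ ∃ x, q x = y) {c : ℕ}
    (hc : HasSuffix m N p q b e 0 none c) : reflexivity S ≤ (c : ℕ∞) := by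
  obtain ⟨l, Z, Sp, hcard, T⟩ := hc
  refine le_trans ?_ (Nat.cast_le.2 hcard)
  have heN := F.eN
  have hbN := F.bN
  have h3P := F.ringP.three_le
  have h3Q := F.ringQ.three_le
  have hq0 : q (e N) = q (e 0) := by rw [heN, F.ringQ.per]
  have hq1 : q (e N + 1) = q (e 0 + 1) := by
    rw [heN, show e 0 + m + 1 = e 0 + 1 + m by omega, F.ringQ.per]
  have hpts := T.points
  simp only [omitted, add_zero] at hpts
  have hmem : ∀ y, y ∈ l ↔ y ∈ S := by
    intro y
    rw [← Multiset.mem_coe, hpts, Multiset.mem_add, mem_pts, mem_pts, hS]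
    constructor
    · rintro (⟨x, _, _, hx⟩ | ⟨x, _, _, hx⟩)
      exacts [Or.inl ⟨x, hx⟩, Or.inr ⟨x, hx⟩]
    · rintro (⟨x, hx⟩ | ⟨x, hx⟩)
      · obtain ⟨j, j1, j2, j3⟩ := F.ringP.exists_rep x (b 0)
        exact Or.inl ⟨j, j1, by omega, by rw [j3, hx]⟩
      · obtain ⟨j, j1, j2, j3⟩ := F.ringQ.exists_rep x (e 0 + 1)
        exact Or.inr ⟨j, j1, by omega, by rw [j3, hx]⟩
  have hnd : l.Nodup := by
    rw [← Multiset.coe_nodup, hpts, Multiset.nodup_add]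
    refine ⟨nodup_pts fun x y h1 h2 h4 => F.ringP.ne_of_lt h2 (by omega),
      nodup_pts fun x y h1 h2 h4 => F.ringQ.ne_of_lt h2 (by omega), ?_⟩
    rw [Multiset.disjoint_left]
    intro y hy hy'
    rw [mem_pts] at hy hy'
    obtain ⟨x, _, _, hx⟩ := hy
    obtain ⟨x', _, _, hx'⟩ := hy'
    exact F.p_ne_q x x' (hx.trans hx'.symm)
  have hlen : 3 ≤ l.length := by
    rw [← Multiset.coe_card, hpts]
    rw [Multiset.card_add, card_pts, card_pts]; omega
  obtain ⟨y, l, rfl⟩ : ∃ y l', l = y :: l' := by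
    cases l with
    | nil => simp at hlen
    | cons y l => exact ⟨y, l, rfl⟩
  have hlast : (y :: l).getLast? = some (q (e 0)) := by
    obtain ⟨r, hr⟩ := T.last
    rw [hq0] at hr
    have h1 : (q (e 0) :: y :: l).getLast? = some (q (e 0)) := by rw [← hr]; simp
    rwa [List.getLast?_cons_cons] at h1
  refine reflexivity_le_of_list hnd (fun v => (hmem v).symm) hlen hlast ?_
    (T.area_pos (by have := F.two_le; omega) rfl) ?_
  · intro a ha a' ha' h1 h2 h3
    exact F.edge_compat T.family (rel_of_mem_zip T.chain a ha) (rel_of_mem_zip T.chain a' ha') h1 h2 h3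
  · have ht := T.turns
    -- At the closing vertex q (e 0) either the turn is excused, so the appended point may be
    -- replaced, or the path begins along the ring and the appended point is already the right one.
    rcases T.head with h1 | ⟨l', h1⟩
    · obtain ⟨r, hr⟩ := T.last
      rw [← hr] at ht
      rw [← hr]
      rw [List.append_assoc] at ht ⊢
      exact TurnsLeft.change_end (by rw [hq0]; exact h1) ht
    · rw [List.cons_append] at h1
      rw [hq1, ← (List.cons.inj h1).1] at ht
      exact ht

theorem hasSuffix_end : HasSuffix m N p q b e N none 0 :=
  ⟨[], ∅, ∅, le_rfl, {
    low := F.emono.monotone (Nat.zero_le N)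
    high := le_rfl
    chain := by simp
    turns := trivial
    head := Or.inr ⟨[], rfl⟩
    last := List.suffix_rfl
    points := by simp [pts, omitted]
    family := ⟨by simp, by simp⟩
    spike_gt := by simp
    omit_spec := fun z hz => by cases hz
    area := by simp [reserve, sweep]
    area_pos := fun h1 => absurd h1 (lt_irrefl N) }⟩

theorem HasSuffix.node {k c : ℕ} {w : Option ℕ} (H : HasSuffix m N p q b e (k + 1) w c)
    (hk : k < N) : HasSuffix m N p q b e k w (c + 1) := by
  classical
  obtain ⟨l, Z, Sp, hcard, T⟩ := H
  have h1 := F.emono (Nat.lt_succ_self k)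
  have h2 := F.emono.monotone (Nat.zero_le k)
  obtain ⟨l', T'⟩ := T.sides F (x := e k + 1) (by omega) h1
  obtain ⟨l'', T''⟩ := T'.node F hk
  refine ⟨l'', insert (q (e k)) Z, Sp, (Finset.card_insert_le _ _).trans (by omega), ?_⟩
  rw [Finset.coe_insert]; exact T''

theorem HasSuffix.merge {k c : ℕ} {w : Option ℕ} (H : HasSuffix m N p q b e (k + 2) w c)
    (hk : k + 1 < N) (hev : Even k) (hg : e (k + 1) = e k + 1) :
    HasSuffix m N p q b e k w (c + 1) := by
  classical
  obtain ⟨l, Z, Sp, hcard, T⟩ := H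
  have h1 := F.emono (Nat.lt_succ_self (k + 1))
  have h2 := F.emono.monotone (Nat.zero_le (k + 1))
  obtain ⟨l', T'⟩ := T.sides F (x := e (k + 1) + 1) (by omega) h1
  obtain ⟨l'', T''⟩ := T'.merge F hk hev hg
  refine ⟨l'', insert (q (e k + 1)) Z, Sp, (Finset.card_insert_le _ _).trans (by omega), ?_⟩
  rw [Finset.coe_insert]; exact T''

theorem HasSuffix.merge_omit {k c : ℕ} (H : HasSuffix m N p q b e (k + 2) none c)
    (hk : k + 1 < N) (hev : Even k) (hg : e (k + 1) = e k + 2) (hs : b (k + 2) = b (k + 1) + 1) :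
    ∃ z, HasSuffix m N p q b e k (some z) (c + 1) := by
  classical
  obtain ⟨l, Z, Sp, hcard, T⟩ := H
  have h1 := F.emono (Nat.lt_succ_self (k + 1))
  have h2 := F.emono.monotone (Nat.zero_le (k + 1))
  obtain ⟨l', T'⟩ := T.sides F (x := e (k + 1) + 1) (by omega) h1
  obtain ⟨l'', T''⟩ := T'.merge_omit F hk hev hg hs
  refine ⟨e k + 2, l'', insert (q (e k + 1)) Z, Sp, (Finset.card_insert_le _ _).trans (by omega), ?_⟩
  rw [Finset.coe_insert]; exact T''

/-- The point p (b (k + 1)) has q z on one side or the other of its line to q (e k + 2). This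
decides whether the spike goes into the side before q (e k + 2) or the one after; either way, two
vertices are excused. -/
theorem HasSuffix.insert_spike {k c z : ℕ} (H : HasSuffix m N p q b e (k + 2) (some z) c)
    (hk : k + 1 < N) (hev : Even k) (hg : e (k + 1) = e k + 2) (hs : b (k + 2) = b (k + 1) + 1) :
    HasSuffix m N p q b e k none (c + 2) := by
  classical
  obtain ⟨l, Z, Sp, hcard, T⟩ := H
  have h1 := F.emono (Nat.lt_succ_self (k + 1))
  have h2 := F.emono.monotone (Nat.zero_le (k + 1))
  obtain ⟨l', T'⟩ := T.sides F (x := e (k + 1) + 1) (by omega) h1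
  have key : ∀ a a' : Plane, (insert a (insert a' Z)).card ≤ c + 2 := fun a a' =>
    (Finset.card_insert_le _ _).trans (by have := Finset.card_insert_le a' Z; omega)
  rcases le_total (orient (p (b (k + 1))) (q (e k + 2)) (q z)) 0 with ht | ht
  · obtain ⟨l'', Sp', T''⟩ := T'.insert_before F hk hg hs ht
    refine ⟨l'', _, Sp', key (q z) (q (e k)), ?_⟩
    rw [Finset.coe_insert, Finset.coe_insert]; exact T''
  · obtain ⟨l'', Sp', T''⟩ := T'.insert_after F hk hev hg hs ht
    refine ⟨l'', _, Sp', key (q z) (q (e k + 1)), ?_⟩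
    rw [Finset.coe_insert, Finset.coe_insert]; exact T''

omit F in
theorem HasSuffix.mono {k c c' : ℕ} {w : Option ℕ} (H : HasSuffix m N p q b e k w c) (hc : c ≤ c') :
    HasSuffix m N p q b e k w c' := by
  obtain ⟨l, Z, Sp, hcard, T⟩ := H
  exact ⟨l, Z, Sp, hcard.trans hc, T⟩

/-- The pairs of nodes 2j and 2j + 1 are treated from the last one backwards, after a possible
unpaired node. A pair of gap cost 0 needs one excused vertex and a pair of cost 2 needs two. Pairs
of cost 1 are matched up: one omits a point, the next one inserts it. When the accumulated cost is
odd, both versions are kept: a complete path with the half unit rounded up, and a path with an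
omitted point with it rounded down. -/
theorem hasSuffix_aux (r u : ℕ) (hN : N = 2 * u + r) (hr : r < 2) (d : ℕ) (hd : d ≤ u) :
    HasSuffix m N p q b e (2 * (u - d)) none
        (r + d + ((∑ j ∈ Finset.Ico (u - d) u, gapCost b e (2 * j)) + 1) / 2) ∧
      ((∑ j ∈ Finset.Ico (u - d) u, gapCost b e (2 * j)) % 2 = 1 →
        ∃ z, HasSuffix m N p q b e (2 * (u - d)) (some z)
          (r + d + (∑ j ∈ Finset.Ico (u - d) u, gapCost b e (2 * j)) / 2)) := by
  induction d with
  | zero =>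
    simp only [Nat.sub_zero, Finset.Ico_self, Finset.sum_empty]
    refine ⟨?_, by simp⟩
    rcases (show r = 0 ∨ r = 1 by omega) with rfl | rfl
    · have := F.hasSuffix_end
      rw [hN] at this ⊢
      exact this
    · have h1 := F.hasSuffix_end
      have h2 : HasSuffix m N p q b e (2 * u + 1) none 0 := by
        convert h1 using 1; exact hN.symm
      exact h2.node F (by omega)
  | succ d ih =>
    obtain ⟨hA, hB⟩ := ih (by omega)
    set t := u - (d + 1) with ht
    have htd : u - d = t + 1 := by omega
    rw [htd] at hA hB
    rw [Finset.sum_eq_sum_Ico_succ_bot (show t < u by omega)]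
    set τ := ∑ j ∈ Finset.Ico (t + 1) u, gapCost b e (2 * j)
    rw [show 2 * (t + 1) = 2 * t + 2 by omega] at hA hB
    have hk : 2 * t + 1 < N := by omega
    have hev : Even (2 * t) := ⟨t, by omega⟩
    have hU : ∀ {w c}, HasSuffix m N p q b e (2 * t + 2) w c → HasSuffix m N p q b e (2 * t) w (c + 2) :=
      fun H => (H.node F hk).node F (by omega)
    by_cases h1 : e (2 * t + 1) = e (2 * t) + 1
    · have hT : gapCost b e (2 * t) = 0 := by simp [gapCost, h1]
      rw [hT, zero_add]
      refine ⟨(hA.merge F hk hev h1).mono (by omega), fun h2 => ?_⟩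
      obtain ⟨z, hz⟩ := hB h2
      exact ⟨z, (hz.merge F hk hev h1).mono (by omega)⟩
    by_cases h2 : e (2 * t + 1) = e (2 * t) + 2 ∧ b (2 * t + 2) = b (2 * t + 1) + 1
    · have hT : gapCost b e (2 * t) = 1 := by
        unfold gapCost; rw [if_neg h1, if_pos h2]
      rw [hT]
      -- After an even total this pair opens an omission, or is paid in full; after an odd total it
      -- absorbs the omission.
      rcases Nat.mod_two_eq_zero_or_one τ with h3 | h3
      · refine ⟨(hU hA).mono (by omega), fun _ => ?_⟩
        obtain ⟨z, hz⟩ := hA.merge_omit F hk hev h2.1 h2.2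
        exact ⟨z, hz.mono (by omega)⟩
      · obtain ⟨z, hz⟩ := hB h3
        exact ⟨(hz.insert_spike F hk hev h2.1 h2.2).mono (by omega), fun h4 => by omega⟩
    · have hT : gapCost b e (2 * t) = 2 := by
        unfold gapCost; rw [if_neg h1, if_neg h2]
      rw [hT]
      refine ⟨(hU hA).mono (by omega), fun h3 => ?_⟩
      obtain ⟨z, hz⟩ := hB (by omega)
      exact ⟨z, (hU hz).mono (by omega)⟩

theorem hasSuffix_zero : HasSuffix m N p q b e 0 none
    (N % 2 + N / 2 + ((∑ j ∈ Finset.range (N / 2), gapCost b e (2 * j)) + 1) / 2) := by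
  have := (F.hasSuffix_aux (N % 2) (N / 2) (Nat.div_add_mod N 2).symm
    (Nat.mod_lt _ (by norm_num)) (N / 2) le_rfl).1
  rwa [Nat.sub_self, mul_zero, ← Finset.range_eq_Ico] at this

theorem shift (s : ℕ) : Frame o h m N p q Θ Φ (fun k => b (k + s)) (fun k => e (k + s)) where
  ringP := F.ringP
  ringQ := F.ringQ
  hull := F.hull
  bmono := fun k l hkl => F.bmono (by omega)
  emono := fun k l hkl => F.emono (by omega)
  bper := fun k => by
    rw [show k + N + s = k + s + N by omega]; exact F.bper _
  eper := fun k => by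
    rw [show k + N + s = k + s + N by omega]; exact F.eper _
  sector := fun k i h1 h2 => F.sector (k + s) i h1 (by
    rw [show k + s + 1 = k + 1 + s by omega]; exact h2)
  leave := fun k => by
    have := F.leave (k + s)
    rw [show k + 1 + s = k + s + 1 by omega]; exact this

/-- Every step of e and of b is at least 1, and the gap cost is bounded by the excess of these two
steps. Over a period the steps add up to m and h; the block of node k + 1 is paired with the gap
before it, whence the shift of b. -/
theorem sum_gapCost_le : 2 * N + ∑ k ∈ Finset.range N, gapCost b e k ≤ h + m := by
  have h1 : ∀ k, 2 + gapCost b e k ≤ (e (k + 1) - e k) + (b (k + 1 + 1) - b (k + 1)) := by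
    intro k
    have a1 := F.emono (Nat.lt_succ_self k)
    have a2 := F.bmono (Nat.lt_succ_self (k + 1))
    simp only [Nat.succ_eq_add_one] at a1 a2
    rw [show k + 1 + 1 = k + 2 from rfl] at *
    unfold gapCost
    split_ifs <;> omega
  have h2 : ∀ n, ∑ k ∈ Finset.range n, (2 + gapCost b e k) ≤ (e n - e 0) + (b (n + 1) - b 1) := by
    intro n
    induction n with
    | zero => simp
    | succ n ih =>
      rw [Finset.sum_range_succ]
      have := h1 n
      have a1 := F.emono (Nat.lt_succ_self n)
      have a2 := F.bmono (Nat.lt_succ_self (n + 1))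
      have a3 := F.emono.monotone (Nat.zero_le n)
      have a4 := F.bmono.monotone (show 1 ≤ n + 1 by omega)
      simp only [Nat.succ_eq_add_one] at a1 a2
      omega
  have h3 := h2 N
  rw [Finset.sum_add_distrib, Finset.sum_const, Finset.card_range, smul_eq_mul] at h3
  have h4 := F.eN
  have h5 := F.bper 1
  rw [show 1 + N = N + 1 by omega] at h5
  omega

theorem gapCost_add (k : ℕ) : gapCost b e (k + N) = gapCost b e k := by
  unfold gapCost
  rw [show k + N + 1 = k + 1 + N by omega, show k + N + 2 = k + 2 + N by omega]
  simp only [F.eper, F.bper]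
  congr 1
  · simp only [eq_iff_iff]; omega
  · congr 1
    simp only [eq_iff_iff]; omega

/-- Each gap occurs in N / 2 of the N shifted pairings, so some shift is no worse than the average.
-/
theorem exists_shift : ∃ s, N * ∑ j ∈ Finset.range (N / 2), gapCost b e (2 * j + s) ≤
    N / 2 * ∑ k ∈ Finset.range N, gapCost b e k := by
  by_contra hcon
  push Not at hcon
  have hsum : ∀ j, ∑ s ∈ Finset.range N, gapCost b e (j + s) = ∑ k ∈ Finset.range N, gapCost b e k := by
    intro j
    induction j with
    | zero => simp
    | succ j ih =>
      rw [← ih]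
      have h1 := Finset.sum_range_succ (fun s => gapCost b e (j + s)) N
      rw [Finset.sum_range_succ' (fun s => gapCost b e (j + s)) N, F.gapCost_add, add_zero] at h1
      have h2 : ∑ s ∈ Finset.range N, gapCost b e (j + (s + 1)) =
          ∑ s ∈ Finset.range N, gapCost b e (j + 1 + s) :=
        Finset.sum_congr rfl fun s _ => by rw [show j + (s + 1) = j + 1 + s by omega]
      omega
  have hN := F.two_le
  have h1 : ∑ s ∈ Finset.range N, (N / 2 * ∑ k ∈ Finset.range N, gapCost b e k) <
      ∑ s ∈ Finset.range N, N * ∑ j ∈ Finset.range (N / 2), gapCost b e (2 * j + s) :=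
    Finset.sum_lt_sum_of_nonempty ⟨0, by simp; omega⟩ fun s _ => hcon s
  have h2 : ∑ s ∈ Finset.range N, N * ∑ j ∈ Finset.range (N / 2), gapCost b e (2 * j + s) =
      N * (N / 2 * ∑ k ∈ Finset.range N, gapCost b e k) := by
    rw [← Finset.mul_sum, Finset.sum_comm]
    simp only [hsum, Finset.sum_const, Finset.card_range, smul_eq_mul]
  rw [h2] at h1
  simp only [Finset.sum_const, Finset.card_range, smul_eq_mul] at h1
  exact lt_irrefl _ h1

theorem exists_small_suffix : ∃ s c, 4 * c ≤ h + m + 3 ∧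
    HasSuffix m N p q (fun k => b (k + s)) (fun k => e (k + s)) 0 none c := by
  obtain ⟨s, hs⟩ := F.exists_shift
  refine ⟨s, _, ?_, (F.shift s).hasSuffix_zero⟩
  have h1 := F.sum_gapCost_le
  have h2 := F.two_le
  have h3 : ∀ j, gapCost (fun k => b (k + s)) (fun k => e (k + s)) (2 * j) = gapCost b e (2 * j + s) := by
    intro j
    unfold gapCost
    simp only [show 2 * j + 1 + s = 2 * j + s + 1 by omega, show 2 * j + 2 + s = 2 * j + s + 2 by omega]
  simp only [h3]
  set τ := ∑ j ∈ Finset.range (N / 2), gapCost b e (2 * j + s)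
  set T := ∑ k ∈ Finset.range N, gapCost b e k
  have h4 := Nat.div_add_mod N 2
  have h6 : 4 * ((τ + 1) / 2) ≤ 2 * τ + 2 := by omega
  have hu : 0 < N / 2 := by omega
  -- The average gives N τ ≤ ⌊N/2⌋ T. If N is odd and T > 0, then 2τ < T, and the unit gained
  -- offsets the unpaired node. If T = 0 then τ = 0 and nothing is lost by rounding.
  have h7 : 2 * τ + N % 2 ≤ T + (if T = 0 then N % 2 else 0) := by
    set u := N / 2
    split_ifs with hT
    · rw [hT, mul_zero] at hs
      have : τ = 0 := by
        by_contra h0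
        have := Nat.mul_pos (show 0 < N by omega) (Nat.pos_of_ne_zero h0)
        omega
      omega
    · rcases Nat.mod_two_eq_zero_or_one N with h8 | h8
      · rw [h8] at h4 ⊢
        have hN : N = 2 * u := by omega
        rw [hN] at hs
        have : u * (2 * τ) ≤ u * T := by nlinarith
        have := Nat.le_of_mul_le_mul_left this hu
        omega
      · rw [h8] at h4 ⊢
        by_contra hc
        have h9 : T ≤ 2 * τ := by omega
        have hN : N = 2 * u + 1 := by omega
        rw [hN] at hs
        have hτ : 0 < τ := by omega
        have := Nat.mul_le_mul_left u h9
        nlinarith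
  rcases Nat.eq_zero_or_pos T with hT | hT
  · rw [if_pos hT] at h7
    omega
  · rw [if_neg (by omega)] at h7
    omega

end Frame

/-! ### The two layers -/

theorem notMem_interior_of_extreme {C : Set Plane} {x : Plane} (hx : x ∈ C.extremePoints ℝ) :
    x ∉ interior C := by
  intro hint
  let w : Plane := !₂[1, 0]
  have hcont : Continuous fun t : ℝ => x + t • w := by fun_prop
  have hmem : ∀ᶠ t in nhds (0 : ℝ), x + t • w ∈ C := by
    have : (fun t : ℝ => x + t • w) 0 ∈ interior C := by simpa using hint
    exact (hcont.continuousAt.eventually_mem (isOpen_interior.mem_nhds this)).mono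
      fun t ht => interior_subset ht
  obtain ⟨ε, hε, hball⟩ := Metric.eventually_nhds_iff.1 hmem
  have h1 := hball (y := ε / 2) (by rw [Real.dist_eq, sub_zero, abs_of_pos] <;> linarith)
  have h2 := hball (y := -(ε / 2)) (by rw [Real.dist_eq, sub_zero, abs_neg, abs_of_pos] <;> linarith)
  have h3 := hx.2 h1 h2 ⟨1 / 2, 1 / 2, by norm_num, by norm_num, by norm_num, by
    apply plane_ext <;> simp <;> ring⟩
  have h4 := congrArg (fun z : Plane => z 0) h3
  simp [w] at h4
  linarith

/-- By Krein–Milman the hull is generated by its extreme points. These belong to X and are not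
interior to the hull. -/
theorem convexHull_inter_frontier {X : Set Plane} (hX : X.Finite) :
    convexHull ℝ (X ∩ frontier (convexHull ℝ X)) = convexHull ℝ X := by
  refine Set.Subset.antisymm (convexHull_mono Set.inter_subset_left) ?_
  have hext : (convexHull ℝ X).extremePoints ℝ ⊆ X ∩ frontier (convexHull ℝ X) := by
    intro x hx
    have h1 := extremePoints_convexHull_subset hx
    exact ⟨h1, subset_closure (subset_convexHull ℝ X h1), notMem_interior_of_extreme hx⟩
  have hfin : (X ∩ frontier (convexHull ℝ X)).Finite := hX.subset Set.inter_subset_left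
  exact (closure_convexHull_extremePoints (hX.isCompact_convexHull ℝ)
    (convex_convexHull ℝ X)).symm.subset.trans
    (closure_minimal (convexHull_mono hext) (hfin.isClosed_convexHull ℝ))

/-- If a point remained after two layers, the remaining finite set would have boundary points of its
hull, and these would form a nonempty third layer. -/
theorem subset_frontier_of_hasLayers {S : Finset Plane} (hS : HasLayers (S : Set Plane) 2) :
    let Q := (S : Set Plane) \ frontier (convexHull ℝ (S : Set Plane))
    Q.Nonempty ∧ Q ⊆ frontier (convexHull ℝ Q) := by
  intro Q
  have hQ : remaining (S : Set Plane) 1 = Q := rfl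
  constructor
  · obtain ⟨x, hx⟩ := (hS 1).2 (by norm_num)
    exact ⟨x, hx.1⟩
  · by_contra hcon
    have hR : (remaining (S : Set Plane) 2).Nonempty := by
      rw [Set.not_subset] at hcon
      obtain ⟨x, hx, hx'⟩ := hcon
      exact ⟨x, hx, hx'⟩
    have hfin : (remaining (S : Set Plane) 2).Finite :=
      S.finite_toSet.subset (Set.sdiff_subset.trans Set.sdiff_subset)
    have h1 := convexHull_inter_frontier hfin
    have h2 : (layer (S : Set Plane) 2).Nonempty := by
      rw [Set.nonempty_iff_ne_empty]
      intro h0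
      unfold layer at h0
      rw [h0, convexHull_empty] at h1
      exact (hR.convexHull (𝕜 := ℝ)).ne_empty h1.symm
    exact absurd ((hS 2).1 h2) (by norm_num)

theorem cast_le_ceil {c n : ℕ} (h : 4 * c ≤ n + 3) : (c : ℕ∞) ≤ (⌈(n : ℝ) / 4⌉₊ : ℕ∞) := by
  rw [Nat.cast_le]
  rcases Nat.eq_zero_or_pos c with rfl | hc
  · exact Nat.zero_le _
  obtain ⟨d, rfl⟩ : ∃ d, c = d + 1 := ⟨c - 1, by omega⟩
  rw [Nat.succ_le_iff, Nat.lt_ceil, lt_div_iff₀ (by norm_num)]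
  have : d * 4 < n := by omega
  exact_mod_cast this

theorem orient_eq_zero_of_interior_empty {X : Set Plane} (hX : interior (convexHull ℝ X) = ∅)
    {a b c : Plane} (ha : a ∈ X) (hb : b ∈ X) (hc : c ∈ X) : orient a b c = 0 := by
  by_contra hne
  have htop : affineSpan ℝ X = ⊤ := by
    rw [eq_top_iff]
    intro z _
    have ha' := subset_affineSpan ℝ X ha
    have hb' := subset_affineSpan ℝ X hb
    have hc' := subset_affineSpan ℝ X hc
    have d1 := AffineSubspace.vsub_mem_direction hb' ha'
    have d2 := AffineSubspace.vsub_mem_direction hc' ha'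
    have hz : z = ((orient a z c / orient a b c) • (b -ᵥ a) + (orient a b z / orient a b c) • (c -ᵥ a)) +ᵥ a := by
      apply plane_ext
      · simp
        field_simp
        simp only [orient_eq]; ring
      · simp
        field_simp
        simp only [orient_eq]; ring
    rw [hz]
    exact AffineSubspace.vadd_mem_of_mem_direction
      (Submodule.add_mem _ (Submodule.smul_mem _ _ d1) (Submodule.smul_mem _ _ d2)) ha'
  have := interior_convexHull_nonempty_iff_affineSpan_eq_top.2 htop
  rw [hX] at this
  exact Set.not_nonempty_empty this

/-- The case in which the inner layer has interior points. -/
theorem reflexivity_le_of_interior {S P Q : Finset Plane} (hcard : S.card = P.card + Q.card)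
    (hS : ∀ y, y ∈ S ↔ y ∈ P ∨ y ∈ Q)
    (hP : (P : Set Plane) ⊆ frontier (convexHull ℝ (P : Set Plane)))
    (hQ : (Q : Set Plane) ⊆ frontier (convexHull ℝ (Q : Set Plane)))
    (hQP : (Q : Set Plane) ⊆ interior (convexHull ℝ (P : Set Plane))) {o : Plane}
    (ho : o ∈ interior (convexHull ℝ (Q : Set Plane))) :
    reflexivity S ≤ (⌈(S.card : ℝ) / 4⌉₊ : ℕ∞) := by
  have hsub : convexHull ℝ (Q : Set Plane) ⊆ interior (convexHull ℝ (P : Set Plane)) :=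
    convexHull_min hQP (convex_convexHull ℝ _).interior
  have hoP : o ∈ interior (convexHull ℝ (P : Set Plane)) := hsub (interior_subset ho)
  -- The outer ring starts one turn later, so that Φ 0 ≤ π < Θ 0, as `exists_frame` requires.
  obtain ⟨p, Θ, RP, hPp, hΘ, _⟩ := exists_convexRing hP hoP 1
  obtain ⟨q, Φ, RQ, hQq, _, hΦ⟩ := exists_convexRing hQ ho 0
  have hpP : ∀ i, p i ∈ P := fun i => by
    obtain ⟨j, _, j2, j3⟩ := RP.exists_rep i 0
    exact (hPp _).2 ⟨j, by omega, j3⟩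
  have hqQ : ∀ i, q i ∈ Q := fun i => by
    obtain ⟨j, _, j2, j3⟩ := RQ.exists_rep i 0
    exact (hQq _).2 ⟨j, by omega, j3⟩
  have hrange : Set.range q = (Q : Set Plane) := by
    ext y
    constructor
    · rintro ⟨i, rfl⟩; exact hqQ i
    · intro hy
      obtain ⟨i, _, hi⟩ := (hQq y).1 hy
      exact ⟨i, hi⟩
  obtain ⟨N, b, e, F⟩ := exists_frame RP RQ (fun i x => by
      refine orient_pos_of_mem_interior (hQP (hqQ x))
        (RP.ne_of_lt (Nat.lt_succ_self i) (by have := RP.three_le; omega)) fun y hy => ?_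
      obtain ⟨j, _, rfl⟩ := (hPp y).1 hy
      exact RP.orient_side_nonneg i j)
    (fun i hi => by
      rw [hrange] at hi
      exact (hP (hpP i)).2 (hsub hi)) (by
      have := Real.pi_pos
      push_cast at *
      linarith)
  obtain ⟨s, c, hc, H⟩ := F.exists_small_suffix
  refine ((F.shift s).reflexivity_le (fun y => ?_) H).trans (cast_le_ceil (by omega))
  rw [hS]
  constructor
  · rintro (hy | hy)
    · obtain ⟨i, _, hi⟩ := (hPp y).1 hy
      exact Or.inl ⟨i, hi⟩
    · obtain ⟨i, _, hi⟩ := (hQq y).1 hy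
      exact Or.inr ⟨i, hi⟩
  · rintro (⟨i, rfl⟩ | ⟨i, rfl⟩)
    exacts [Or.inl (hpP i), Or.inr (hqQ i)]

/-! ### Collinear inner layer -/

theorem reflexivity_le_of_fun {S : Finset Plane} {G : ℕ → Plane} {n : ℕ} (h3 : 3 ≤ n)
    (h0 : G n = G 0) (h1 : G (n + 1) = G 1) (inj : ∀ i j, i < j → j < n → G i ≠ G j)
    (hS : ∀ y, y ∈ S ↔ ∃ i < n, G i = y)
    (comp : ∀ i j, i < j → j < n → SegCompat (G i) (G (i + 1)) (G j) (G (j + 1)))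
    {o : Plane} (area : 0 < ∑ i ∈ Finset.range n, orient o (G i) (G (i + 1)))
    {Z : Finset Plane}
    (turn : ∀ i < n, G (i + 1) ∈ Z ∨ 0 ≤ orient (G i) (G (i + 1)) (G (i + 2))) :
    reflexivity S ≤ (Z.card : ℕ∞) := by
  have e0 : ∀ i < n, G (i % n) = G i := fun i hi => by rw [Nat.mod_eq_of_lt hi]
  have e1 : ∀ i < n, G ((i + 1) % n) = G (i + 1) := fun i hi => by
    rcases (show i + 1 ≤ n from hi).eq_or_lt with h | h
    · rw [h, Nat.mod_self, h0]
    · exact e0 _ h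
  have e2 : ∀ i < n, G ((i + 2) % n) = G (i + 2) := fun i hi => by
    rcases (show i + 1 ≤ n from hi).eq_or_lt with h | h
    · rw [show i + 2 = n + 1 by omega, Nat.add_mod_left, Nat.mod_eq_of_lt (by omega), h1]
    · exact e1 _ h
  refine reflexivity_le_of_periodic (g := fun t => G (t % n)) (o := o) h3 (fun i => by simp)
    (fun i j hi hj hij => ?_) (fun y => ?_) (fun i j hij hj => ?_) ?_ (fun i => ?_)
  · simp only [e0 i hi, e0 j hj] at hij
    rcases lt_trichotomy i j with h | h | h
    · exact absurd hij (inj i j h hj)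
    · exact h
    · exact absurd hij.symm (inj j i h hi)
  · rw [hS]
    exact exists_congr fun i => and_congr_right fun hi => by simp only [e0 i hi]
  · simp only [e0 i (hij.trans hj), e1 i (hij.trans hj), e0 j hj, e1 j hj]
    exact comp i j hij hj
  · rwa [Finset.sum_congr rfl fun i hi => by
      rw [e0 i (Finset.mem_range.1 hi), e1 i (Finset.mem_range.1 hi)]]
  · have hi : i % n < n := Nat.mod_lt _ (by omega)
    have a1 : (i % n + 1) % n = (i + 1) % n := by simp
    have a2 : (i % n + 2) % n = (i + 2) % n := by simp
    have := turn (i % n) hi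
    rwa [← e1 _ hi, ← e2 _ hi, a1, a2] at this

theorem ConvexRing.shift {o : Plane} {h : ℕ} {c : ℕ → Plane} {Θ : ℕ → ℝ} (R : ConvexRing o h c Θ)
    (s : ℕ) : ConvexRing o h (fun i => c (i + s)) (fun i => Θ (i + s)) := by
  have hr : Set.range (fun i => c (i + s)) = Set.range c := by
    ext y
    constructor
    · rintro ⟨i, rfl⟩; exact ⟨_, rfl⟩
    · rintro ⟨i, rfl⟩
      obtain ⟨j, h1, _, h3⟩ := R.exists_rep i s
      exact ⟨j - s, by simp only [Nat.sub_add_cancel h1, h3]⟩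
  refine ⟨R.pos, fun i j hij => R.mono (by omega), fun i => ?_, fun i => ?_, fun i => R.polar _,
    fun i => ?_, fun i j k h1 h2 h3 => R.tri _ _ _ (by omega) (by omega) (by omega), ?_, ?_⟩
  · simpa only [show i + h + s = i + s + h by omega] using R.angle_add (i + s)
  · simpa only [show i + h + s = i + s + h by omega] using R.per (i + s)
  · simpa only [show i + 1 + s = i + s + 1 by omega] using R.gap (i + s)
  · rw [hr]; exact R.inner
  · rw [hr]; exact fun i => R.outer _

theorem orient_line_left (o d y : Plane) (s t : ℝ) :
    orient y (o + s • d) (o + t • d) = (t - s) * orient o (o + d) y := by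
  simp only [orient_eq, PiLp.add_apply, PiLp.smul_apply, smul_eq_mul]; ring

/-- The polygon that inserts the points of a line, in their order, into a side of a convex ring
which that line crosses. -/
theorem reflexivity_le_one_of_line {S : Finset Plane} {o d : Plane} {h m : ℕ} {c x : ℕ → Plane}
    {Θ τ : ℕ → ℝ} (R : ConvexRing o h c Θ) (hm : 0 < m) (hx : ∀ a, x a = o + τ a • d)
    (h0 : τ 0 = 0) (hτ : ∀ a b, a < b → b < m → τ a < τ b) (hd : d ≠ 0)
    (hside : ∀ i, ∀ a < m, 0 < orient (c i) (c (i + 1)) (x a))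
    (hfirst : 0 ≤ orient o (o + d) (c 0)) (hlast : orient o (o + d) (c (h - 1)) < 0)
    (hS : ∀ y, y ∈ S ↔ (∃ i < h, c i = y) ∨ ∃ a < m, x a = y) :
    reflexivity S ≤ 1 := by
  have h3 := R.three_le
  have hx0 : x 0 = o := by rw [hx, h0]; simp
  have hT : ∀ a b y, orient y (x a) (x b) = (τ b - τ a) * orient o (o + d) y := fun a b y => by
    rw [hx, hx, orient_line_left]
  have hline : ∀ a, orient o (o + d) (x a) = 0 := fun a => by
    rw [hx]; simp only [orient_eq, PiLp.add_apply, PiLp.smul_apply, smul_eq_mul]; ring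
  have hch : c (h - 1 + 1) = c 0 := by
    have := R.per 0
    rwa [show h - 1 + 1 = 0 + h by omega]
  -- The ring from c 0 to c (h - 1), then the points of the line, then the ring again: the overhang
  -- of two vertices closes the polygon.
  let G : ℕ → Plane := fun t => if t < h then c t else if t < h + m then x (t - h) else c (t - (h + m))
  have g1 : ∀ t < h, G t = c t := fun t ht => if_pos ht
  have g2 : ∀ a < m, G (h + a) = x a := fun a ha => by
    simp only [G]; rw [if_neg (by omega), if_pos (by omega), Nat.add_sub_cancel_left]
  have g3 : ∀ t, G (h + m + t) = c t := fun t => by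
    simp only [G]; rw [if_neg (by omega), if_neg (by omega), Nat.add_sub_cancel_left]
  have hxc : ∀ i, ∀ a < m, c i ≠ x a := fun i a ha he => by
    have := hside i a ha
    rw [← he] at this
    simp at this
  have hxx : ∀ a b, a < b → b < m → x a ≠ x b := fun a b hab hb he => by
    have h1 : (τ b - τ a) * orient o (o + d) (c (h - 1)) = 0 := by rw [← hT, he]; simp
    have h2 := hτ a b hab hb
    have : (τ b - τ a) * orient o (o + d) (c (h - 1)) < 0 :=
      mul_neg_of_pos_of_neg (by linarith) hlast
    linarith
  have hlp : ∀ a < m, 0 ≤ orient (c (h - 1)) (x (m - 1)) (x a) := fun a ha => by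
    rw [hT]
    rcases (show a ≤ m - 1 by omega).eq_or_lt with rfl | hlt
    · simp
    · have := hτ a (m - 1) hlt (by omega)
      nlinarith
  have hlp' : ∀ a, a + 1 < m → 0 < orient (c (h - 1)) (x (m - 1)) (x a) := fun a ha => by
    rw [hT]
    have := hτ a (m - 1) (by omega) (by omega)
    nlinarith
  have hln : orient (c (h - 1)) (x (m - 1)) (c 0) < 0 := by
    have := hside (h - 1) (m - 1) (by omega)
    rw [hch] at this
    rw [orient_swap]; linarith
  have hkind : ∀ i < h + m, (i + 1 < h ∧ G i = c i ∧ G (i + 1) = c (i + 1)) ∨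
      (i + 1 = h ∧ G i = c (h - 1) ∧ G (i + 1) = x 0) ∨
      (∃ a, i = h + a ∧ a + 1 < m ∧ G i = x a ∧ G (i + 1) = x (a + 1)) ∨
      (i + 1 = h + m ∧ G i = x (m - 1) ∧ G (i + 1) = c 0) := by
    intro i hi
    rcases lt_trichotomy (i + 1) h with hlt | heq | hgt
    · exact Or.inl ⟨hlt, g1 _ (by omega), g1 _ hlt⟩
    · refine Or.inr (Or.inl ⟨heq, ?_, ?_⟩)
      · rw [g1 i (by omega)]; congr 1; omega
      · have := g2 0 hm
        rwa [heq]
    · rcases (show i + 1 ≤ h + m by omega).eq_or_lt with heq | hlt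
      · refine Or.inr (Or.inr (Or.inr ⟨heq, ?_, ?_⟩))
        · have := g2 (m - 1) (by omega)
          rwa [show h + (m - 1) = i by omega] at this
        · rw [heq]; exact g3 0
      · refine Or.inr (Or.inr (Or.inl ⟨i - h, by omega, by omega, ?_, ?_⟩))
        · have := g2 (i - h) (by omega)
          rwa [show h + (i - h) = i by omega] at this
        · have := g2 (i - h + 1) (by omega)
          rwa [show h + (i - h + 1) = i + 1 by omega] at this
  -- The line from c (h - 1) through the last point x (m - 1) separates the closing edge from the
  -- edges into the earlier points of the line.
  have hB : ∀ a < m, ∀ y, (y = c (h - 1) ∧ a + 1 < m ∨ ∃ b, a + 1 = b ∧ b < m ∧ y = x b) →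
      SegCompat y (x a) (x (m - 1)) (c 0) := by
    intro a ha y hy
    have hpos : 0 < orient (c (h - 1)) (x (m - 1)) (x a) := hlp' a (by
      rcases hy with hy | ⟨b, rfl, hb, _⟩
      exacts [hy.2, hb])
    refine (segCompat_of_separated (u := c (h - 1)) (v := x (m - 1)) (by simp) hln.le
      (Or.inr hln.ne) ?_ hpos.le (Or.inr hpos.ne')).symm
    rcases hy with ⟨rfl, _⟩ | ⟨b, rfl, hb, rfl⟩
    · simp
    · exact hlp _ hb
  have main := reflexivity_le_of_fun (S := S) (G := G) (n := h + m) (o := o) (Z := {x 0})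
    (by omega) ?_ ?_ ?_ ?_ ?_ ?_ ?_
  · simpa using main
  · rw [g1 0 (by omega)]; exact g3 0
  · rw [g3 1, g1 1 (by omega)]
  · intro i j hij hj
    rcases lt_or_ge j h with hjh | hjh
    · rw [g1 i (by omega), g1 j hjh]
      exact R.ne_of_lt hij (by omega)
    · obtain ⟨b, rfl⟩ := Nat.exists_eq_add_of_le hjh
      rw [g2 b (by omega)]
      rcases lt_or_ge i h with hih | hih
      · rw [g1 i hih]; exact hxc i b (by omega)
      · obtain ⟨a, rfl⟩ := Nat.exists_eq_add_of_le hih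
        rw [g2 a (by omega)]
        exact hxx a b (by omega) (by omega)
  · intro y
    rw [hS]
    constructor
    · rintro (⟨i, hi, rfl⟩ | ⟨a, ha, rfl⟩)
      · exact ⟨i, by omega, g1 i hi⟩
      · exact ⟨h + a, by omega, g2 a ha⟩
    · rintro ⟨i, hi, rfl⟩
      rcases lt_or_ge i h with hih | hih
      · exact Or.inl ⟨i, hih, (g1 i hih).symm⟩
      · obtain ⟨a, rfl⟩ := Nat.exists_eq_add_of_le hih
        exact Or.inr ⟨a, by omega, (g2 a (by omega)).symm⟩
  · intro i j hij hj
    rcases hkind i (by omega) with ⟨h1, e1, e2⟩ | ⟨h1, e1, e2⟩ | ⟨a, h1, h2, e1, e2⟩ | ⟨h1, e1, e2⟩ <;>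
    rcases hkind j hj with ⟨k1, f1, f2⟩ | ⟨k1, f1, f2⟩ | ⟨b, k1, k2, f1, f2⟩ | ⟨k1, f1, f2⟩ <;>
    rw [e1, e2, f1, f2] <;> try omega
    · exact R.side_compat hij (by omega)
    · exact segCompat_of_on_line (u := c i) (v := c (i + 1)) (by simp) (by simp)
        (R.orient_side_nonneg _ _) (hside _ _ hm) R.mem_side
    · exact segCompat_of_pos (u := c i) (v := c (i + 1)) (by simp) (by simp)
        (hside _ _ (by omega)) (hside _ _ (by omega))
    · exact (segCompat_of_on_line (u := c i) (v := c (i + 1)) (by simp) (by simp)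
        (R.orient_side_nonneg _ _) (hside _ _ (by omega)) R.mem_side).flip_right
    · refine (segCompat_of_on_line' (u := o) (v := o + d) (hline b) (hline (b + 1))
        (hline 0).le hlast fun hmem => ?_).symm.flip_left
      rcases Nat.eq_zero_or_pos b with rfl | hb
      · exact Or.inl rfl
      exfalso
      obtain ⟨s, s0, s1, _, _, hs⟩ := orient_of_mem_segment hmem
      have := hs (c (h - 1)) (x 0)
      rw [hT, hT, hT] at this
      have t1 := hτ 0 b hb (by omega)
      have p1 : (τ b - τ 0) * orient o (o + d) (c (h - 1)) < 0 :=
        mul_neg_of_pos_of_neg (by linarith) hlast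
      have p2 : (τ (b + 1) - τ 0) * orient o (o + d) (c (h - 1)) ≤
          (τ b - τ 0) * orient o (o + d) (c (h - 1)) :=
        mul_le_mul_of_nonpos_right (by linarith [hτ b (b + 1) (by omega) (by omega)]) hlast.le
      have p3 := mul_nonneg s0 (sub_nonneg.2 p2)
      rw [sub_self, zero_mul] at this
      linarith
    · rcases (show 1 ≤ m from hm).eq_or_lt with rfl | hm1
      · exact segCompat_of_on_line' (u := c (h - 1)) (v := x 0) (by simp) (by simp) (by simp)
          hln fun _ => Or.inr rfl
      · exact hB 0 hm _ (Or.inl ⟨rfl, by omega⟩)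
    -- The perpendicular to the line at x b separates the edges before x b from the edge after it.
    · let w : Plane := !₂[d 1, -d 0]
      have hd2 : 0 < d 0 * d 0 + d 1 * d 1 := by
        by_contra hcon
        exact hd (plane_ext (by simp; nlinarith [mul_self_nonneg (d 0), mul_self_nonneg (d 1)])
          (by simp; nlinarith [mul_self_nonneg (d 0), mul_self_nonneg (d 1)]))
      have key : ∀ t, orient (x b) (x b + w) (x t) = (τ t - τ b) * (d 0 * d 0 + d 1 * d 1) := by
        intro t
        rw [hx, hx]
        simp [orient_eq, w]; ring
      have s1 : τ a < τ b := hτ a b (by omega) (by omega)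
      have s2 : τ (a + 1) ≤ τ b := by
        rcases (show a + 1 ≤ b by omega).eq_or_lt with rfl | hlt
        · exact le_rfl
        · exact (hτ _ _ hlt (by omega)).le
      have s3 : τ b < τ (b + 1) := hτ b (b + 1) (by omega) (by omega)
      refine segCompat_of_separated (u := x b) (v := x b + w) ?_ ?_ (Or.inl ?_) ?_ ?_ (Or.inr ?_)
      · rw [key]; nlinarith
      · rw [key]; nlinarith
      · rw [key]; exact (mul_neg_of_neg_of_pos (by linarith) hd2).ne
      · simp
      · rw [key]; nlinarith
      · rw [key]; exact (mul_pos (by linarith) hd2).ne'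
    · exact (hB a (by omega) _ (Or.inr ⟨a + 1, rfl, h2, rfl⟩)).flip_left
  -- With base point o = x 0 the entering edge and the edges on the line sweep nothing, and the
  -- closing edge sweeps a nonnegative area by `hfirst`.
  · refine Finset.sum_pos' (fun i hi => ?_) ⟨0, Finset.mem_range.2 (by omega), ?_⟩
    · rcases hkind i (Finset.mem_range.1 hi) with
        ⟨h1, e1, e2⟩ | ⟨h1, e1, e2⟩ | ⟨a, h1, h2, e1, e2⟩ | ⟨h1, e1, e2⟩ <;> rw [e1, e2]
      · exact (R.side_pos i).le
      · rw [hx0]; simp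
      · rw [← hx0, hT, hx0]; simp
      · have e : orient o (x (m - 1)) (c 0) = (τ (m - 1) - τ 0) * orient o (o + d) (c 0) := by
          rw [← hT, hx0, orient_rotate, orient_rotate]
        rw [e]
        refine mul_nonneg ?_ hfirst
        rcases Nat.eq_zero_or_pos (m - 1) with h' | h'
        · simp [h']
        · linarith [hτ 0 (m - 1) h' (by omega)]
    · rw [g1 0 (by omega), g1 (0 + 1) (by omega)]
      exact R.side_pos 0
  · intro i hi
    rcases hkind i hi with ⟨h1, e1, e2⟩ | ⟨h1, e1, e2⟩ | ⟨a, h1, h2, e1, e2⟩ | ⟨h1, e1, e2⟩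
    · right
      rcases (show i + 2 ≤ h by omega).eq_or_lt with heq | hlt
      · have := g2 0 hm
        rw [e1, e2, heq, ← add_zero h, this]
        exact (hside i 0 hm).le
      · rw [e1, e2, g1 _ hlt]
        exact R.tri _ _ _ (by omega) (by omega) (by omega)
    · left; rw [e2]; simp
    · right
      rw [e1, e2]
      rcases (show a + 2 ≤ m by omega).eq_or_lt with heq | hlt
      · have := g3 0
        rw [show i + 2 = h + m + 0 by omega, this, orient_rotate, orient_rotate, hT]
        exact mul_nonneg (by linarith [hτ a (a + 1) (by omega) (by omega)]) hfirst
      · rw [h1, show h + a + 2 = h + (a + 2) by omega, g2 _ hlt, hT]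
        have : orient o (o + d) (x a) = 0 := hline a
        rw [this]; simp
    · right
      rw [e1, e2, show i + 2 = h + m + 1 by omega, g3 1]
      have := hside 0 (m - 1) (by omega)
      rw [orient_rotate]
      exact this.le

theorem reflexivity_le_of_collinear {S P Q : Finset Plane} (hcard : S.card = P.card + Q.card)
    (hS : ∀ y, y ∈ S ↔ y ∈ P ∨ y ∈ Q)
    (hP : (P : Set Plane) ⊆ frontier (convexHull ℝ (P : Set Plane)))
    (hQP : (Q : Set Plane) ⊆ interior (convexHull ℝ (P : Set Plane))) (hne : Q.Nonempty)
    (hcol : ∀ a ∈ Q, ∀ b ∈ Q, ∀ y ∈ Q, orient a b y = 0) :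
    reflexivity S ≤ (⌈(S.card : ℝ) / 4⌉₊ : ℕ∞) := by
  obtain ⟨u, hu⟩ := hne
  obtain ⟨d, hd, hud⟩ : ∃ d : Plane, d ≠ 0 ∧ ∀ y ∈ Q, orient u (u + d) y = 0 := by
    by_cases hv : ∃ v ∈ Q, v ≠ u
    · obtain ⟨v, hv, hvu⟩ := hv
      exact ⟨v - u, sub_ne_zero.2 hvu, fun y hy => by rw [add_sub_cancel]; exact hcol u hu v hv y hy⟩
    · push Not at hv
      refine ⟨!₂[1, 0], fun he => ?_, fun y hy => ?_⟩
      · have := congrArg (fun z : Plane => z 0) he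
        simp at this
      · rw [hv y hy]; simp
  have hd2 : 0 < d 0 * d 0 + d 1 * d 1 := by
    by_contra hcon
    exact hd (plane_ext (by simp; nlinarith [mul_self_nonneg (d 0), mul_self_nonneg (d 1)])
      (by simp; nlinarith [mul_self_nonneg (d 0), mul_self_nonneg (d 1)]))
  let π : Plane → ℝ := fun y => ((y 0 - u 0) * d 0 + (y 1 - u 1) * d 1) / (d 0 * d 0 + d 1 * d 1)
  have hπ : ∀ y ∈ Q, y = u + π y • d := by
    intro y hy
    have h1 := hud y hy
    simp only [orient_eq, PiLp.add_apply] at h1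
    apply plane_ext
    · have : y 0 - u 0 = π y * d 0 := by
        simp only [π]
        rw [div_mul_eq_mul_div, eq_div_iff hd2.ne']
        linear_combination -d 1 * h1
      simp only [PiLp.add_apply, PiLp.smul_apply, smul_eq_mul]
      linarith
    · have : y 1 - u 1 = π y * d 1 := by
        simp only [π]
        rw [div_mul_eq_mul_div, eq_div_iff hd2.ne']
        linear_combination d 0 * h1
      simp only [PiLp.add_apply, PiLp.smul_apply, smul_eq_mul]
      linarith
  have hinj : Set.InjOn π Q := fun y hy z hz he => by rw [hπ y hy, hπ z hz, he]
  have hc : (Q.image π).card = Q.card := Finset.card_image_of_injOn hinj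
  have hm : 0 < Q.card := Finset.card_pos.2 ⟨u, hu⟩
  let emb := (Q.image π).orderEmbOfFin hc
  let σ : ℕ → ℝ := fun a => if ha : a < Q.card then emb ⟨a, ha⟩ else 0
  have hσ : ∀ a b, a < b → b < Q.card → σ a < σ b := by
    intro a b hab hb
    simp only [σ]
    rw [dif_pos (hab.trans hb), dif_pos hb]
    exact emb.strictMono hab
  have hσQ : ∀ y, y ∈ Q ↔ ∃ a < Q.card, u + σ a • d = y := by
    intro y
    constructor
    · intro hy
      have h1 : π y ∈ Set.range emb := by
        rw [Finset.range_orderEmbOfFin]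
        exact Finset.mem_coe.2 (Finset.mem_image_of_mem π hy)
      obtain ⟨a, ha⟩ := h1
      refine ⟨a, a.2, ?_⟩
      simp only [σ]
      rw [dif_pos a.2, Fin.eta, ha, ← hπ y hy]
    · rintro ⟨a, ha, rfl⟩
      obtain ⟨y, hy, hye⟩ := Finset.mem_image.1 ((Q.image π).orderEmbOfFin_mem hc ⟨a, ha⟩)
      have : σ a = π y := by simp only [σ]; rw [dif_pos ha, hye]
      rw [this, ← hπ y hy]; exact hy
  set o : Plane := u + σ 0 • d with ho_def
  have hoQ : o ∈ Q := (hσQ o).2 ⟨0, hm, rfl⟩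
  have ho : o ∈ interior (convexHull ℝ (P : Set Plane)) := hQP hoQ
  obtain ⟨p, Θ, R, hPp, _⟩ := exists_convexRing hP ho 0
  have h3 := R.three_le
  have hneg : ∃ j, orient o (o + d) (p j) < 0 := by
    by_contra hcon
    push Not at hcon
    have := orient_pos_of_mem_interior ho (u := o) (v := o + d) (by simpa using hd) fun y hy => by
      obtain ⟨j, _, rfl⟩ := (hPp y).1 hy
      exact hcon j
    simp at this
  have hnn : ∃ j, 0 ≤ orient o (o + d) (p j) := by
    by_contra hcon
    push Not at hcon
    have := orient_pos_of_mem_interior ho (u := o + d) (v := o) (by simpa using hd) fun y hy => by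
      obtain ⟨j, _, rfl⟩ := (hPp y).1 hy
      rw [orient_swap_left]
      linarith [hcon j]
    simp at this
  -- The ring has points strictly to the right of the line and points weakly to its left; the line
  -- is inserted into a side where the sign changes.
  obtain ⟨i, hi, hi'⟩ : ∃ i, orient o (o + d) (p i) < 0 ∧ 0 ≤ orient o (o + d) (p (i + 1)) := by
    obtain ⟨j, hj⟩ := hneg
    obtain ⟨k, hk⟩ := hnn
    obtain ⟨k', hk1, _, hk2⟩ := R.exists_rep k j
    by_contra hcon
    push Not at hcon
    have : ∀ t, orient o (o + d) (p (j + t)) < 0 := fun t => by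
      induction t with
      | zero => exact hj
      | succ t ih => exact hcon _ ih
    have := this (k' - j)
    rw [Nat.add_sub_cancel' hk1, hk2] at this
    linarith
  have hmemP : ∀ y, y ∈ P ↔ ∃ j < P.card, p (j + (i + 1)) = y := by
    intro y
    rw [hPp]
    constructor
    · rintro ⟨j, _, rfl⟩
      obtain ⟨k, h1, h2, h3⟩ := R.exists_rep j (i + 1)
      exact ⟨k - (i + 1), by omega, by rw [Nat.sub_add_cancel h1, h3]⟩
    · rintro ⟨j, _, rfl⟩
      obtain ⟨k, h1, h2, h3⟩ := R.exists_rep (j + (i + 1)) 0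
      exact ⟨k, by omega, h3⟩
  have main := reflexivity_le_one_of_line (S := S) (d := d) (x := fun a => u + σ a • d)
    (τ := fun a => σ a - σ 0) (R.shift (i + 1)) hm
    (fun a => by simp only [ho_def, sub_smul]; abel) (by simp)
    (fun a b hab hb => by linarith [hσ a b hab hb]) hd ?_ ?_ ?_ ?_
  · refine main.trans ?_
    have := cast_le_ceil (c := 1) (n := S.card) (by omega)
    simpa using this
  · intro j a ha
    rw [show j + 1 + (i + 1) = j + (i + 1) + 1 by omega]
    refine orient_pos_of_mem_interior (hQP ((hσQ _).2 ⟨a, ha, rfl⟩))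
      (R.ne_of_lt (Nat.lt_succ_self _) (by omega)) fun y hy => ?_
    obtain ⟨k, _, rfl⟩ := (hPp y).1 hy
    exact R.orient_side_nonneg _ k
  · simpa only [zero_add] using hi'
  · rw [show P.card - 1 + (i + 1) = i + P.card by omega, R.per]; exact hi
  · intro y
    rw [hS, hmemP, hσQ]

/-! ### The upper bound -/

theorem reflexivity_le_of_hasLayers {S : Finset Plane} (hS : HasLayers (S : Set Plane) 2) :
    reflexivity S ≤ (⌈(S.card : ℝ) / 4⌉₊ : ℕ∞) := by
  classical
  obtain ⟨hne, hQ⟩ := subset_frontier_of_hasLayers hS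
  set C := convexHull ℝ (S : Set Plane) with hC
  let P := S.filter (· ∈ frontier C)
  let Q := S.filter (· ∉ frontier C)
  have hPc : (P : Set Plane) = (S : Set Plane) ∩ frontier C := by ext; simp [P]
  have hQc : (Q : Set Plane) = (S : Set Plane) \ frontier C := by ext; simp [Q]
  have hhull : convexHull ℝ (P : Set Plane) = C := by
    rw [hPc]; exact convexHull_inter_frontier S.finite_toSet
  have hcard : S.card = P.card + Q.card := (Finset.card_filter_add_card_filter_not _).symm
  have hmem : ∀ y, y ∈ S ↔ y ∈ P ∨ y ∈ Q := fun y => by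
    simp only [P, Q, Finset.mem_filter]; tauto
  have hP : (P : Set Plane) ⊆ frontier (convexHull ℝ (P : Set Plane)) := by
    rw [hhull, hPc]; exact Set.inter_subset_right
  have hQP : (Q : Set Plane) ⊆ interior (convexHull ℝ (P : Set Plane)) := by
    rw [hhull, hQc]
    rintro y ⟨hy, hy'⟩
    by_contra hcon
    exact hy' ⟨subset_closure (subset_convexHull ℝ _ hy), hcon⟩
  rw [← hQc] at hQ hne
  rcases (interior (convexHull ℝ (Q : Set Plane))).eq_empty_or_nonempty with h0 | ⟨o, ho⟩
  · exact reflexivity_le_of_collinear hcard hmem hP hQP (Finset.coe_nonempty.1 hne)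
      fun a ha b hb y hy => orient_eq_zero_of_interior_empty h0 ha hb hy
  · exact reflexivity_le_of_interior hcard hmem hP hQ hQP ho

/-! ### Almost convex position -/

/-- The segments of two pairs of points that separate each other meet in an interior point. -/
theorem not_segCompat_of_cross {a b c d : Plane} (h1 : 0 < orient a b c) (h2 : 0 < orient a c d)
    (h3 : 0 < orient a b d) (h4 : 0 < orient b c d) : ¬ SegCompat a c b d := by
  intro H
  have hid : orient a b c + orient a c d = orient a b d + orient b c d := by
    simp only [orient_eq]; ring
  set D := orient a b c + orient a c d with hD
  have hDpos : 0 < D := by linarith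
  -- The intersection of the two diagonals; its coordinates on either diagonal are ratios of
  -- triangle areas with the same total D.
  let x : Plane := (1 - orient a b c / D) • b + (orient a b c / D) • d
  have hx2 : x ∈ segment ℝ b d := by
    refine ⟨1 - orient a b c / D, orient a b c / D, ?_, by positivity, by ring, rfl⟩
    rw [sub_nonneg, div_le_one hDpos]; linarith
  have hxe : (1 - orient a b d / D) • a + (orient a b d / D) • c = x := by
    apply plane_ext
    · simp only [x, PiLp.add_apply, PiLp.smul_apply, smul_eq_mul]
      field_simp
      simp only [hD, orient_eq]; ring
    · simp only [x, PiLp.add_apply, PiLp.smul_apply, smul_eq_mul]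
      field_simp
      simp only [hD, orient_eq]; ring
  have hx1 : x ∈ segment ℝ a c := by
    refine ⟨1 - orient a b d / D, orient a b d / D, ?_, by positivity, by ring, hxe⟩
    rw [sub_nonneg, div_le_one hDpos]; linarith
  obtain ⟨t, _, _, _, _, ht⟩ := orient_of_mem_segment hx2
  have hz : orient b d x = 0 := by rw [ht]; simp
  rcases (H ⟨hx1, hx2⟩).1 with e | e
  · rw [e, ← orient_rotate] at hz
    linarith
  · rw [Set.mem_singleton_iff.1 e, orient_swap] at hz
    linarith

/-- A cyclic sequence of points in convex position, except that the points whose index satisfies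
`I` lie slightly inside the segment of their two neighbours. -/
structure AlmostConvex (n : ℕ) (v : ℕ → Plane) (I : ℕ → Prop) : Prop where
  four_le : 4 ≤ n
  per : ∀ i, v (i + n) = v i
  perI : ∀ i, I (i + n) ↔ I i
  -- The neighbours of an inner point are outer. For n = 4 opposite points have the same neighbours,
  -- so they may not both be inner either.
  sep : ∀ i, I i → ¬ I (i + 1)
  -- In the field `pos` the excluded triples are an inner point with its two neighbours, in the
  -- three possible cyclic positions; these have the opposite sign by `neg`.
  sep_two : n = 4 → ∀ i, I i → ¬ I (i + 2)
  pos : ∀ i j k, i < j → j < k → k < i + n → ¬ (k = i + 2 ∧ I j) → ¬ (i + n = j + 2 ∧ I k) →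
    ¬ (j + n = k + 2 ∧ I (i + n)) → 0 < orient (v i) (v j) (v k)
  neg : ∀ i, I (i + 1) → orient (v i) (v (i + 1)) (v (i + 2)) < 0

namespace AlmostConvex

variable {n : ℕ} {v : ℕ → Plane} {I : ℕ → Prop} (C : AlmostConvex n v I)

include C

theorem shift (s : ℕ) : AlmostConvex n (fun i => v (i + s)) (fun i => I (i + s)) where
  four_le := C.four_le
  per i := by simpa only [show i + n + s = i + s + n by omega] using C.per (i + s)
  perI i := by simpa only [show i + n + s = i + s + n by omega] using C.perI (i + s)
  sep i := by simpa only [show i + 1 + s = i + s + 1 by omega] using C.sep (i + s)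
  sep_two h i := by simpa only [show i + 2 + s = i + s + 2 by omega] using C.sep_two h (i + s)
  pos i j k h1 h2 h3 e1 e2 e3 := C.pos _ _ _ (by omega) (by omega) (by omega)
    (fun h => e1 ⟨by omega, h.2⟩) (fun h => e2 ⟨by omega, h.2⟩)
    (fun h => e3 ⟨by omega, by rw [show i + n + s = i + s + n by omega]; exact h.2⟩)
  neg i h := by
    simpa only [show i + 1 + s = i + s + 1 by omega, show i + 2 + s = i + s + 2 by omega] using
      C.neg (i + s) (by rwa [show i + s + 1 = i + 1 + s by omega])

theorem orient_ne_zero {i j k : ℕ} (h1 : i < j) (h2 : j < k) (h3 : k < i + n) :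
    orient (v i) (v j) (v k) ≠ 0 := by
  by_cases e1 : k = i + 2 ∧ I j
  · obtain rfl : j = i + 1 := by omega
    rw [e1.1]; exact (C.neg i e1.2).ne
  by_cases e2 : i + n = j + 2 ∧ I k
  · obtain rfl : k = j + 1 := by omega
    have := C.neg j e2.2
    rw [← e2.1, C.per, ← orient_rotate] at this
    exact this.ne
  by_cases e3 : j + n = k + 2 ∧ I (i + n)
  · have h : i + n = k + 1 := by omega
    have := C.neg k (h ▸ e3.2)
    rw [← e3.1, ← h, C.per, C.per, orient_rotate] at this
    exact this.ne
  exact (C.pos i j k h1 h2 h3 e1 e2 e3).ne'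

theorem ne_of_lt {i j : ℕ} (h1 : i < j) (h2 : j < i + n) : v i ≠ v j := by
  intro he
  have := C.four_le
  by_cases h : j + 1 < i + n
  · have := C.orient_ne_zero h1 (Nat.lt_succ_self j) h
    rw [he] at this
    simp at this
  · have := C.orient_ne_zero (Nat.lt_succ_self i) (show i + 1 < j by omega) h2
    rw [he] at this
    simp at this

/-- The segment of two neighbours of an inner point. -/
def _root_.TwoLayer.IsSkip (n : ℕ) (I : ℕ → Prop) (a b : ℕ) : Prop :=
  (b = a + 2 ∧ I (a + 1)) ∨ (a = b + 2 ∧ I (b + 1)) ∨ (a = 0 ∧ b + 2 = n ∧ I (b + 1)) ∨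
    (b = 0 ∧ a + 2 = n ∧ I (a + 1))

omit C in
theorem _root_.TwoLayer.IsSkip.symm {a b : ℕ} (h : IsSkip n I a b) : IsSkip n I b a := by
  unfold IsSkip at *; tauto

variable (h0 : ¬ I 0)

include h0

theorem pos_of_lt {i j k : ℕ} (h1 : i < j) (h2 : j < k) (h3 : k < n) (e1 : ¬ (k = i + 2 ∧ I j))
    (e2 : ¬ (i = 0 ∧ n = j + 2 ∧ I k)) : 0 < orient (v i) (v j) (v k) := by
  refine C.pos i j k h1 h2 (by omega) e1 (fun h => e2 ⟨by omega, by omega, h.2⟩) fun h => ?_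
  obtain rfl : i = 0 := by omega
  exact h0 ((C.perI 0).1 h.2)

theorem not_segCompat {a b c d : ℕ} (hab : a < b) (hbc : b < c) (hcd : c < d) (hd : d < n)
    (hac : ¬ IsSkip n I a c) (hbd : ¬ IsSkip n I b d) : ¬ SegCompat (v a) (v c) (v b) (v d) := by
  refine not_segCompat_of_cross (C.pos_of_lt h0 hab hbc (by omega) ?_ ?_)
    (C.pos_of_lt h0 (hab.trans hbc) hcd hd ?_ ?_)
    (C.pos_of_lt h0 hab (hbc.trans hcd) hd ?_ ?_) (C.pos_of_lt h0 hbc hcd hd ?_ ?_)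
  · rintro ⟨e, hI⟩
    exact hac (Or.inl ⟨e, by rwa [show a + 1 = b by omega]⟩)
  · omega
  · omega
  · rintro ⟨e, e', hI⟩
    exact hac (Or.inr (Or.inr (Or.inl ⟨e, e'.symm, by rwa [show c + 1 = d by omega]⟩)))
  · omega
  · omega
  · rintro ⟨e, hI⟩
    exact hbd (Or.inl ⟨e, by rwa [show b + 1 = c by omega]⟩)
  · omega

end AlmostConvex

/-! ### Parity of crossings of chords in the cyclic order. -/

/-- The indicator of `a < b`. -/
def below (a b : ℕ) : ZMod 2 := if a < b then 1 else 0

/-- The parity of the crossings of two chords. -/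
def crossing (a a' b b' : ℕ) : ZMod 2 := below a b + below a b' + below a' b + below a' b'

theorem crossing_swap_left (a a' b b' : ℕ) : crossing a' a b b' = crossing a a' b b' := by
  unfold crossing; ring

theorem crossing_swap_right (a a' b b' : ℕ) : crossing a a' b' b = crossing a a' b b' := by
  unfold crossing; ring

theorem zmod_two_add_self (x : ZMod 2) : x + x = 0 := CharTwo.add_self_eq_zero x

theorem sum_range_add_succ (f : ℕ → ZMod 2) (i₀ s : ℕ) :
    ∑ i ∈ Finset.range s, (f (i₀ + i) + f (i₀ + i + 1)) = f i₀ + f (i₀ + s) := by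
  induction s with
  | zero => simp [zmod_two_add_self]
  | succ s ih =>
    rw [Finset.sum_range_succ, ih]
    have := zmod_two_add_self (f (i₀ + s))
    linear_combination this

/-- Modulo 2 the contributions of intermediate vertices cancel, so a path crosses a chord with the
same parity as the chord joining its ends. -/
theorem sum_crossing_left (g : ℕ → ℕ) (b b' i₀ s : ℕ) :
    ∑ i ∈ Finset.range s, crossing (g (i₀ + i)) (g (i₀ + i + 1)) b b' =
      crossing (g i₀) (g (i₀ + s)) b b' := by
  rw [show crossing (g i₀) (g (i₀ + s)) b b' = (below (g i₀) b + below (g i₀) b') +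
    (below (g (i₀ + s)) b + below (g (i₀ + s)) b') by unfold crossing; ring,
    ← sum_range_add_succ (fun i => below (g i) b + below (g i) b')]
  exact Finset.sum_congr rfl fun i _ => by unfold crossing; ring

theorem sum_crossing_right (g : ℕ → ℕ) (a a' j₀ t : ℕ) :
    ∑ j ∈ Finset.range t, crossing a a' (g (j₀ + j)) (g (j₀ + j + 1)) =
      crossing a a' (g j₀) (g (j₀ + t)) := by
  rw [show crossing a a' (g j₀) (g (j₀ + t)) = (below a (g j₀) + below a' (g j₀)) +
    (below a (g (j₀ + t)) + below a' (g (j₀ + t))) by unfold crossing; ring,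
    ← sum_range_add_succ (fun i => below a (g i) + below a' (g i))]
  exact Finset.sum_congr rfl fun i _ => by unfold crossing; ring

/-- Two paths all of whose edges cross evenly, apart from exceptional edges of either path that
cross the whole other path evenly, have endpoints that do not separate each other. -/
theorem crossing_eq_zero (g : ℕ → ℕ) {i₀ s j₀ t : ℕ} {A B : ℕ → Prop}
    (hA : ∀ i < s, A i → crossing (g (i₀ + i)) (g (i₀ + i + 1)) (g j₀) (g (j₀ + t)) = 0)
    (hB : ∀ j < t, B j → crossing (g i₀) (g (i₀ + s)) (g (j₀ + j)) (g (j₀ + j + 1)) = 0)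
    (hAB : ∀ i < s, ∀ j < t, (A i ↔ B j) →
      crossing (g (i₀ + i)) (g (i₀ + i + 1)) (g (j₀ + j)) (g (j₀ + j + 1)) = 0) :
    crossing (g i₀) (g (i₀ + s)) (g j₀) (g (j₀ + t)) = 0 := by
  classical
  let X : ℕ → ℕ → ZMod 2 := fun i j =>
    crossing (g (i₀ + i)) (g (i₀ + i + 1)) (g (j₀ + j)) (g (j₀ + j + 1))
  have hrow : ∀ i < s, A i → ∑ j ∈ Finset.range t, X i j = 0 := fun i hi h => by
    rw [← hA i hi h]; exact sum_crossing_right g _ _ _ _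
  have hcol : ∀ j < t, B j → ∑ i ∈ Finset.range s, X i j = 0 := fun j hj h => by
    rw [← hB j hj h]; exact sum_crossing_left g _ _ _ _
  have htot : ∑ i ∈ Finset.range s, ∑ j ∈ Finset.range t, X i j =
      crossing (g i₀) (g (i₀ + s)) (g j₀) (g (j₀ + t)) := by
    rw [← sum_crossing_left]
    exact Finset.sum_congr rfl fun i _ => sum_crossing_right g _ _ _ _
  rw [← htot]
  -- Every row sum may be restricted to the columns in B: in an ordinary row the other entries
  -- vanish, and in an exceptional row both sums are zero. The restricted total is then a sum of
  -- full columns in B, each of which is zero.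
  have h1 : ∀ i ∈ Finset.range s, ∑ j ∈ Finset.range t, X i j =
      ∑ j ∈ Finset.range t, if B j then X i j else 0 := fun i hi => by
    by_cases h : A i
    · rw [hrow i (Finset.mem_range.1 hi) h]
      refine (Finset.sum_eq_zero fun j hj => ?_).symm
      split_ifs with hb
      · exact hAB i (Finset.mem_range.1 hi) j (Finset.mem_range.1 hj) (by tauto)
      · rfl
    · refine Finset.sum_congr rfl fun j hj => ?_
      split_ifs with hb
      · rfl
      · exact hAB i (Finset.mem_range.1 hi) j (Finset.mem_range.1 hj) (by tauto)
  rw [Finset.sum_congr rfl h1, Finset.sum_comm]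
  refine Finset.sum_eq_zero fun j hj => ?_
  by_cases hb : B j
  · simp only [if_pos hb]; exact hcol j (Finset.mem_range.1 hj) hb
  · simp [hb]

/-- Chords that are disjoint as segments do not separate each other. -/
theorem AlmostConvex.crossing_of_segCompat {n : ℕ} {v : ℕ → Plane} {I : ℕ → Prop}
    (C : AlmostConvex n v I) (h0 : ¬ I 0) {a a' b b' : ℕ} (ha : a < n) (ha' : a' < n) (hb : b < n)
    (hb' : b' < n) (h1 : a ≠ b) (h2 : a ≠ b') (h3 : a' ≠ b) (h4 : a' ≠ b')
    (hs : ¬ IsSkip n I a a') (ht : ¬ IsSkip n I b b')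
    (H : SegCompat (v a) (v a') (v b) (v b')) : crossing a a' b b' = 0 := by
  wlog hab : a ≤ a' generalizing a a'
  · rw [← crossing_swap_left]
    exact this ha' ha h3 h4 h1 h2 (fun h => hs h.symm) H.flip_left (by omega)
  wlog hbb : b ≤ b' generalizing b b'
  · rw [← crossing_swap_right]
    exact this hb' hb (fun h => ht h.symm) h2 h1 h4 h3 H.flip_right (by omega)
  by_cases c1 : a < b ∧ b < a' ∧ a' < b'
  · exact absurd H (C.not_segCompat h0 c1.1 c1.2.1 c1.2.2 hb' hs ht)
  by_cases c2 : b < a ∧ a < b' ∧ b' < a'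
  · exact absurd H.symm (C.not_segCompat h0 c2.1 c2.2.1 c2.2.2 ha' ht hs)
  unfold crossing below
  split_ifs <;> first | omega | decide

/-! ### Pockets of polygons on points in almost convex position -/

namespace AlmostConvex

variable {n : ℕ} {v : ℕ → Plane} {I : ℕ → Prop} (C : AlmostConvex n v I) (h0 : ¬ I 0)

include C h0

theorem not_inner_of_isSkip {a b : ℕ} (h : IsSkip n I a b) : ¬ I a ∧ ¬ I b := by
  rcases h with ⟨rfl, h⟩ | ⟨rfl, h⟩ | ⟨rfl, h, h'⟩ | ⟨rfl, h, h'⟩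
  · exact ⟨fun ha => C.sep _ ha h, C.sep _ h⟩
  · exact ⟨C.sep _ h, fun ha => C.sep _ ha h⟩
  · exact ⟨h0, fun ha => C.sep _ ha h'⟩
  · exact ⟨fun ha => C.sep _ ha h', h0⟩

variable {g : ℕ → ℕ} (hlt : ∀ i, g i < n) (g0 : g 0 = 0)
  (inj : ∀ i j, i < j → j < i + n → g i ≠ g j)
  (comp : ∀ i j, i < j → j < n → SegCompat (v (g i)) (v (g (i + 1))) (v (g j)) (v (g (j + 1))))
  (h1 : I 1)

include hlt g0 inj comp h1

/-- A chain of inner points between the endpoints of the segment of two neighbours of an inner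
point has a right turn. -/
theorem exists_right_turn {k : ℕ} (hk : 1 ≤ k) (hkn : k + 1 < n)
    (hin : ∀ d, 1 ≤ d → d ≤ k → I (g d)) (hend : g (k + 1) = 2) :
    ∃ d < k, orient (v (g d)) (v (g (d + 1))) (v (g (d + 2))) < 0 := by
  have h4 := C.four_le
  have h2 : ¬ I 2 := C.sep 1 h1
  by_contra hcon
  push Not at hcon
  rcases hk.eq_or_lt with rfl | hk2
  · have ht := hcon 0 (by omega)
    rw [g0, zero_add, hend] at ht
    have a1 := inj 0 1 (by omega) (by omega)
    have a2 := inj 1 2 (by omega) (by omega)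
    rw [g0] at a1
    rw [show g 2 = 2 from hend] at a2
    by_cases hx : g 1 = 1
    · rw [hx] at ht
      have := C.neg 0 h1
      linarith
    · have := C.pos_of_lt h0 (i := 0) (j := 2) (k := g 1) (by omega) (by omega) (hlt 1)
        (fun h => h2 h.2) (fun h => by
          have h5 := C.sep_two (by omega) 1 h1
          have := hlt 1
          rw [show g 1 = 1 + 2 by omega] at h
          exact h5 h.2.2)
      rw [orient_swap] at ht
      linarith
  -- Without right turns and crossings the chain can only advance in the cyclic order, so it cannot
  -- come back to the position 2 after two or more inner points.
  have hmono : ∀ d ≤ k, ∀ l ≤ d, g l < g (l + 1) := by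
    intro d
    induction d with
    | zero =>
      intro _ l hl
      obtain rfl : l = 0 := by omega
      have := inj 0 1 (by omega) (by omega)
      rw [g0] at *
      exact Nat.pos_of_ne_zero this.symm
    | succ d ih =>
      intro hd l hl
      have ih' := ih (by omega)
      rcases Nat.lt_or_ge l (d + 1) with hl' | hl'
      · exact ih' l (by omega)
      obtain rfl : l = d + 1 := by omega
      by_contra hle
      have n1 := inj (d + 1) (d + 2) (by omega) (by omega)
      have n2 := inj d (d + 2) (by omega) (by omega)
      have hcb : g (d + 2) < g (d + 1) := by
        rcases lt_trichotomy (g (d + 1)) (g (d + 2)) with h | h | h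
        · exact absurd h hle
        · exact absurd h n1
        · exact h
      have hab := ih' d le_rfl
      have hIb := hin (d + 1) (by omega) hd
      rcases lt_or_gt_of_ne n2 with hac | hca
      · have := C.pos_of_lt h0 hac hcb (hlt _)
          (fun h => C.sep (g (d + 2)) h.2 (by rwa [show g (d + 2) + 1 = g (d + 1) by omega]))
          (fun h => by
            have hd0 : d = 0 := by
              by_contra hne
              have := inj 0 d (by omega) (by omega)
              rw [g0] at this
              exact this h.1.symm
            subst hd0
            have := hlt 1
            refine C.sep (g 2) (hin 2 (by omega) hk2) ?_
            rwa [show g 2 + 1 = g 1 by simp only [zero_add] at *; omega])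
        have ht := hcon d (by omega)
        rw [orient_swap] at ht
        linarith
      -- The chain steps back into a gap it has already passed over, so the new edge crosses the
      -- edge that spans this gap.
      · have hex : ∃ l, l + 1 ≤ d ∧ g l < g (d + 2) ∧ g (d + 2) < g (l + 1) := by
          by_contra hno
          push Not at hno
          have : ∀ l ≤ d, g l < g (d + 2) := fun l => by
            induction l with
            | zero =>
              intro _
              have := inj 0 (d + 2) (by omega) (by omega)
              rw [g0] at *
              omega
            | succ l ihl =>
              intro hl
              have a1 := hno l hl (ihl (by omega))
              have a2 := inj (l + 1) (d + 2) (by omega) (by omega)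
              omega
          have := this d le_rfl
          omega
        obtain ⟨l, l1, l2, l3⟩ := hex
        have hle : g (l + 1) ≤ g d := by
          have : ∀ t, l + 1 + t ≤ d → g (l + 1) ≤ g (l + 1 + t) := fun t => by
            induction t with
            | zero => intro _; exact le_rfl
            | succ t iht =>
              intro h
              exact (iht (by omega)).trans (ih' (l + 1 + t) (by omega)).le
          have := this (d - (l + 1)) (by omega)
          rwa [show l + 1 + (d - (l + 1)) = d by omega] at this
        have := C.not_segCompat h0 l2 l3 (show g (l + 1) < g (d + 1) by omega) (hlt _)
          (fun h => (C.not_inner_of_isSkip h0 h).2 (hin (l + 1) (by omega) (by omega)))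
          (fun h => (C.not_inner_of_isSkip h0 h).2 hIb)
        exact this (comp l (d + 1) (by omega) (by omega)).flip_right
  have m1 := hmono k le_rfl k le_rfl
  have m2 := hmono k le_rfl (k - 1) (by omega)
  rw [show k - 1 + 1 = k by omega] at m2
  have := inj 0 (k - 1) (by omega) (by omega)
  rw [g0] at this
  rw [hend] at m1
  omega

variable (hgn : g n = 0)

include hgn

/-- At a left turn of the polygon the next outer point is the neighbouring one. -/
theorem next_outer_eq {k e : ℕ} (hin : ∀ d, 1 ≤ d → d ≤ k → I (g d)) (hout : ¬ I (g (k + 1)))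
    (he : e < n) (hge : g e = 2) (hke : k + 1 ≤ e)
    (hturn : 0 ≤ orient (v (g (n - 1))) (v (g 0)) (v (g 1))) : g (k + 1) = 2 := by
  have h4 := C.four_le
  have h2 : ¬ I 2 := C.sep 1 h1
  by_contra hne
  have hke' : k + 1 < e := by
    rcases hke.eq_or_lt with h | h
    · rw [← h] at hge; exact absurd hge hne
    · exact h
  have hp0 := inj 0 (k + 1) (by omega) (by omega)
  have hx0 := inj 0 1 (by omega) (by omega)
  have hw0 := inj 0 (n - 1) (by omega) (by omega)
  have hxw := inj 1 (n - 1) (by omega) (by omega)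
  rw [g0] at hp0 hx0 hw0 hturn
  have hp1 : g (k + 1) ≠ 1 := fun h => hout (by rw [h]; exact h1)
  have hx2 : g 1 ≠ 2 := by
    rcases Nat.eq_zero_or_pos k with rfl | hk
    · exact hne
    · intro h; exact h2 (h ▸ hin 1 le_rfl hk)
  rw [orient_rotate] at hturn
  -- The left turn at 0 fixes the cyclic order of the two polygon neighbours of 0. The only
  -- exception is the triple in which g 1 is an inner point between g (n - 1) and 0.
  have hxlt : g 1 < g (n - 1) ∨ (g (n - 1) + 2 = n ∧ I (g 1) ∧ g 1 = g (n - 1) + 1) := by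
    by_contra hcon
    push Not at hcon
    have := C.pos_of_lt h0 (i := 0) (j := g (n - 1)) (k := g 1) (by omega) (by omega) (hlt 1)
      (fun h => hx2 (by omega)) (fun h => hcon.2 (by omega) h.2.2 (by have := hlt 1; omega))
    rw [orient_swap] at hturn
    linarith
  have hw2 : g (n - 1) ≠ 2 := by
    intro hw
    rcases hxlt with h | h
    · rw [hw, show g 1 = 1 by omega] at hturn
      have := C.neg 0 h1
      linarith
    · have := C.sep_two (by omega) 1 h1
      rw [show g 1 = 1 + 2 by omega] at h
      exact this h.2.1
  have hns : ∀ i < k + 1, ¬ IsSkip n I (g i) (g (i + 1)) := by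
    intro i hi hs
    have hs' := C.not_inner_of_isSkip h0 hs
    rcases Nat.eq_zero_or_pos k with rfl | hk
    · obtain rfl : i = 0 := by omega
      rw [g0] at hs
      rcases hs with ⟨h, _⟩ | ⟨h, _⟩ | ⟨_, h, h'⟩ | ⟨h, _⟩
      · exact hne (by omega)
      · omega
      · simp only [zero_add] at h h'
        rcases hxlt with hlt' | hlt'
        · have hw := hlt (n - 1)
          have := C.neg (g 1) h'
          rw [h, ← zero_add n, C.per, ← orient_rotate] at this
          rw [show g (n - 1) = g 1 + 1 by omega] at hturn
          linarith
        · exact hout hlt'.2.1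
      · omega
    · rcases Nat.eq_zero_or_pos i with rfl | hi'
      · exact hs'.2 (hin 1 le_rfl hk)
      · exact hs'.1 (hin i hi' (by omega))
  -- The path from 0 to the next outer vertex is compared with the one from 2 back to 0. Their
  -- contact at 0 counts as even because of the left turn, whereas the ends would give an odd
  -- crossing if the next outer vertex were not 2.
  have key := crossing_eq_zero g (i₀ := 0) (s := k + 1) (j₀ := e) (t := n - e)
    (A := fun _ => False) (B := fun j => IsSkip n I (g (e + j)) (g (e + j + 1)))
    (fun _ _ h => h.elim) ?_ ?_
  · rw [show e + (n - e) = n by omega, hgn, hge, g0, zero_add] at key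
    have : crossing 0 (g (k + 1)) 2 0 = 1 := by
      unfold crossing below
      rw [if_pos (by omega), if_neg (by omega), if_neg (by omega), if_neg (by omega)]
      decide
    rw [this] at key
    exact absurd key (by decide)
  · intro j hj hs
    rw [g0, zero_add]
    have b1 := inj 0 (e + j) (by omega) (by omega)
    have b2 := inj (k + 1) (e + j) (by omega) (by omega)
    have b3 := inj (k + 1) (e + j + 1) (by omega) (by omega)
    rw [g0] at b1
    have b5 : g (e + j + 1) = 0 → g (e + j) ≠ 2 := by
      intro h h'
      rcases (show e + j + 1 ≤ n by omega).eq_or_lt with hn | hn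
      · rw [show e + j = n - 1 by omega] at h'
        exact hw2 h'
      · have := inj 0 (e + j + 1) (by omega) (by omega)
        rw [g0, h] at this
        exact this rfl
    have hpn := hlt (k + 1)
    have ho : ∀ y, I (y + 1) → g (k + 1) ≠ y + 1 := fun y hy h => hout (h ▸ hy)
    unfold crossing below
    rcases hs with ⟨h, h'⟩ | ⟨h, h'⟩ | ⟨h, _, _⟩ | ⟨h, h'', h'⟩
    · have := ho _ h'
      split_ifs <;> first | omega | decide
    · have := ho _ h'
      split_ifs <;> first | omega | decide
    · exact absurd h.symm b1
    · have := ho _ h'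
      split_ifs <;> first | omega | decide
  · intro i hi j hj hiff
    have hs : ¬ IsSkip n I (g (e + j)) (g (e + j + 1)) := fun h => hiff.2 h
    simp only [zero_add] at *
    by_cases hsh : i = 0 ∧ e + j + 1 = n
    · obtain ⟨rfl, hn⟩ := hsh
      rw [hn, hgn, g0, show e + j = n - 1 by omega]
      rw [show e + j = n - 1 by omega, show n - 1 + 1 = n by omega, hgn] at hs
      have hlt' : g 1 < g (n - 1) := by
        rcases hxlt with h | h
        · exact h
        · exact absurd (Or.inr (Or.inr (Or.inr ⟨rfl, h.1, h.2.2 ▸ h.2.1⟩))) hs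
      simp only [zero_add]
      unfold crossing below
      rw [if_pos (by omega), if_neg (by omega), if_pos hlt', if_neg (by omega)]
      decide
    · refine C.crossing_of_segCompat h0 (hlt _) (hlt _) (hlt _) (hlt _)
        (inj _ _ (by omega) (by omega)) ?_
        (inj _ _ (by omega) (by omega)) (inj _ _ (by omega) (by omega)) (hns i hi) hs
        (comp _ _ (by omega) (by omega))
      rcases Nat.eq_zero_or_pos i with rfl | hi'
      · exact inj _ _ (by omega) (by omega)
      · exact inj _ _ (by omega) (by omega)

/-- An inner point is a right turn if its two neighbours are joined by an edge. -/
theorem right_turn_of_edge (h12 : g 1 = 2) {e : ℕ} (he0 : 1 < e) (he : e < n) (hge : g e = 1) :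
    orient (v (g (e - 1))) (v (g e)) (v (g (e + 1))) < 0 := by
  have h4 := C.four_le
  have h2 : ¬ I 2 := C.sep 1 h1
  by_contra hturn
  rw [not_lt, hge] at hturn
  have hB : ∀ j, 1 ≤ j → j < e → 2 ≤ g j := fun j hj hje => by
    have a1 := inj 0 j (by omega) (by omega)
    have a2 := inj j e hje (by omega)
    omega
  have hA : ∀ i, e < i → i < n → 3 ≤ g i := fun i hi hin => by
    have a1 := inj 0 i (by omega) (by omega)
    have a2 := inj e i hi (by omega)
    have a3 := inj 1 i (by omega) (by omega)
    omega
  have hu := hB (e - 1) (by omega) (by omega)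
  have hwn : e + 1 < n := by
    by_contra hcon
    have hen : e + 1 = n := by omega
    rw [hen, hgn] at hturn
    have hu2 : g (e - 1) ≠ 2 := by
      rw [← h12]
      exact (inj 1 (e - 1) (by omega) (by omega)).symm
    have := C.pos_of_lt h0 (i := 0) (j := 1) (k := g (e - 1)) (by omega) (by omega) (hlt _)
      (by omega) (by omega)
    rw [orient_swap_left, ← orient_rotate] at hturn
    have e1 : orient (v (g (e - 1))) (v 1) (v 0) = -orient (v 0) (v 1) (v (g (e - 1))) := by
      simp only [orient_eq]; ring
    simp only [orient_eq] at *
    linarith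
  have hw := hA (e + 1) (by omega) hwn
  -- A left turn at the inner point 1 orders its two polygon neighbours.
  have hwu : g (e + 1) < g (e - 1) := by
    by_contra hcon
    have := inj (e - 1) (e + 1) (by omega) (by omega)
    have := C.pos_of_lt h0 (i := 1) (j := g (e - 1)) (k := g (e + 1)) (by omega) (by omega) (hlt _)
      (fun h => h2 (by rw [show (2 : ℕ) = g (e - 1) by omega]; exact h.2)) (by omega)
    rw [orient_rotate, orient_swap] at hturn
    linarith
  -- The paths from 2 to 1 and from 1 to 0 meet only at 1, where the left turn makes their contact
  -- even; yet their ends give an odd crossing.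
  have key := crossing_eq_zero g (i₀ := e) (s := n - e) (j₀ := 1) (t := e - 1)
    (A := fun i => IsSkip n I (g (e + i)) (g (e + i + 1)))
    (B := fun j => IsSkip n I (g (1 + j)) (g (1 + j + 1))) ?_ ?_ ?_
  · rw [show e + (n - e) = n by omega, show 1 + (e - 1) = e by omega, hgn, hge, h12] at key
    exact absurd key (by decide)
  · intro i hi hs
    rw [show 1 + (e - 1) = e by omega, hge, h12]
    have hn := C.not_inner_of_isSkip h0 hs
    have b1 : 3 ≤ g (e + i) := by
      rcases Nat.eq_zero_or_pos i with rfl | hi'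
      · exact absurd h1 (by rw [← hge]; exact hn.1)
      · exact hA _ (by omega) (by omega)
    have b2 : 3 ≤ g (e + i + 1) ∨ g (e + i + 1) = 0 := by
      rcases (show e + i + 1 ≤ n by omega).eq_or_lt with h | h
      · right; rw [h, hgn]
      · exact Or.inl (hA _ (by omega) h)
    unfold crossing below
    split_ifs <;> first | omega | decide
  · intro j hj hs
    rw [show e + (n - e) = n by omega, hgn, hge]
    have hn := C.not_inner_of_isSkip h0 hs
    have b1 := hB (1 + j) (by omega) (by omega)
    have b2 : 2 ≤ g (1 + j + 1) := by
      rcases (show 1 + j + 1 ≤ e by omega).eq_or_lt with h | h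
      · exact absurd h1 (by rw [← hge, ← h]; exact hn.2)
      · exact hB _ (by omega) h
    unfold crossing below
    split_ifs <;> first | omega | decide
  · intro i hi j hj hiff
    by_cases hsh : i = 0 ∧ 1 + j + 1 = e
    · obtain ⟨rfl, hj'⟩ := hsh
      rw [hj', add_zero, hge, show 1 + j = e - 1 by omega]
      unfold crossing below
      rw [if_pos (by omega), if_neg (by omega), if_pos hwu, if_neg (by omega)]
      decide
    have d1 : g (1 + j) ≠ g (e + i) := inj _ _ (by omega) (by omega)
    have d2 : g (1 + j) ≠ g (e + i + 1) := inj _ _ (by omega) (by omega)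
    have d3 : g (1 + j + 1) ≠ g (e + i) := inj _ _ (by omega) (by omega)
    have d4 : g (1 + j + 1) ≠ g (e + i + 1) := inj _ _ (by omega) (by omega)
    by_cases hs : IsSkip n I (g (e + i)) (g (e + i + 1))
    · have ht := hiff.1 hs
      have hn := C.not_inner_of_isSkip h0 hs
      have hn' := C.not_inner_of_isSkip h0 ht
      have f : ∀ y z, I (y + 1) → ¬ I z → z ≠ y + 1 := fun y z hy hz h => hz (h ▸ hy)
      have b1 := hB (1 + j) (by omega) (by omega)
      have l1 := hlt (1 + j)
      have l2 := hlt (1 + j + 1)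
      unfold crossing below
      rcases hs with ⟨h, h'⟩ | ⟨h, h'⟩ | ⟨h, h'', h'⟩ | ⟨h, h'', h'⟩ <;>
      rcases ht with ⟨k, k'⟩ | ⟨k, k'⟩ | ⟨k, k'', k'⟩ | ⟨k, k'', k'⟩ <;>
      · have f1 := f _ _ h' hn'.1
        have f2 := f _ _ h' hn'.2
        have f3 := f _ _ k' hn.1
        have f4 := f _ _ k' hn.2
        split_ifs <;> first | omega | decide
    · exact C.crossing_of_segCompat h0 (hlt _) (hlt _) (hlt _) (hlt _) d1.symm d3.symm d2.symm
        d4.symm hs (fun h => hs (hiff.2 h)) (comp _ _ (by omega) (by omega)).symm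

/-- In a polygon on points in almost convex position, an inner point is a right turn, or there is
a right turn among its preceding neighbour and the inner points that the polygon visits next. -/
theorem exists_right_turn_near (hg : ∀ i, g (i + n) = g i) (surj : ∀ x < n, ∃ i < n, g i = x) :
    ∃ d < n, orient (v (g (d + n - 1))) (v (g (d + n))) (v (g (d + n + 1))) < 0 ∧
      (g d = 1 ∨ ∀ l, 0 < l → l ≤ d → I (g l)) := by
  classical
  have h4 := C.four_le
  have h2 : ¬ I 2 := C.sep 1 h1
  have hT : ∀ d, 1 ≤ d → orient (v (g (d + n - 1))) (v (g (d + n))) (v (g (d + n + 1))) =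
      orient (v (g (d - 1))) (v (g d)) (v (g (d + 1))) := fun d hd => by
    rw [show d + n - 1 = d - 1 + n by omega, show d + n + 1 = d + 1 + n by omega, hg, hg, hg]
  by_contra hcon
  push Not at hcon
  obtain ⟨e, he, hge⟩ := surj 2 (by omega)
  have he0 : e ≠ 0 := by rintro rfl; omega
  have hex : ∃ k, ¬ I (g (k + 1)) := ⟨e - 1, by rwa [show e - 1 + 1 = e by omega, hge]⟩
  -- The number of inner points visited immediately after the outer vertex 0.
  set k := Nat.find hex with hk
  have hout : ¬ I (g (k + 1)) := Nat.find_spec hex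
  have hke : k + 1 ≤ e := by
    have := Nat.find_min' hex (m := e - 1) (by rwa [show e - 1 + 1 = e by omega, hge])
    omega
  have hin : ∀ d, 1 ≤ d → d ≤ k → I (g d) := fun d h1 h2 => by
    have := Nat.find_min hex (m := d - 1) (by omega)
    rwa [not_not, show d - 1 + 1 = d by omega] at this
  have ht0 : 0 ≤ orient (v (g (n - 1))) (v (g 0)) (v (g 1)) := by
    by_contra hlt0
    refine (hcon 0 (by omega) ?_).2.elim fun l hl => absurd hl.2.1 (by omega)
    have e1 := hg 0
    have e2 := hg 1
    rw [show 0 + n + 1 = 1 + n by omega, e2, e1, show 0 + n - 1 = n - 1 by omega]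
    exact not_le.1 hlt0
  have hend := C.next_outer_eq h0 hlt g0 inj comp h1 hgn hin hout he hge hke ht0
  rcases Nat.eq_zero_or_pos k with hk0 | hkpos
  · rw [hk0] at hend
    obtain ⟨f, hf, hgf⟩ := surj 1 (by omega)
    have hf1 : 1 < f := by
      rcases f with _ | _ | f
      · omega
      · simp only [zero_add] at *; omega
      · omega
    have := C.right_turn_of_edge h0 hlt g0 inj comp h1 hgn hend hf1 hf hgf
    rw [← hT f (by omega)] at this
    exact (hcon f hf this).1 hgf
  · obtain ⟨d, hd, hlt0⟩ := C.exists_right_turn h0 hlt g0 inj comp h1 hkpos (by omega) hin hend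
    have := hT (d + 1) (by omega)
    rw [show d + 1 - 1 = d by omega] at this
    rw [← show d + 1 + 1 = d + 2 by omega, ← this] at hlt0
    obtain ⟨l, l1, l2, l3⟩ := (hcon (d + 1) (by omega) hlt0).2
    exact l3 (hin l l1 (by omega))

end AlmostConvex

/-! ### Counting right turns -/

namespace AlmostConvex

variable {n : ℕ} {v : ℕ → Plane} {I : ℕ → Prop} (C : AlmostConvex n v I)

include C

theorem apply_mod (i : ℕ) : v (i % n) = v i := periodic_mod C.per i

theorem inner_mod (i : ℕ) : I (i % n) ↔ I i :=
  iff_of_eq (periodic_mod (fun i => propext (C.perI i)) i)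

/-- The conclusion of `exists_right_turn_near` for an arbitrary inner point `j + 1`. -/
theorem exists_right_turn_of_inner {g : ℕ → ℕ} (hlt : ∀ i, g i < n) (hg : ∀ i, g (i + n) = g i)
    (inj : ∀ i j, g i = g j → i % n = j % n) (surj : ∀ x < n, ∃ i < n, g i = x)
    (comp : ∀ i j, i % n ≠ j % n →
      SegCompat (v (g i)) (v (g (i + 1))) (v (g j)) (v (g (j + 1))))
    {j : ℕ} (hj : I (j + 1)) :
    ∃ t d, g t = j % n ∧
      orient (v (g (t + d + n - 1))) (v (g (t + d + n))) (v (g (t + d + n + 1))) < 0 ∧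
      (g (t + d) = (j + 1) % n ∨ ∀ l, 0 < l → l ≤ d → I (g (t + l))) := by
  have h4 := C.four_le
  obtain ⟨t, ht, hgt⟩ := surj (j % n) (Nat.mod_lt _ (by omega))
  set r := j % n with hr
  have hrn : r < n := Nat.mod_lt _ (by omega)
  have hI1 : I (1 + r) := by
    rw [← C.inner_mod, hr, Nat.add_mod_mod, C.inner_mod, add_comm]; exact hj
  have key : ∀ i, (g (i + t) + n - r) % n + r = g (i + t) ∨
      (g (i + t) + n - r) % n + r = g (i + t) + n := by
    intro i
    have := hlt (i + t)
    rcases Nat.lt_or_ge (g (i + t)) r with h | h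
    · right; rw [Nat.mod_eq_of_lt (by omega)]; omega
    · left
      rw [show g (i + t) + n - r = g (i + t) - r + n by omega, Nat.add_mod_right,
        Nat.mod_eq_of_lt (by omega)]
      omega
  have hv : ∀ i, v ((g (i + t) + n - r) % n + r) = v (g (i + t)) := fun i => by
    rcases key i with h | h <;> rw [h]
    exact C.per _
  have hI : ∀ i, I ((g (i + t) + n - r) % n + r) ↔ I (g (i + t)) := fun i => by
    rcases key i with h | h <;> rw [h]
    exact C.perI _
  -- The labels are rotated by r and the polygon is restarted at t, so that the outer neighbour
  -- becomes 0 and the given inner point becomes 1.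
  obtain ⟨d, hd, hT, hor⟩ := (C.shift r).exists_right_turn_near
    (g := fun i => (g (i + t) + n - r) % n)
    (by rw [zero_add]; intro h; exact C.sep r h (by rwa [add_comm]))
    (fun i => Nat.mod_lt _ (by omega))
    (by simp only [zero_add]; rw [hgt, show r + n - r = n by omega, Nat.mod_self])
    (fun i k hik hki he => by
      have h1 := key i
      have h2 := key k
      rw [he] at h1
      have l1 := hlt (i + t)
      have l2 := hlt (k + t)
      have := inj (i + t) (k + t) (by omega)
      have m1 := Nat.div_add_mod (i + t) n
      have m2 := Nat.div_add_mod (k + t) n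
      rw [this] at m1
      have hq : n * ((k + t) / n) = n * ((i + t) / n) + (k - i) := by omega
      rcases Nat.lt_or_ge ((i + t) / n) ((k + t) / n) with hlt' | hge
      · have := Nat.mul_le_mul_left n (show (i + t) / n + 1 ≤ (k + t) / n from hlt')
        rw [Nat.mul_add, Nat.mul_one] at this
        omega
      · have := Nat.mul_le_mul_left n hge
        omega)
    (fun i k hik hkn => by
      simp only [hv]
      have := comp (i + t) (k + t) (fun h => by
        have := (Nat.ModEq.add_right_cancel' t h : i ≡ k [MOD n])
        rw [Nat.ModEq, Nat.mod_eq_of_lt (by omega), Nat.mod_eq_of_lt hkn] at this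
        omega)
      rwa [show i + t + 1 = i + 1 + t by omega, show k + t + 1 = k + 1 + t by omega] at this)
    hI1
    (by rw [add_comm n t, hg, hgt, show r + n - r = n by omega, Nat.mod_self])
    (fun i => by rw [show i + n + t = i + t + n by omega, hg])
    (fun x hx => by
      obtain ⟨i, hi, hgi⟩ := surj ((x + r) % n) (Nat.mod_lt _ (by omega))
      obtain ⟨k, k1, k2, k3⟩ := exists_mod_eq (show 0 < n by omega) i t
      refine ⟨k - t, by omega, ?_⟩
      rw [Nat.sub_add_cancel k1, ← periodic_mod hg k, k3, periodic_mod hg, hgi]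
      rcases Nat.lt_or_ge (x + r) n with h | h
      · rw [Nat.mod_eq_of_lt h, show x + r + n - r = x + n by omega, Nat.add_mod_right,
          Nat.mod_eq_of_lt hx]
      · rw [Nat.mod_eq_sub_mod h, Nat.mod_eq_of_lt (a := x + r - n) (by omega),
          show x + r - n + n - r = x by omega, Nat.mod_eq_of_lt hx])
  refine ⟨t, d, hgt, ?_, ?_⟩
  · simp only [hv] at hT
    rwa [show d + n - 1 + t = t + d + n - 1 by omega, show d + n + t = t + d + n by omega,
      show d + n + 1 + t = t + d + n + 1 by omega] at hT
  · rcases hor with h | h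
    · left
      have hkey := key d
      rw [h] at hkey
      rw [Nat.add_comm t d, ← Nat.mod_eq_of_lt (hlt (d + t))]
      have e1 : (j + 1) % n = (1 + r) % n := by rw [hr, Nat.add_mod_mod, add_comm]
      rw [e1]
      rcases hkey with h' | h' <;> rw [h']
      rw [Nat.add_mod_right]
    · right
      intro l l1 l2
      have := h l l1 l2
      rw [hI] at this
      rwa [add_comm t l]

/-- Every polygon on points in almost convex position has, in each direction, right turns at at
least half as many vertices as there are inner points. -/
theorem card_inner_le {p : Fin n → Plane} (hp : IsSimplePolygon p)
    (hrange : ∀ y, (∃ i, p i = y) ↔ ∃ x < n, v x = y) {J : Finset ℕ}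
    (hJ : ∀ j ∈ J, j < n ∧ I j) :
    J.card ≤ 2 * {i : Fin n | orient (p (prev i)) (p i) (p (next i)) < 0}.ncard := by
  classical
  have h4 := C.four_le
  have hn : 0 < n := by omega
  choose pos hpos hvp using fun i => (hrange (p i)).1 ⟨i, rfl⟩
  let τ : ℕ → Fin n := fun t => ⟨t % n, Nat.mod_lt _ hn⟩
  let g : ℕ → ℕ := fun t => pos (τ t)
  have hvg : ∀ t, v (g t) = p (τ t) := fun t => hvp _
  have hτ1 : ∀ t, τ (t + 1) = next (τ t) := fun t => Fin.ext (by simp [τ, next_val])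
  have hτn : ∀ t, τ (t + n) = τ t := fun t => Fin.ext (by simp [τ])
  have hg : ∀ t, g (t + n) = g t := fun t => by simp only [g, hτn]
  have hinj : ∀ i j, g i = g j → i % n = j % n := fun i j h => by
    have h1 : p (τ i) = p (τ j) := by rw [← hvg, ← hvg, h]
    exact congrArg Fin.val (hp.2.1 h1)
  have hlt : ∀ t, g t < n := fun t => hpos _
  have hsurj : ∀ x < n, ∃ i < n, g i = x := fun x hx => by
    obtain ⟨i, hi⟩ := (hrange (v x)).2 ⟨x, hx, rfl⟩
    refine ⟨i, i.2, ?_⟩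
    have h1 : v (g i) = v x := by
      rw [hvg, ← hi]
      congr 1
      exact Fin.ext (Nat.mod_eq_of_lt i.2)
    have h2 := hlt i
    rcases lt_trichotomy (g i) x with h | h | h
    · exact absurd h1 (C.ne_of_lt h (by omega))
    · exact h
    · exact absurd h1.symm (C.ne_of_lt h (by omega))
  have hcomp : ∀ i j, i % n ≠ j % n →
      SegCompat (v (g i)) (v (g (i + 1))) (v (g j)) (v (g (j + 1))) := fun i j hij => by
    rw [hvg, hvg, hvg, hvg, hτ1, hτ1]
    exact hp.2.2 (τ i) (τ j) fun h => hij (congrArg Fin.val h)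
  set F := {i : Fin n | orient (p (prev i)) (p i) (p (next i)) < 0} with hF
  have hturn : ∀ t, orient (v (g (t + n - 1))) (v (g (t + n))) (v (g (t + n + 1))) < 0 →
      τ t ∈ F := fun t ht => by
    have e1 : next (τ (t + n - 1)) = τ t := by
      rw [← hτ1, show t + n - 1 + 1 = t + n by omega, hτn]
    have e2 : prev (τ t) = τ (t + n - 1) := by
      rw [← e1]; exact (finRotate n).symm_apply_apply _
    rw [hvg, hvg, hvg, hτ1, hτn, ← e2] at ht
    exact ht
  -- Each right turn offers two places: one for the inner point at that vertex, the other for the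
  -- inner point whose preceding neighbour starts the run of inner vertices leading to it.
  let r : ℕ → Fin n × Bool → Prop := fun j y =>
    if y.2 = true then g y.1 = j else
      ∃ t d, y.1 = τ (t + d) ∧ g t = (j + n - 1) % n ∧ ∀ l, 0 < l → l ≤ d → I (g (t + l))
  rw [Set.ncard_eq_toFinset_card' F, mul_comm]
  have hcard : (F.toFinset ×ˢ (Finset.univ : Finset Bool)).card = F.toFinset.card * 2 := by
    rw [Finset.card_product]; simp
  rw [← hcard]
  refine Finset.card_le_card_of_forall_subsingleton r (fun j hj => ?_) ?_
  · obtain ⟨hjn, hIj⟩ := hJ j hj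
    obtain ⟨t, d, h1, h2, h3⟩ := C.exists_right_turn_of_inner hlt hg hinj hsurj hcomp
      (j := j + n - 1) (by rw [show j + n - 1 + 1 = j + n by omega, C.perI]; exact hIj)
    rw [show j + n - 1 + 1 = j + n by omega, Nat.add_mod_right, Nat.mod_eq_of_lt hjn] at h3
    have hmem := hturn _ h2
    rcases h3 with h3 | h3
    · refine ⟨(τ (t + d), true), by simpa using hmem, ?_⟩
      simp only [r, if_true]
      rw [← h3]
      exact periodic_mod hg (t + d)
    · refine ⟨(τ (t + d), false), by simpa using hmem, ?_⟩
      simp only [r, Bool.false_eq_true, if_false]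
      exact ⟨t, d, rfl, h1, h3⟩
  · rintro ⟨x, b⟩ _ j ⟨hj, hj'⟩ k ⟨hk, hk'⟩
    cases b with
    | true =>
      simp only [r, if_true] at hj' hk'
      exact hj'.symm.trans hk'
    | false =>
      simp only [r, Bool.false_eq_true, if_false] at hj' hk'
      wlog hle : hj'.choose_spec.choose ≤ hk'.choose_spec.choose generalizing j k
      · exact (this hk hj hk' hj' (by omega)).symm
      obtain ⟨j1, j2, j3⟩ := hj'.choose_spec.choose_spec
      obtain ⟨k1, k2, k3⟩ := hk'.choose_spec.choose_spec
      set t := hj'.choose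
      set d := hj'.choose_spec.choose
      set t' := hk'.choose
      set d' := hk'.choose_spec.choose
      -- Two runs ending at the same vertex have the same start, for otherwise the start of the
      -- shorter one, an outer point, would be an inner vertex of the longer one.
      have hmod : (t + d) % n = (t' + (d' - d) + d) % n := by
        rw [show t' + (d' - d) + d = t' + d' by omega]
        exact congrArg Fin.val (j1.symm.trans k1)
      have hmod' : t % n = (t' + (d' - d)) % n := Nat.ModEq.add_right_cancel' d hmod
      have hgt : g t = g (t' + (d' - d)) := by
        rw [← periodic_mod hg t, hmod', periodic_mod hg]
      have hjn := (hJ j hj).1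
      have hkn := (hJ k hk).1
      rcases hle.eq_or_lt with he | hl
      · rw [he, Nat.sub_self, add_zero, j2, k2] at hgt
        have h1 : (j + n - 1) % n + 1 ≡ (k + n - 1) % n + 1 [MOD n] := by rw [hgt]
        have h2 : j + n - 1 + 1 ≡ k + n - 1 + 1 [MOD n] :=
          (((Nat.mod_modEq _ _).add_right 1).symm.trans h1).trans
            ((Nat.mod_modEq _ _).add_right 1)
        rw [show j + n - 1 + 1 = j + n by omega, show k + n - 1 + 1 = k + n by omega] at h2
        have h3 : j % n = k % n := Nat.ModEq.add_right_cancel' n h2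
        rwa [Nat.mod_eq_of_lt hjn, Nat.mod_eq_of_lt hkn] at h3
      · exfalso
        have h1 := k3 (d' - d) (by omega) (by omega)
        rw [← hgt, j2, C.inner_mod] at h1
        refine C.sep _ h1 ?_
        rw [show j + n - 1 + 1 = j + n by omega, C.perI]
        exact (hJ j hj).2

omit C in
theorem _root_.TwoLayer.rev_next (i : Fin n) : Fin.rev (next i) = prev (Fin.rev i) := by
  apply Fin.ext
  rw [Fin.val_rev, next_val, prev_val, Fin.val_rev]
  have := i.2
  rcases (show (i : ℕ) + 1 ≤ n from this).eq_or_lt with h | h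
  · rw [h, Nat.mod_self, Nat.sub_self, zero_add, zero_add, Nat.mod_eq_of_lt (by omega)]
  · rw [Nat.mod_eq_of_lt h, show n - ((i : ℕ) + 1) + (n - 1) = n - ((i : ℕ) + 1 + 1) + n by omega,
      Nat.add_mod_right, Nat.mod_eq_of_lt (by omega)]

omit C in
theorem _root_.TwoLayer.rev_prev (i : Fin n) : Fin.rev (prev i) = next (Fin.rev i) := by
  have := rev_next (Fin.rev i)
  rw [Fin.rev_rev] at this
  rw [← this, Fin.rev_rev]

omit C in
theorem _root_.TwoLayer.IsSimplePolygon.rev {p : Fin n → Plane} (hp : IsSimplePolygon p) :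
    IsSimplePolygon (fun i => p (Fin.rev i)) := by
  refine ⟨hp.1, hp.2.1.comp Fin.rev_injective, fun i j hij => ?_⟩
  have key : ∀ i : Fin n, next (Fin.rev (next i)) = Fin.rev i := fun i => by rw [rev_next, next_prev]
  have := hp.2.2 (Fin.rev (next i)) (Fin.rev (next j))
    (fun h => hij ((finRotate n).injective (Fin.rev_injective h)))
  unfold edge at *
  rw [key, key] at this
  simp only
  rw [segment_symm ℝ (p (Fin.rev i)), segment_symm ℝ (p (Fin.rev j)), Set.pair_comm (p (Fin.rev i)),
    Set.pair_comm (p (Fin.rev j))]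
  exact this

/-- A clockwise polygon is reversed, which makes its reflex vertices right turns; the count of right
turns does not depend on the sign of the area. -/
theorem card_inner_le_reflexCount {p : Fin n → Plane} (hp : IsSimplePolygon p)
    (hrange : ∀ y, (∃ i, p i = y) ↔ ∃ x < n, v x = y) {J : Finset ℕ}
    (hJ : ∀ j ∈ J, j < n ∧ I j) : J.card ≤ 2 * reflexCount p := by
  have h4 := C.four_le
  have hne : ∀ i : Fin n, next i ≠ i := fun i h => by
    have := congrArg Fin.val h
    rw [next_val] at this
    have hi := i.2
    rcases (show (i : ℕ) + 1 ≤ n from hi).eq_or_lt with h' | h'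
    · rw [h', Nat.mod_self] at this; omega
    · rw [Nat.mod_eq_of_lt h'] at this; omega
  have h1 : ∀ i, p (next i) ≠ p i := fun i h => hne i (hp.2.1 h)
  have h2 : ∀ i, p (prev i) ≠ p i := fun i h => by
    have := hp.2.1 h
    have h3 := next_prev i
    rw [this] at h3
    exact hne i h3
  unfold reflexCount
  by_cases ha : 0 < signedArea p
  · have := C.card_inner_le hp hrange hJ
    simpa only [isReflex_iff_of_area_pos ha (h1 _) (h2 _)] using this
  · have := C.card_inner_le hp.rev (fun y => by
      rw [← hrange]
      exact ⟨fun ⟨i, hi⟩ => ⟨_, hi⟩, fun ⟨i, hi⟩ => ⟨Fin.rev i, by rwa [Fin.rev_rev]⟩⟩) hJ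
    refine this.trans (Nat.mul_le_mul_left 2 ?_)
    simp only [isReflex_iff_of_area_nonpos ha (h1 _) (h2 _)]
    refine Set.ncard_le_ncard_of_injOn Fin.rev (fun i hi => ?_) Fin.rev_injective.injOn
      (Set.toFinite _)
    rw [Set.mem_ofPred_eq, rev_prev, rev_next] at hi
    exact hi

end AlmostConvex

/-! ### The layers of a set in almost convex position -/

theorem mem_frontier_of_support {X : Set Plane} {x w : Plane} (hx : x ∈ X) (hw : x ≠ w)
    (h : ∀ y ∈ X, 0 ≤ orient x w y) : x ∈ frontier (convexHull ℝ X) := by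
  refine ⟨subset_closure (subset_convexHull ℝ X hx), fun hint => ?_⟩
  have := orient_pos_of_mem_interior hint hw h
  simp at this

namespace AlmostConvex

variable {n : ℕ} {v : ℕ → Plane} {I : ℕ → Prop} (C : AlmostConvex n v I)

include C

theorem exists_index_from (s t : ℕ) : ∃ s', t ≤ s' ∧ s' < t + n ∧ v s' = v s ∧ (I s' ↔ I s) := by
  obtain ⟨k, h1, h2, h3⟩ := exists_mod_eq (show 0 < n by have := C.four_le; omega) s t
  exact ⟨k, h1, h2, by rw [← C.apply_mod k, h3, C.apply_mod],
    by rw [← C.inner_mod k, h3, C.inner_mod]⟩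

/-- The supporting line goes to the next point, or to the one after it if the next point is inner.
-/
theorem outer_mem_frontier {t : ℕ} (ht : ¬ I t) :
    v t ∈ frontier (convexHull ℝ (Set.range v)) := by
  have h4 := C.four_le
  by_cases h1 : I (t + 1)
  · refine mem_frontier_of_support ⟨t, rfl⟩ (C.ne_of_lt (j := t + 2) (by omega) (by omega)) ?_
    rintro _ ⟨s, rfl⟩
    obtain ⟨s', k1, k2, k3, -⟩ := C.exists_index_from s t
    rw [← k3]
    rcases Nat.lt_or_ge (t + 2) s' with hs | hs
    · refine (C.pos t (t + 2) s' (by omega) hs k2 (by omega) (fun h => ?_)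
        fun h => ht ((C.perI t).1 h.2)).le
      refine C.sep_two (by omega) _ h1 ?_
      rw [show t + 1 + 2 = s' by omega]; exact h.2
    · obtain rfl | rfl | rfl : s' = t ∨ s' = t + 1 ∨ s' = t + 2 := by omega
      · simp
      · rw [orient_swap]; linarith [C.neg t h1]
      · simp
  · refine mem_frontier_of_support ⟨t, rfl⟩ (C.ne_of_lt (j := t + 1) (by omega) (by omega)) ?_
    rintro _ ⟨s, rfl⟩
    obtain ⟨s', k1, k2, k3, -⟩ := C.exists_index_from s t
    rw [← k3]
    rcases Nat.lt_or_ge (t + 1) s' with hs | hs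
    · exact (C.pos t (t + 1) s' (by omega) hs k2 (fun h => h1 h.2) (by omega)
        fun h => ht ((C.perI t).1 h.2)).le
    · obtain rfl | rfl : s' = t ∨ s' = t + 1 := by omega
      · simp
      · simp

/-- The point lies strictly inside the triangle of v t, v (t + 2) and v (t + 3), so a supporting
line through it would have to contain v t and v (t + 2). -/
theorem inner_notMem_frontier {t : ℕ} (ht : I (t + 1)) :
    v (t + 1) ∉ frontier (convexHull ℝ (Set.range v)) := by
  have h4 := C.four_le
  have hγ := C.neg t ht
  have hα : 0 < orient (v (t + 1)) (v (t + 2)) (v (t + 3)) :=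
    C.pos _ _ _ (by omega) (by omega) (by omega) (fun h => C.sep _ ht h.2) (by omega) (by omega)
  have hβ : 0 < orient (v t) (v (t + 1)) (v (t + 3)) :=
    C.pos _ _ _ (by omega) (by omega) (by omega) (by omega) (by omega)
      (fun h => C.sep t ((C.perI t).1 h.2) ht)
  rintro ⟨-, hint⟩
  have hne : (interior (convexHull ℝ (Set.range v))).Nonempty := by
    rw [Set.nonempty_iff_ne_empty]
    intro h
    exact hγ.ne (orient_eq_zero_of_interior_empty h ⟨t, rfl⟩ ⟨t + 1, rfl⟩ ⟨t + 2, rfl⟩)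
  obtain ⟨w, hw, hs⟩ := exists_support hne hint
  have f1 := hs (v t) ⟨t, rfl⟩
  have f2 := hs (v (t + 2)) ⟨t + 2, rfl⟩
  have f3 := hs (v (t + 3)) ⟨t + 3, rfl⟩
  have hid : orient (v (t + 1)) (v (t + 2)) (v (t + 3)) * orient (v (t + 1)) w (v t) +
      orient (v t) (v (t + 1)) (v (t + 3)) * orient (v (t + 1)) w (v (t + 2)) =
      orient (v t) (v (t + 1)) (v (t + 2)) * orient (v (t + 1)) w (v (t + 3)) := by
    simp only [orient_eq]; ring
  have g1 := mul_nonneg hα.le f1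
  have g2 := mul_nonneg hβ.le f2
  have g3 := mul_nonpos_of_nonpos_of_nonneg hγ.le f3
  have z1 : orient (v (t + 1)) w (v t) = 0 :=
    (mul_eq_zero.1 (by linarith : orient (v (t + 1)) (v (t + 2)) (v (t + 3)) * _ = 0)).resolve_left
      hα.ne'
  have z2 : orient (v (t + 1)) w (v (t + 2)) = 0 :=
    (mul_eq_zero.1 (by linarith : orient (v t) (v (t + 1)) (v (t + 3)) * _ = 0)).resolve_left
      hβ.ne'
  exact hγ.ne (orient_eq_zero_of_collinear hw.symm z1 (by simp) z2)

theorem inner_mem_frontier {t : ℕ} (ht : I t) :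
    v t ∈ frontier (convexHull ℝ (v '' {s | I s})) := by
  have h4 := C.four_le
  refine mem_frontier_of_support ⟨t, ht, rfl⟩ (C.ne_of_lt (j := t + 1) (by omega) (by omega)) ?_
  rintro _ ⟨s, hs, rfl⟩
  obtain ⟨s', k1, k2, k3, k4⟩ := C.exists_index_from s t
  have hs' : I s' := k4.2 hs
  rw [← k3]
  rcases Nat.lt_or_ge (t + 1) s' with hlt | hge
  · exact (C.pos t (t + 1) s' (by omega) hlt k2 (fun h => C.sep _ ht h.2) (by omega)
      fun h => C.sep _ hs' (by rw [show s' + 1 = t + n by omega]; exact h.2)).le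
  · obtain rfl | rfl : s' = t ∨ s' = t + 1 := by omega
    · simp
    · simp

theorem hasLayers {t : ℕ} (ht : I t) : HasLayers (Set.range v) 2 := by
  have h4 := C.four_le
  have hrem : remaining (Set.range v) 1 = v '' {s | I s} := by
    ext y
    constructor
    · rintro ⟨⟨s, rfl⟩, hs⟩
      by_contra hcon
      exact hs (C.outer_mem_frontier fun h => hcon ⟨s, h, rfl⟩)
    · rintro ⟨s, hs, rfl⟩
      refine ⟨⟨s, rfl⟩, ?_⟩
      have := C.inner_notMem_frontier (t := s + n - 1)
        (by rw [show s + n - 1 + 1 = s + n by omega, C.perI]; exact hs)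
      rwa [show s + n - 1 + 1 = s + n by omega, C.per] at this
  have hempty : ∀ i, remaining (Set.range v) (i + 2) = ∅ := fun i => by
    induction i with
    | zero =>
      rw [Set.eq_empty_iff_forall_notMem]
      rintro y ⟨hy, hy'⟩
      rw [hrem] at hy hy'
      obtain ⟨s, hs, rfl⟩ := hy
      exact hy' (C.inner_mem_frontier hs)
    | succ i ih =>
      rw [Set.eq_empty_iff_forall_notMem]
      rintro y ⟨hy, -⟩
      rw [show i + 1 + 1 = i + 2 by omega, ih] at hy
      exact hy
  intro i
  rcases i with _ | _ | i
  · exact ⟨fun _ => by norm_num, fun _ => ⟨v (t + 1), ⟨_, rfl⟩,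
      C.outer_mem_frontier (C.sep _ ht)⟩⟩
  · refine ⟨fun _ => by norm_num, fun _ => ⟨v t, ?_, ?_⟩⟩
    · rw [zero_add, hrem]; exact ⟨t, ht, rfl⟩
    · rw [zero_add, hrem]; exact C.inner_mem_frontier ht
  · refine ⟨fun ⟨y, hy, _⟩ => ?_, fun h => absurd h (by omega)⟩
    rw [show i + 1 + 1 = i + 2 by omega, hempty i] at hy
    exact hy.elim

/-- The points of an almost convex sequence. -/
theorem exists_finset {t : ℕ} (ht : I t) {J : Finset ℕ} (hJ : ∀ j ∈ J, j < n ∧ I j) :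
    ∃ S : Finset Plane, S.card = n ∧ HasLayers (S : Set Plane) 2 ∧
      ∀ p : Fin S.card → Plane, IsPolygonalization S p → J.card ≤ 2 * reflexCount p := by
  classical
  have h4 := C.four_le
  have hcard : ((Finset.range n).image v).card = n := by
    rw [Finset.card_image_of_injOn, Finset.card_range]
    intro i hi j hj hij
    have hi' := Finset.mem_range.1 hi
    have hj' := Finset.mem_range.1 hj
    rcases lt_trichotomy i j with h | h | h
    · exact absurd hij (C.ne_of_lt h (by omega))
    · exact h
    · exact absurd hij.symm (C.ne_of_lt h (by omega))
  have hmem : ∀ y, y ∈ (Finset.range n).image v ↔ ∃ x < n, v x = y := fun y => by simp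
  set S := (Finset.range n).image v with hS
  have hrange : (S : Set Plane) = Set.range v := by
    ext y
    rw [Finset.mem_coe, hmem]
    constructor
    · rintro ⟨x, _, rfl⟩; exact ⟨x, rfl⟩
    · rintro ⟨x, rfl⟩; exact ⟨x % n, Nat.mod_lt _ (by omega), C.apply_mod x⟩
  clear_value S
  subst hcard
  refine ⟨S, rfl, by rw [hrange]; exact C.hasLayers ht, fun p hp => ?_⟩
  refine C.card_inner_le_reflexCount hp.1 (fun y => ?_) hJ
  rw [← hmem, ← Finset.mem_coe, ← hp.2]
  rfl

end AlmostConvex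

/-! ### Construction of points in almost convex position -/

theorem succ_mod_cases {n : ℕ} (hn : 0 < n) (i : ℕ) :
    ((i + 1) % n = i % n + 1 ∧ i % n + 1 < n) ∨ ((i + 1) % n = 0 ∧ i % n + 1 = n) := by
  have h := Nat.mod_lt i hn
  rw [← Nat.mod_add_mod]
  rcases (show i % n + 1 ≤ n from h).eq_or_lt with h' | h'
  · right; rw [h', Nat.mod_self]; exact ⟨rfl, rfl⟩
  · left; exact ⟨Nat.mod_eq_of_lt h', h'⟩

/-- Any cyclic triple can be rotated into a single period. Since the index 0 is outer, only one
excluded triple wraps around. -/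
theorem AlmostConvex.of_base {n : ℕ} {w : ℕ → Plane} {K : ℕ → Prop} (hn : 4 ≤ n)
    (h0 : ¬ K 0) (hsep : ∀ i, i + 1 < n → K i → ¬ K (i + 1)) (h4 : n = 4 → ¬ K 2 ∧ ¬ K 3)
    (hpos : ∀ i j k, i < j → j < k → k < n → ¬ (k = i + 2 ∧ K j) →
      ¬ (i = 0 ∧ j + 2 = n ∧ K k) → 0 < orient (w i) (w j) (w k))
    (hneg : ∀ i, i + 2 < n → K (i + 1) → orient (w i) (w (i + 1)) (w (i + 2)) < 0)
    (hlast : K (n - 1) → orient (w (n - 2)) (w (n - 1)) (w 0) < 0) :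
    AlmostConvex n (fun i => w (i % n)) (fun i => K (i % n)) where
  four_le := hn
  per i := by simp
  perI i := by simp
  sep i hi := by
    rcases succ_mod_cases (show 0 < n by omega) i with ⟨h, h'⟩ | ⟨h, h'⟩
    · rw [h]; exact hsep _ h' hi
    · rw [h]; exact h0
  sep_two he i hi := by
    subst he
    have h1 : i % 4 ≠ 0 := fun h => h0 (h ▸ hi)
    have h2 : i % 4 ≠ 2 := fun h => (h4 rfl).1 (h ▸ hi)
    have h3 : i % 4 ≠ 3 := fun h => (h4 rfl).2 (h ▸ hi)
    rw [show (i + 2) % 4 = 3 by omega]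
    exact (h4 rfl).2
  pos i j k hij hjk hki e1 e2 e3 := by
    have hdm := Nat.div_add_mod i n
    have hr := Nat.mod_lt i (show 0 < n by omega)
    set q := i / n
    set r := i % n
    obtain ⟨j', rfl⟩ : ∃ j', j = n * q + j' := ⟨j - n * q, by omega⟩
    obtain ⟨k', rfl⟩ : ∃ k', k = n * q + k' := ⟨k - n * q, by omega⟩
    have hm : ∀ x, (n * q + x) % n = x % n := fun x => by simp
    have hbig : ∀ x, n ≤ x → x < 2 * n → x % n = x - n := fun x h1 h2 => by
      rw [Nat.mod_eq_sub_mod h1, Nat.mod_eq_of_lt (by omega)]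
    simp only [hm, Nat.add_mod_right] at e1 e2 e3 ⊢
    rcases Nat.lt_or_ge k' n with hk | hk
    · rw [Nat.mod_eq_of_lt hk] at e2 ⊢
      rw [Nat.mod_eq_of_lt (a := j') (by omega)] at e1 ⊢
      exact hpos _ _ _ (by omega) (by omega) hk (fun h => e1 ⟨by omega, h.2⟩)
        fun h => e2 ⟨by omega, h.2.2⟩
    · rw [hbig k' hk (by omega)] at e2 ⊢
      rcases Nat.lt_or_ge j' n with hj | hj
      · rw [Nat.mod_eq_of_lt hj] at e1 ⊢
        rw [orient_rotate, orient_rotate]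
        exact hpos _ _ _ (by omega) (by omega) hj (fun h => e3 ⟨by omega, h.2⟩)
          fun h => e1 ⟨by omega, h.2.2⟩
      · rw [hbig j' hj (by omega)] at e1 ⊢
        rw [orient_rotate]
        exact hpos _ _ _ (by omega) (by omega) hr (fun h => e2 ⟨by omega, h.2⟩)
          fun h => e3 ⟨by omega, h.2.2⟩
  neg i hi := by
    have hn0 : 0 < n := by omega
    rcases succ_mod_cases hn0 i with ⟨h, h'⟩ | ⟨h, h'⟩
    · rw [h] at hi ⊢
      rcases succ_mod_cases hn0 (i + 1) with ⟨k, k'⟩ | ⟨k, k'⟩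
      · rw [show i + 2 = i + 1 + 1 by omega, k, h]
        rw [h] at k'
        exact hneg _ k' hi
      · rw [show i + 2 = i + 1 + 1 by omega, k]
        rw [h] at k'
        have := hlast (by rwa [show n - 1 = i % n + 1 by omega])
        rwa [show n - 1 = i % n + 1 by omega, show n - 2 = i % n by omega] at this
    · rw [h] at hi
      exact absurd hi h0

/-- This is the numerator in `orient_parabola_top`, with H = 2s and a, b the distances of x, y from
H. The excluded case x = b = 0 is the chord beneath which the closing inner point lies. -/
theorem wrap_pos {x y a b H δ δ' : ℝ} (hx : x = 0 ∨ 1 ≤ x) (hb : b = 0 ∨ 1 ≤ b)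
    (hxb : x ≠ 0 ∨ b ≠ 0) (hxy : x + 1 ≤ y) (ha : x + a = H) (hy : y + b = H) (hH : 4 ≤ H)
    (h1 : 0 ≤ δ) (h2 : δ ≤ 3 / 2) (h3 : 0 ≤ δ') (h4 : δ' ≤ 3 / 2) :
    0 < (y - x) * (a * b + x * y - 1 / 2) + δ * (b - y) - δ' * (a - x) := by
  have hx0 : 0 ≤ x := by rcases hx with h | h <;> linarith
  have hb0 : 0 ≤ b := by rcases hb with h | h <;> linarith
  have hab : a - b = y - x := by linarith
  rcases lt_or_ge a x with hax | hax
  · have q1 : 0 ≤ δ' * (x - a) := mul_nonneg h3 (by linarith)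
    have q2 : δ * (y - b) ≤ 3 / 2 * y := by nlinarith
    have q3 : 2 * y ≤ x * y := by nlinarith
    have q4 : 0 ≤ a * b := mul_nonneg (by linarith) hb0
    have q5 : 2 * y - 1 / 2 ≤ (y - x) * (a * b + x * y - 1 / 2) := by nlinarith
    nlinarith
  · rcases lt_or_ge y b with hyb | hyb
    · have q1 : 0 ≤ δ * (b - y) := mul_nonneg h1 (by linarith)
      have q2 : δ' * (a - x) ≤ 3 / 2 * a := by nlinarith
      have q3 : 2 * a ≤ a * b := by nlinarith
      have q4 : 0 ≤ x * y := mul_nonneg hx0 (by linarith)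
      have q5 : 2 * a - 1 / 2 ≤ (y - x) * (a * b + x * y - 1 / 2) := by nlinarith
      nlinarith
    · have q1 : δ * (y - b) ≤ 3 / 2 * (y - b) := mul_le_mul_of_nonneg_right h2 (by linarith)
      have q2 : δ' * (a - x) ≤ 3 / 2 * (a - x) := mul_le_mul_of_nonneg_right h4 (by linarith)
      have q3 : 4 ≤ a * b + x * y := by
        rcases hx with rfl | hx
        · rcases hb with rfl | hb
          · simp at hxb
          · nlinarith
        · rcases hb with rfl | hb
          · nlinarith
          · nlinarith
      have q4 : (y - x) * (7 / 2) ≤ (y - x) * (a * b + x * y - 1 / 2) :=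
        mul_le_mul_of_nonneg_left (by linarith) (by linarith)
      nlinarith

/-! ### The parabola example. -/

/-- The indices of the inner points in `layeredPoint`. -/
def IsInnerIndex (m t : ℕ) : Prop := t % 2 = 1 ∧ t < 2 * m

open Classical in
/-- The height of the inner points in `layeredPoint` above the parabola. -/
def lift (m t : ℕ) : ℝ := if IsInnerIndex m t then 3 / 2 else 0

/-- The abscissa of the points in `layeredPoint`. -/
def abscissa (m t : ℕ) : ℕ := if t < 2 * m then t else 2 * (t - m)

/-- `h` points of a parabola, in convex position, and `m` points slightly inside the sides
of their convex hull, in their cyclic order. -/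
def layeredPoint (h m t : ℕ) : Plane :=
  -- This index occurs below h + m only for m = h. The point is the midpoint of the chord from (0,
  -- 0) to the last parabola point, at abscissa 2(h - 1), lowered by 1/4 into the hull.
  if t + 1 = 2 * h then !₂[(h : ℝ) - 1, 2 * ((h : ℝ) - 1) ^ 2 - 1 / 4]
  else !₂[(abscissa m t : ℝ), (abscissa m t : ℝ) ^ 2 + lift m t]

theorem lift_nonneg (m t : ℕ) : 0 ≤ lift m t := by unfold lift; split_ifs <;> norm_num

theorem lift_le (m t : ℕ) : lift m t ≤ 3 / 2 := by unfold lift; split_ifs <;> norm_num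

theorem lift_of_not {m t : ℕ} (h : ¬ IsInnerIndex m t) : lift m t = 0 := if_neg h

theorem lift_of_inner {m t : ℕ} (h : IsInnerIndex m t) : lift m t = 3 / 2 := if_pos h

theorem abscissa_lt {m i j : ℕ} (h : i < j) : abscissa m i < abscissa m j := by
  unfold abscissa; split_ifs <;> omega

theorem orient_parabola (x y z α β γ : ℝ) :
    orient !₂[x, x ^ 2 + α] !₂[y, y ^ 2 + β] !₂[z, z ^ 2 + γ] =
      (z - x) * ((y - x) * (z - y) - β) + α * (z - y) + γ * (y - x) := by
  simp only [orient_eq]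
  simp
  ring

theorem orient_parabola_top (x y s α β : ℝ) :
    orient !₂[x, x ^ 2 + α] !₂[y, y ^ 2 + β] !₂[s, 2 * s ^ 2 - 1 / 4] =
      ((y - x) * ((2 * s - x) * (2 * s - y) + x * y - 1 / 2) + α * (2 * s - y - y) -
        β * (2 * s - x - x)) / 2 := by
  simp only [orient_eq]
  simp
  ring

theorem layeredPoint_of_lt {h m t : ℕ} (ht : t + 1 < 2 * h) :
    layeredPoint h m t = !₂[(abscissa m t : ℝ), (abscissa m t : ℝ) ^ 2 + lift m t] :=
  if_neg (by omega)

theorem layeredPoint_last {h m t : ℕ} (ht : t + 1 = 2 * h) :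
    layeredPoint h m t = !₂[(h : ℝ) - 1, 2 * ((h : ℝ) - 1) ^ 2 - 1 / 4] :=
  if_pos ht

theorem orient_layeredPoint_pos {h m i j k : ℕ} (hij : i < j) (hjk : j < k) (hk : k + 1 < 2 * h)
    (hne : ¬ (k = i + 2 ∧ IsInnerIndex m j)) :
    0 < orient (layeredPoint h m i) (layeredPoint h m j) (layeredPoint h m k) := by
  rw [layeredPoint_of_lt (by omega), layeredPoint_of_lt (by omega), layeredPoint_of_lt hk,
    orient_parabola]
  have hx := abscissa_lt (m := m) hij
  have hy := abscissa_lt (m := m) hjk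
  have h1 : (abscissa m i : ℝ) + 1 ≤ abscissa m j := by exact_mod_cast hx
  have h2 : (abscissa m j : ℝ) + 1 ≤ abscissa m k := by exact_mod_cast hy
  have l1 := mul_nonneg (lift_nonneg m i) (by linarith : (0 : ℝ) ≤ abscissa m k - abscissa m j)
  have l2 := mul_nonneg (lift_nonneg m k) (by linarith : (0 : ℝ) ≤ abscissa m j - abscissa m i)
  -- The product of the gaps is the height of the chord above the parabola. It is 1 between the two
  -- neighbours of an inner point and at least 2 in the other cases with an inner middle point; the
  -- lift 3/2 lies in between.
  have main : lift m j < ((abscissa m j : ℝ) - abscissa m i) * (abscissa m k - abscissa m j) := by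
    by_cases hI : IsInnerIndex m j
    · have : (abscissa m i : ℝ) + 2 ≤ abscissa m j ∨ (abscissa m j : ℝ) + 2 ≤ abscissa m k := by
        have : abscissa m i + 2 ≤ abscissa m j ∨ abscissa m j + 2 ≤ abscissa m k := by
          by_contra hcon
          push Not at hcon
          apply hne
          refine ⟨?_, hI⟩
          obtain ⟨a1, a2⟩ := hI
          unfold abscissa at hx hy hcon
          split_ifs at hx hy hcon <;> omega
        exact this.imp (fun h => by exact_mod_cast h) fun h => by exact_mod_cast h
      rw [lift_of_inner hI]
      rcases this with h | h <;> nlinarith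
    · rw [lift_of_not hI]
      exact mul_pos (by linarith) (by linarith)
  have := mul_pos (by linarith : (0 : ℝ) < abscissa m k - abscissa m i) (sub_pos.2 main)
  linarith

theorem almostConvex_layeredPoint {h m : ℕ} (hh : 3 ≤ h) (hm : 1 ≤ m) (hmh : m ≤ h) :
    AlmostConvex (h + m) (fun i => layeredPoint h m (i % (h + m)))
      (fun i => IsInnerIndex m (i % (h + m))) := by
  refine AlmostConvex.of_base (by omega) (by unfold IsInnerIndex; omega)
    (by unfold IsInnerIndex; omega) (by unfold IsInnerIndex; omega) ?_ ?_ ?_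
  · intro i j k hij hjk hk e1 e2
    rcases (show k + 1 ≤ 2 * h by omega).eq_or_lt with hlast | hlt
    · rw [layeredPoint_of_lt (by omega), layeredPoint_of_lt (by omega), layeredPoint_last hlast,
        orient_parabola_top]
      have hx := abscissa_lt (m := m) hij
      have hi : abscissa m i = i := if_pos (by omega)
      have hj : abscissa m j = j := if_pos (by omega)
      have hI : IsInnerIndex m k := by unfold IsInnerIndex; omega
      have hi0 : i ≠ 0 ∨ j + 2 ≠ h + m := by
        by_contra hcon
        push Not at hcon
        exact e2 ⟨hcon.1, hcon.2, hI⟩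
      rw [hi, hj]
      have hjh : j + 2 ≤ 2 * h := by omega
      refine div_pos ?_ two_pos
      refine wrap_pos (H := 2 * ((h : ℝ) - 1)) ?_ ?_ ?_ ?_ (by ring) (by ring) ?_ (lift_nonneg _ _)
        (lift_le _ _) (lift_nonneg _ _) (lift_le _ _)
      · rcases Nat.eq_zero_or_pos i with rfl | h'
        · exact Or.inl (by simp)
        · exact Or.inr (by exact_mod_cast h')
      · rcases hjh.eq_or_lt with h' | h'
        · left
          have : (j : ℝ) + 2 = 2 * h := by exact_mod_cast h'
          linarith
        · right
          have : (j : ℝ) + 2 + 1 ≤ 2 * h := by exact_mod_cast h'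
          linarith
      · rcases hi0 with h' | h'
        · exact Or.inl (by exact_mod_cast h')
        · right
          have : j + 2 < 2 * h := by omega
          have : (j : ℝ) + 2 < 2 * h := by exact_mod_cast this
          linarith
      · exact_mod_cast hij
      · have : (3 : ℝ) ≤ h := by exact_mod_cast hh
        linarith
    · exact orient_layeredPoint_pos hij hjk hlt e1
  · rintro i hi ⟨h1, h2⟩
    rw [layeredPoint_of_lt (by omega), layeredPoint_of_lt (by omega), layeredPoint_of_lt (by omega),
      orient_parabola, lift_of_inner ⟨h1, h2⟩, lift_of_not (by unfold IsInnerIndex; omega),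
      lift_of_not (by unfold IsInnerIndex; omega), show abscissa m i = i from if_pos (by omega),
      show abscissa m (i + 1) = i + 1 from if_pos h2,
      show abscissa m (i + 2) = i + 2 by unfold abscissa; split_ifs <;> omega]
    push_cast
    nlinarith
  · rintro ⟨h1, h2⟩
    have hmh' : m = h := by omega
    subst hmh'
    rw [layeredPoint_of_lt (by omega), layeredPoint_last (by omega), layeredPoint_of_lt (by omega),
      ← orient_rotate, orient_parabola_top, lift_of_not (by unfold IsInnerIndex; omega),
      lift_of_not (by unfold IsInnerIndex; omega),
      show abscissa m 0 = 0 from if_pos (by omega),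
      show abscissa m (m + m - 2) = m + m - 2 from if_pos (by omega)]
    rw [show ((m + m - 2 : ℕ) : ℝ) = 2 * ((m : ℝ) - 1) by
      rw [Nat.cast_sub (by omega)]; push_cast; ring]
    have : (3 : ℝ) ≤ m := by exact_mod_cast hh
    push_cast
    nlinarith

theorem ceil_div_four (n : ℕ) : ⌈(n : ℝ) / 4⌉₊ = (n + 3) / 4 := by
  apply le_antisymm
  · rw [Nat.ceil_le, div_le_iff₀ (by norm_num)]
    exact_mod_cast (by omega : n ≤ (n + 3) / 4 * 4)
  · have := cast_le_ceil (c := (n + 3) / 4) (n := n) (by omega)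
    exact_mod_cast this

/-- Sets with two layers whose reflexivity attains the upper bound. -/
theorem exists_le_reflexivity {n : ℕ} (hn : 4 ≤ n) (h1 : n % 4 ≠ 1) :
    ∃ S : Finset Plane, S.card = n ∧ HasLayers (S : Set Plane) 2 ∧
      (⌈(n : ℝ) / 4⌉₊ : ℕ∞) ≤ reflexivity S := by
  obtain ⟨r, hr⟩ : ∃ r, r = (n + 3) / 4 := ⟨_, rfl⟩
  -- The least number of inner points that forces r reflex vertices. They fit into the sides, m ≤ h
  -- = n - m, exactly because n is not 1 modulo 4.
  obtain ⟨m, hm⟩ : ∃ m, m + 1 = 2 * r := ⟨2 * r - 1, by omega⟩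
  obtain ⟨h, rfl⟩ : ∃ h, n = h + m := ⟨n - m, by omega⟩
  have C := almostConvex_layeredPoint (h := h) (m := m) (by omega) (by omega) (by omega)
  obtain ⟨S, h1, h2, h3⟩ := C.exists_finset (t := 1) (by
      rw [Nat.mod_eq_of_lt (by omega)]; unfold IsInnerIndex; omega)
    (J := (Finset.range m).image fun j => 2 * j + 1) (fun j hj => by
      obtain ⟨i, hi, rfl⟩ := Finset.mem_image.1 hj
      have := Finset.mem_range.1 hi
      rw [Nat.mod_eq_of_lt (by omega)]
      unfold IsInnerIndex
      omega)
  refine ⟨S, h1, h2, le_iInf fun p => ?_⟩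
  have := h3 p.1 p.2
  rw [Finset.card_image_of_injective _ (fun a b hab => by simpa using hab),
    Finset.card_range] at this
  rw [ceil_div_four]
  exact_mod_cast (by omega : (h + m + 3) / 4 ≤ reflexCount p.1)

end TwoLayer

end

theorem theorem5 :
    (∀ (n : ℕ) (S : Finset TwoLayer.Plane), S.card = n → TwoLayer.HasLayers (S : Set TwoLayer.Plane) 2 →
      TwoLayer.reflexivity S ≤ (⌈(n : ℝ) / 4⌉₊ : ℕ∞)) ∧
    (∀ n : ℕ, 4 ≤ n → n % 4 ≠ 1 →
      ∃ S : Finset TwoLayer.Plane, S.card = n ∧ TwoLayer.HasLayers (S : Set TwoLayer.Plane) 2 ∧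
        TwoLayer.reflexivity S = (⌈(n : ℝ) / 4⌉₊ : ℕ∞)) := by
  refine ⟨fun n S hn hS => hn ▸ TwoLayer.reflexivity_le_of_hasLayers hS, fun n hn h1 => ?_⟩
  obtain ⟨S, rfl, hS, hle⟩ := TwoLayer.exists_le_reflexivity hn h1
  exact ⟨S, rfl, hS, le_antisymm (TwoLayer.reflexivity_le_of_hasLayers hS) hle⟩
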